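/- **Setting.** Let $d\ge 0$ be an integer, $\mathbb{E}=\mathbb{R}^d$ Euclidean space, $m\in\mathbb{R}$, and $\mathcal{C}(\mathbb{E})=C^\infty(\mathbb{E},\mathbb{R})$ with its usual Fréchet topology. Let $P\in\mathcal{D}'(\mathbb{E})$ be a real distribution with $(-\Delta+m^2)P=\delta$ that is invariant under $O(d)$, so that the kernel $P(x,y)=P(x-y)$ is invariant under the Euclidean group (for instance, for $m>0$, the one vanishing at infinity). *Functionals.* A functional $F:\mathcal{C}(\mathbb{E})\to\mathbb{C}$ belongs to $\mathcal{F}(\mathbb{E})$ if $\lambda\mapsto F(\varphi+\lambda h)$ is smooth on $\mathbb{R}$ for all $\varphi,h$ and if, for every $n\ge 0$ and every $\varphi$, there is a symmetric distribution of compact support $F^{(n)}(\varphi)\in\mathcal{E}'(\mathbb{E}^n)$ such that $$\langle F^{(n)}(\varphi),h^{\otimes n}\rangle=\frac{d^n}{d\lambda^n}\Big|_{\lambda=0}F(\varphi+\lambda h)\qquad\text{for all }h\in C^\infty(\mathbb{E},\mathbb{R}),$$ where $(\varphi,u)\mapsto\langle F^{(n)}(\varphi),u\rangle$ is jointly continuous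 on $\mathcal{C}(\mathbb{E})\times C^\infty(\mathbb{E}^n,\mathbb{R})$. Put $\operatorname{supp}F=\overline{\bigcup_{\varphi}\operatorname{supp}F^{(1)}(\varphi)}$. For formal power series $F=\sum_n\hbar^nF_n\in\mathcal{F}(\mathbb{E})[[\hbar]]$ put $\operatorname{supp}F=\bigcup_n\operatorname{supp}F_n$. *Product.* For $T\in\mathcal{E}'(\mathbb{E}^k)$ let $P^{\otimes k}T\in\mathcal{D}'(\mathbb{E}^k)$ be the result of applying $f\mapsto P*f$ in each of the $k$ arguments of $T$. If $S\in\mathcal{D}'(\mathbb{E}^k)$ coincides with a smooth function $u\in C^\infty(\mathbb{E}^k,\mathbb{C})$ on a neighbourhood of $\operatorname{supp}T$, put $\langle T,S\rangle:=T(u)$. The Euclidean time-ordered product of two series is $$F\cdot_E G=\sum_{k\ge 0}\frac{\hbar^k}{k!}\big\langle F^{(k)},P^{\otimes k}G^{(k)}\big\rangle,\qquad\text{i.e.}\qquad (F\cdot_EG)_n(\varphi)=\sum_{k+i+j=n}\frac{1}{k!}\big\langle F_i^{(k)}(\varphi),P^{\otimes k}G_j^{(k)}(\varphi)\big\rangle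 .$$ Let $\mathcal{D}=\{(F,G)\in\mathcal{F}(\mathbb{E})[[\hbar]]^2:\operatorname{supp}F\cap\operatorname{supp}G=\emptyset\}$. **Proposition (Partial Algebra of Functionals of Compact Support).** 1. The product is well defined on $\mathcal{D}$: for $(F,G)\in\mathcal{D}$ all pairings $\langle F_i^{(k)}(\varphi),P^{\otimes k}G_j^{(k)}(\varphi)\rangle$ exist and are uniquely determined, and $F\cdot_EG\in\mathcal{F}(\mathbb{E})[[\hbar]]$. Moreover $\operatorname{supp}(F\cdot_EG)_n\subseteq\bigcup_{i\le n}(\operatorname{supp}F_i\cup\operatorname{supp}G_i)$; in particular, if all $\operatorname{supp}F_n$ and $\operatorname{supp}G_n$ are compact, so are all $\operatorname{supp}(F\cdot_EG)_n$. 2. It is bilinear: if $(F,G),(F',G)\in\mathcal{D}$ and $a,b\in\mathbb{C}$, then $(aF+bF',G)$ and $(G,aF+bF')$ are in $\mathcal{D}$, $(aF+bF')\cdot_EG=a\,F\cdot_EG+b\,F'\cdot_EG$ and $G\cdot_E(aF+bF')=a\,G\cdot_EF+b\,G\cdot_EF'$. 3. It is commutative: if $(F,G)\in\mathcal{D}$,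 then $(G,F)\in\mathcal{D}$ and $F\cdot_EG=G\cdot_EF$. 4. It is associative: if $(F,G),(G,H),(F,H)\in\mathcal{D}$, then $(F\cdot_EG,H)\in\mathcal{D}$, $(F,G\cdot_EH)\in\mathcal{D}$ and $(F\cdot_EG)\cdot_EH=F\cdot_E(G\cdot_EH)$. Thus $\mathcal{F}(\mathbb{E})[[\hbar]]$ with $\cdot_E$ is a commutative partial algebra: a vector space with a commutative, associative, bilinear product that is defined only on $\mathcal{D}$. -/

import Mathlib

open scoped Topology ContDiff Distributions LineDeriv
open MeasureTheory TopologicalSpace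

noncomputable section

/-! ### Smooth functions, distributions of compact support -/

/-- `d`-dimensional Euclidean space `𝔼`. -/
abbrev Euc (d : ℕ) : Type := EuclideanSpace ℝ (Fin d)

section SmoothFunctions

variable (X : Type*) [NormedAddCommGroup X] [NormedSpace ℝ X]

/-- The real vector space of smooth functions on `X`, as a subspace of all functions. -/
def smoothSubmodule : Submodule ℝ (X → ℝ) where
  carrier := {f | ContDiff ℝ ∞ f}
  add_mem' := fun {f g} (hf : ContDiff ℝ ∞ f) (hg : ContDiff ℝ ∞ g) => hf.add hg
  zero_mem' := (contDiff_const : ContDiff ℝ ∞ fun _ : X => (0 : ℝ))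
  smul_mem' := fun _ f (hf : ContDiff ℝ ∞ f) => contDiff_const.smul hf

/-- `C^∞(X) = C^∞(X, ℝ)`. -/
def SmoothFun : Type _ := smoothSubmodule X

namespace SmoothFun

instance : AddCommGroup (SmoothFun X) := inferInstanceAs (AddCommGroup (smoothSubmodule X))

instance : Module ℝ (SmoothFun X) := inferInstanceAs (Module ℝ (smoothSubmodule X))

instance : FunLike (SmoothFun X) X ℝ where
  coe f := f.1
  coe_injective _ _ h := Subtype.ext h

variable {X}

/-- A smooth function as an element of `C^∞(X)`. -/
def mk (f : X → ℝ) (hf : ContDiff ℝ ∞ f) : SmoothFun X := ⟨f, hf⟩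

theorem contDiff (f : SmoothFun X) : ContDiff ℝ ∞ f := f.2

/-- The `n`-th derivative of `f`, as a continuous map. -/
def jet (f : SmoothFun X) (n : ℕ) : C(X, X [×n]→L[ℝ] ℝ) :=
  ⟨iteratedFDeriv ℝ n f,
    f.contDiff.continuous_iteratedFDeriv (by exact_mod_cast (le_top : (n : ℕ∞) ≤ ⊤))⟩

/-- The usual Fréchet topology of `C^∞(X)`: locally uniform convergence of all derivatives
(the spaces `C(X, _)` carry the compact-open topology). -/
instance : TopologicalSpace (SmoothFun X) :=
  TopologicalSpace.induced (fun f n => f.jet n) inferInstance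

end SmoothFun

/-- `𝓔'(X)`: complex-valued distributions of compact support, i.e. the dual of `C^∞(X)`. As for
Mathlib's `𝓓'(Ω, ℂ)`, they are tested against real functions. Their support is
`Distribution.dsupport`. -/
abbrev CompDist : Type _ := SmoothFun X →L[ℝ] ℂ

end SmoothFunctions

/-! ### Functionals -/

/-- The configuration space `𝒞(𝔼) = C^∞(𝔼)`. -/
abbrev Config (d : ℕ) : Type := SmoothFun (Euc d)

/-- The tensor power `h^{⊗n} ∈ C^∞(𝔼ⁿ)`, `(x₁, …, xₙ) ↦ h(x₁) ⋯ h(xₙ)`. -/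
def tensorPow {d : ℕ} (n : ℕ) (h : Config d) : SmoothFun (Fin n → Euc d) :=
  SmoothFun.mk (fun x => ∏ i, h (x i))
    (contDiff_prod fun i _ => h.contDiff.comp (contDiff_apply ℝ (Euc d) i))

/-- `(x₁, …, xₙ) ↦ u(x_{σ(1)}, …, x_{σ(n)})`. -/
def permuteVars {d n : ℕ} (σ : Equiv.Perm (Fin n)) (u : SmoothFun (Fin n → Euc d)) :
    SmoothFun (Fin n → Euc d) :=
  SmoothFun.mk (fun x => u (fun i => x (σ i)))
    (u.contDiff.comp (contDiff_pi.2 fun i => contDiff_apply ℝ (Euc d) (σ i)))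

/-- `T φ = F^{(n)}(φ) ∈ 𝓔'(𝔼ⁿ)` for all `φ`: a symmetric distribution in `n` variables with
`⟨F^{(n)}(φ), h^{⊗n}⟩ = dⁿ/dλⁿ|_{λ=0} F(φ + λh)`, depending continuously on `φ`, in the sense that
`(φ, u) ↦ ⟨F^{(n)}(φ), u⟩` is jointly continuous. -/
structure IsFunctionalDeriv {d : ℕ} (F : Config d → ℂ) (n : ℕ)
    (T : Config d → CompDist (Fin n → Euc d)) : Prop where
  symm : ∀ φ (σ : Equiv.Perm (Fin n)) u, T φ (permuteVars σ u) = T φ u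
  continuous : Continuous fun p : Config d × SmoothFun (Fin n → Euc d) => T p.1 p.2
  deriv_eq : ∀ φ h, T φ (tensorPow n h) = iteratedDeriv n (fun t : ℝ => F (φ + t • h)) 0

/-- `F` is smooth, and all its functional derivatives are distributions of compact support. -/
structure IsSmoothFunctional {d : ℕ} (F : Config d → ℂ) : Prop where
  contDiff_line : ∀ φ h, ContDiff ℝ ∞ fun t : ℝ => F (φ + t • h)
  exists_deriv : ∀ n, ∃ T, IsFunctionalDeriv F n T

open Classical in
/-- The functional derivative `F^{(n)}(φ) ∈ 𝓔'(𝔼ⁿ)` of a smooth functional. -/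
def functionalDeriv {d : ℕ} (F : Config d → ℂ) (n : ℕ) (φ : Config d) :
    CompDist (Fin n → Euc d) :=
  if h : ∃ T, IsFunctionalDeriv F n T then h.choose φ else 0

/-- `supp F`, the closure of `⋃_φ supp F^{(1)}(φ)`. -/
def functionalSupport {d : ℕ} (F : Config d → ℂ) : Set (Euc d) :=
  closure (⋃ φ, {x | (fun _ => x) ∈ Distribution.dsupport (functionalDeriv F 1 φ)})

/-- The complex vector space `𝓕(𝔼)`. -/
def Functionals (d : ℕ) : Submodule ℂ (Config d → ℂ) where
  carrier := {F | IsSmoothFunctional F}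
  add_mem' := by
    rintro F G ⟨hF, hF'⟩ ⟨hG, hG'⟩
    refine ⟨fun φ h => (hF φ h).add (hG φ h), fun n => ?_⟩
    obtain ⟨S, hS⟩ := hF' n
    obtain ⟨T, hT⟩ := hG' n
    refine ⟨fun φ => S φ + T φ, ⟨fun φ σ u => ?_, ?_, fun φ h => ?_⟩⟩
    · simp [hS.symm, hT.symm]
    · exact hS.continuous.add hT.continuous
    · have hn : ((n : ℕ∞) : WithTop ℕ∞) ≤ ∞ := by exact_mod_cast (le_top : (n : ℕ∞) ≤ ⊤)
      have := iteratedDeriv_add (x := (0 : ℝ)) ((hF φ h).contDiffAt.of_le hn)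
        ((hG φ h).contDiffAt.of_le hn)
      simpa [hS.deriv_eq, hT.deriv_eq] using! this.symm
  zero_mem' := by
    refine ⟨fun φ h => contDiff_const, fun n => ⟨fun _ => 0, ⟨by simp, ?_, fun φ h => ?_⟩⟩⟩
    · exact continuous_const
    · simp
  smul_mem' := by
    rintro c F ⟨hF, hF'⟩
    refine ⟨fun φ h => contDiff_const.smul (hF φ h), fun n => ?_⟩
    obtain ⟨S, hS⟩ := hF' n
    refine ⟨fun φ => c • S φ, ⟨fun φ σ u => ?_, ?_, fun φ h => ?_⟩⟩
    · simp [hS.symm]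
    · exact hS.continuous.const_smul c
    · simp [hS.deriv_eq]

/-- `𝓕(𝔼)⟦ħ⟧`: the sequence `F` stands for the formal power series `∑ₙ ħⁿ Fₙ`. -/
def FunctionalSeries (d : ℕ) : Submodule ℂ (ℕ → Config d → ℂ) :=
  Submodule.pi Set.univ fun _ => Functionals d

/-- `⋃ₙ supp Fₙ`. No closure is taken, so that disjointness of supports is the weakest condition:
`supp Fᵢ ∩ supp Gⱼ = ∅` for all `i`, `j`. -/
def seriesSupport {d : ℕ} (F : ℕ → Config d → ℂ) : Set (Euc d) :=
  ⋃ n, functionalSupport (F n)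

/-! ### The fundamental solution and the product -/

/-- `P ∈ 𝓓'(𝔼)` solves `(-Δ + m²) P = δ` and is invariant under `O(d)`. The corresponding kernel
`P(x, y) = P(x - y)` is then invariant under the full Euclidean group. -/
structure IsInvariantFundamentalSolution {d : ℕ} (m : ℝ)
    (P : 𝓓'((⊤ : Opens (Euc d)), ℝ)) : Prop where
  helmholtz : -(∑ i : Fin d, ∂_{EuclideanSpace.single i (1 : ℝ)}
      (∂_{EuclideanSpace.single i (1 : ℝ)} P)) + m ^ 2 • P = Distribution.delta 0
  invariant : ∀ (R : Euc d ≃ₗᵢ[ℝ] Euc d) (f g : 𝓓((⊤ : Opens (Euc d)), ℝ)),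
      (∀ x, g x = f (R x)) → P g = P f

open Classical in
/-- `P` applied to a function that is not bundled as a test function. -/
def applyDist {d : ℕ} (P : 𝓓'((⊤ : Opens (Euc d)), ℝ)) (f : Euc d → ℝ) : ℝ :=
  if h : ContDiff ℝ ∞ f ∧ HasCompactSupport f then P ⟨f, h.1, h.2, Set.subset_univ _⟩ else 0

/-- `y ↦ ∫ P(z - yᵢ) f(y₁, …, z, …, yₖ) dz`, with `z` in the `i`-th slot: the transpose of
convolution with `P` in the `i`-th argument. -/
def convolveSlot {d k : ℕ} (P : 𝓓'((⊤ : Opens (Euc d)), ℝ)) (i : Fin k)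
    (f : (Fin k → Euc d) → ℝ) : (Fin k → Euc d) → ℝ :=
  fun y => applyDist P fun z => f (Function.update y i (y i + z))

/-- `y ↦ ∫ P(x₁ - y₁) ⋯ P(xₖ - yₖ) f(x₁, …, xₖ) dx₁ ⋯ dxₖ`. -/
def convolveAll {d k : ℕ} (P : 𝓓'((⊤ : Opens (Euc d)), ℝ))
    (f : (Fin k → Euc d) → ℝ) : (Fin k → Euc d) → ℝ :=
  (List.finRange k).foldr (convolveSlot P) f

/-- `S = P^{⊗k} T ∈ 𝓓'(𝔼ᵏ)`, the map `P : 𝓔'(𝔼) → 𝓓'(𝔼)`, `f ↦ P * f`, being applied in each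
argument of `T ∈ 𝓔'(𝔼ᵏ)`. -/
def IsTensorConvolution {d k : ℕ} (P : 𝓓'((⊤ : Opens (Euc d)), ℝ)) (T : CompDist (Fin k → Euc d))
    (S : 𝓓'((⊤ : Opens (Fin k → Euc d)), ℂ)) : Prop :=
  ∀ f : 𝓓((⊤ : Opens (Fin k → Euc d)), ℝ),
    ∃ h : ContDiff ℝ ∞ (convolveAll P f), S f = T (SmoothFun.mk _ h)

/-- `c = ⟨T, S⟩`, the pairing of `T ∈ 𝓔'` with a distribution `S ∈ 𝓓'` that is smooth near the
support of `T`: on some open `U ⊇ supp T`, `S` is given by a smooth complex function `u + iv`, and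
`c = T(u + iv)`. -/
def IsPairing {d k : ℕ} (T : CompDist (Fin k → Euc d))
    (S : 𝓓'((⊤ : Opens (Fin k → Euc d)), ℂ)) (c : ℂ) : Prop :=
  ∃ (U : Set (Fin k → Euc d)) (u v : SmoothFun (Fin k → Euc d)),
    IsOpen U ∧ Distribution.dsupport T ⊆ U ∧
    (∀ f : 𝓓((⊤ : Opens (Fin k → Euc d)), ℝ), tsupport f ⊆ U →
      S f = ∫ x, (f x : ℂ) * ((u x : ℂ) + Complex.I * (v x : ℂ))) ∧
    c = T u + Complex.I * T v

/-- `c = ⟨T, P^{⊗k} T'⟩`. -/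
def IsContraction {d k : ℕ} (P : 𝓓'((⊤ : Opens (Euc d)), ℝ)) (T T' : CompDist (Fin k → Euc d))
    (c : ℂ) : Prop :=
  ∃ S, IsTensorConvolution P T' S ∧ IsPairing T S c

open Classical in
/-- The number `⟨T, P^{⊗k} T'⟩`, when it is well-defined (otherwise `0`). -/
def contraction {d k : ℕ} (P : 𝓓'((⊤ : Opens (Euc d)), ℝ)) (T T' : CompDist (Fin k → Euc d)) : ℂ :=
  if h : ∃! c, IsContraction P T T' c then h.exists.choose else 0

/-- The Euclidean time-ordered product `∑ₖ ħᵏ/k! ⟨F^{(k)}, P^{⊗k} G^{(k)}⟩` of formal power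
series: its coefficient of `ħⁿ` collects `⟨Fᵢ^{(k)}, P^{⊗k} Gⱼ^{(k)}⟩ / k!` for `k + i + j = n`. -/
def timeOrderedProduct {d : ℕ} (P : 𝓓'((⊤ : Opens (Euc d)), ℝ)) (F G : ℕ → Config d → ℂ) :
    ℕ → Config d → ℂ :=
  fun n φ => ∑ k ∈ Finset.range (n + 1), ∑ ij ∈ Finset.HasAntidiagonal.antidiagonal (n - k),
    (k.factorial : ℂ)⁻¹ *
      contraction P (functionalDeriv (F ij.1) k φ) (functionalDeriv (G ij.2) k φ)

/-- The domain `𝒟` of the product: pairs in `𝓕(𝔼)⟦ħ⟧` with disjoint supports. -/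
def productDomain (d : ℕ) : Set ((ℕ → Config d → ℂ) × (ℕ → Config d → ℂ)) :=
  {p | p.1 ∈ FunctionalSeries d ∧ p.2 ∈ FunctionalSeries d ∧
    Disjoint (seriesSupport p.1) (seriesSupport p.2)}

end

/-! Everything rests on replacing the singular kernel `P(x - y)` by a smooth symmetric one, for
which the product is an honest exponential of a bidifferential operator.

Regularity of `P`. Away from the origin `P` is an even smooth function `p`
(`IsInvariantFundamentalSolution.exists_smooth`). This is a mean value argument: multiplying by `cos
(m t)` in one extra variable `t` turns `Δ - m²` into the Laplacian in `d + 1` variables. Let `W_σ f`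
be the radially weighted average at scale `σ` there. By the fundamental equation, the `σ`-derivative
of `P (W_σ f)` is `σ` times a weighted average of `f` over the ball of radius `σ` about `0`, so it
vanishes for `σ ≤ r` if `f` vanishes on the ball of radius `r`. Hence `P f` is a multiple of `P (W_r
f)`, in which `f` is convolved with a smooth function. For `T`, `T'` with supports at distance at
least `3r`, the pairing `⟨T, P^{⊗k} T'⟩` is therefore `(T ⊗ T')(K^{⊗k})` with `K(x, y) = p(x - y)`
(`contraction_eq_tens`).

Calculus of functionals. The axioms only describe derivatives along lines, tested on `h^{⊗n}`.
Restriction to finite-dimensional spaces, mollification and polarisation show that `F⁽ⁿ⁾` is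
differentiable in every direction with derivative `F⁽ⁿ⁺¹⁾`
(`IsSmoothFunctional.hasDerivAt_functionalDeriv`). Consequently `F⁽ⁿ⁾` is supported in `(supp F)ⁿ`,
and contractions with a smooth kernel obey the product rule and are again smooth functionals
(`isFunctionalDeriv_contr`).

Localisation. Joint continuity confines the supports of `F⁽ᵏ⁾(φ)`, for `φ` near `φ₀`, to one ball. A
compact set and a disjoint closed set have positive distance, so for small `r` one kernel computes
the finitely many contractions in the coefficient of `ħⁿ` near `φ₀`
(`eventually_timeOrderedProduct_eq`). Smoothness of functionals is a local property, so the product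
inherits it from smooth kernels.

Algebra. For `K = ∑ₐ fₐ ⊗ gₐ` the product is multiplication after `exp (ħ D)` with `D = ∑ₐ ∂_{fₐ} ⊗
∂_{gₐ}`. By the Leibniz rule both bracketings of a triple product are multiplication after `exp (ħ
(D₁₂ + D₁₃ + D₂₃))`. Such `K` are dense and both sides are continuous in `K`, which gives
associativity for all smooth kernels (`sum_contr_contr`). Commutativity is Fubini's theorem together
with the evenness of `p`.

The recurrent tool is the density of the span of the exponentials `exp ∘ ℓ` in `C^∞`: continuous
linear identities need only be tested on functions that factor into one-variable functions. -/

open Filter Set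

set_option linter.unusedSectionVars false

noncomputable section

/-! ### The topology of `C^∞(X)` and continuity of the elementary operations -/

section

/-- In finite dimension, multilinear maps converge as soon as they converge pointwise. -/
theorem ContinuousMultilinearMap.tendsto_of_apply {ι X : Type*} [NormedAddCommGroup X]
    [NormedSpace ℝ X] [FiniteDimensional ℝ X] {n : ℕ} {l : Filter ι} {f : ι → X [×n]→L[ℝ] ℝ}
    {a : X [×n]→L[ℝ] ℝ} (h : ∀ v, Tendsto (fun i => f i v) l (𝓝 (a v))) : Tendsto f l (𝓝 a) := by
  let b := Module.finBasis ℝ X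
  let Φ : (X [×n]→L[ℝ] ℝ) →ₗ[ℝ] ((Fin n → Fin (Module.finrank ℝ X)) → ℝ) :=
    { toFun := fun g s => g fun i => b (s i)
      map_add' := fun _ _ => rfl
      map_smul' := fun _ _ => rfl }
  have hΦ : Function.Injective Φ := by
    intro g g' hgg
    apply ContinuousMultilinearMap.toMultilinearMap_injective
    exact Module.Basis.ext_multilinear (fun _ => b) fun v => congrFun hgg v
  have : FiniteDimensional ℝ (X [×n]→L[ℝ] ℝ) := FiniteDimensional.of_injective Φ hΦ
  have hemb := LinearMap.isClosedEmbedding_of_injective (𝕜 := ℝ) (LinearMap.ker_eq_bot.2 hΦ)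
  rw [hemb.isInducing.tendsto_nhds_iff, tendsto_pi_nhds]
  exact fun s => h _

namespace SmoothFun

section Basic

variable {X : Type*} [NormedAddCommGroup X] [NormedSpace ℝ X]

@[simp] theorem mk_apply (f : X → ℝ) (hf : ContDiff ℝ ∞ f) (x : X) : mk f hf x = f x := rfl
@[simp] theorem add_apply (f g : SmoothFun X) (x : X) : (f + g) x = f x + g x := rfl
@[simp] theorem zero_apply (x : X) : (0 : SmoothFun X) x = 0 := rfl
@[simp] theorem neg_apply (f : SmoothFun X) (x : X) : (-f) x = -f x := rfl
@[simp] theorem sub_apply (f g : SmoothFun X) (x : X) : (f - g) x = f x - g x := rfl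
@[simp] theorem smul_apply (c : ℝ) (f : SmoothFun X) (x : X) : (c • f) x = c * f x := rfl

theorem coe_add (f g : SmoothFun X) : ⇑(f + g) = f + g := rfl
theorem coe_smul (c : ℝ) (f : SmoothFun X) : ⇑(c • f) = c • ⇑f := rfl

@[ext] theorem ext {f g : SmoothFun X} (h : ∀ x, f x = g x) : f = g := DFunLike.ext f g h

@[simp] theorem sum_apply {ι : Type*} (s : Finset ι) (f : ι → SmoothFun X) (x : X) :
    (∑ i ∈ s, f i) x = ∑ i ∈ s, f i x := by
  induction s using Finset.cons_induction with
  | empty => simp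
  | cons a s ha ih => simp [ih]

theorem differentiable (f : SmoothFun X) : Differentiable ℝ f :=
  f.contDiff.differentiable (by simp)

theorem continuous (f : SmoothFun X) : Continuous f := f.contDiff.continuous

/-- The derivative in direction `v`. -/
def pd (v : X) (f : SmoothFun X) : SmoothFun X :=
  mk (fun x => fderiv ℝ f x v) ((f.contDiff.fderiv_right (m := ∞) (by simp)).clm_apply contDiff_const)

theorem pd_apply (v : X) (f : SmoothFun X) (x : X) : pd v f x = fderiv ℝ f x v := rfl

/-- The value of the iterated derivative at given vectors. -/
def ipd (n : ℕ) (v : Fin n → X) (f : SmoothFun X) : SmoothFun X :=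
  mk (fun x => iteratedFDeriv ℝ n f x v)
    ((ContinuousMultilinearMap.apply ℝ (fun _ : Fin n => X) ℝ v).contDiff.comp
      (f.contDiff.iteratedFDeriv_right (m := ∞) (i := n) le_rfl))

theorem ipd_apply (n : ℕ) (v : Fin n → X) (f : SmoothFun X) (x : X) :
    ipd n v f x = iteratedFDeriv ℝ n f x v := rfl

theorem ipd_zero (v : Fin 0 → X) (f : SmoothFun X) : ipd 0 v f = f := by
  ext x; simp [ipd_apply]

theorem ipd_succ (n : ℕ) (v : Fin (n + 1) → X) (f : SmoothFun X) :
    ipd (n + 1) v f = pd (v 0) (ipd n (Fin.tail v) f) := by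
  ext x
  rw [ipd_apply, iteratedFDeriv_succ_apply_left, pd_apply]
  have hd : DifferentiableAt ℝ (iteratedFDeriv ℝ n f) x :=
    (f.contDiff.differentiable_iteratedFDeriv (m := n) (by exact_mod_cast ENat.natCast_lt_top n)) x
  have := ((ContinuousMultilinearMap.apply ℝ (fun _ : Fin n => X) ℝ
    (Fin.tail v)).hasFDerivAt.comp x hd.hasFDerivAt).fderiv
  have h2 : (⇑(ipd n (Fin.tail v) f)) =
    (ContinuousMultilinearMap.apply ℝ (fun _ : Fin n => X) ℝ (Fin.tail v)) ∘
      (iteratedFDeriv ℝ n f) := rfl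
  rw [h2, this]; rfl

theorem ipd_pd (n : ℕ) (v : X) (w : Fin n → X) (f : SmoothFun X) :
    ipd n w (pd v f) = ipd (n + 1) (Fin.snoc w v) f := by
  ext x
  rw [ipd_apply, ipd_apply, iteratedFDeriv_succ_apply_right]
  have hd : ContDiffAt ℝ n (fderiv ℝ f) x :=
    (f.contDiff.fderiv_right (m := n) (by exact_mod_cast le_top)).contDiffAt
  have := iteratedFDeriv_clm_apply_const_apply (i := n) (u := v) (m := w) (x := x)
    (f.contDiff.fderiv_right (m := n) (by exact_mod_cast le_top)) le_rfl
  simpa using! this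

theorem pd_add (v : X) (f g : SmoothFun X) : pd v (f + g) = pd v f + pd v g := by
  ext x
  rw [add_apply, pd_apply, pd_apply, pd_apply, coe_add,
    fderiv_add (f.differentiable x) (g.differentiable x)]
  rfl

theorem pd_smul (v : X) (c : ℝ) (f : SmoothFun X) : pd v (c • f) = c • pd v f := by
  ext x
  rw [smul_apply, pd_apply, pd_apply, coe_smul, fderiv_const_smul (f.differentiable x)]
  rfl

theorem pd_pd (v w : X) (f : SmoothFun X) (x : X) :
    pd v (pd w f) x = fderiv ℝ (fderiv ℝ f) x v w := by
  have hd : DifferentiableAt ℝ (fderiv ℝ f) x :=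
    (f.contDiff.fderiv_right (m := ∞) (by simp)).differentiable (by simp) x
  have := (hd.hasFDerivAt.clm_apply (hasFDerivAt_const w x)).fderiv
  have h2 : ⇑(pd w f) = fun y => (fderiv ℝ f y) w := rfl
  rw [pd_apply, h2, this]
  simp

theorem pd_comm (v w : X) (f : SmoothFun X) : pd v (pd w f) = pd w (pd v f) := by
  ext x
  rw [pd_pd, pd_pd]
  exact (f.contDiff.contDiffAt.isSymmSndFDerivAt (x := x) (by
    simpa using WithTop.coe_le_coe.2 (le_top : (2 : ℕ∞) ≤ ⊤))) v w

theorem pd_zero (v : X) : pd v (0 : SmoothFun X) = 0 := by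
  simpa using pd_smul v 0 (0 : SmoothFun X)

theorem pd_sub (v : X) (f g : SmoothFun X) : pd v (f - g) = pd v f - pd v g := by
  have := pd_add v (f - g) g
  rw [sub_add_cancel] at this
  rw [this, add_sub_cancel_right]

/-- Multiplication of smooth functions. -/
instance instMul : Mul (SmoothFun X) := ⟨fun f g => mk (fun x => f x * g x) (f.contDiff.mul g.contDiff)⟩

@[simp] theorem mul_apply (f g : SmoothFun X) (x : X) : (f * g) x = f x * g x := rfl

theorem pd_mul (v : X) (f g : SmoothFun X) : pd v (f * g) = f * pd v g + pd v f * g := by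
  ext x
  have : (⇑(f * g)) = fun x => f x * g x := rfl
  rw [pd_apply, this, fderiv_fun_mul (f.differentiable x) (g.differentiable x)]
  simp [pd_apply, mul_comm]

theorem continuous_uncurry_iteratedFDeriv [LocallyCompactSpace X] (n : ℕ) :
    Continuous fun p : SmoothFun X × X => iteratedFDeriv ℝ n p.1 p.2 := by
  have h1 : Continuous fun f : SmoothFun X => f.jet n :=
    continuous_pi_iff.1 (continuous_induced_dom (f := fun (f : SmoothFun X) n => f.jet n)) n
  have : Continuous fun p : C(X, X [×n]→L[ℝ] ℝ) × X => p.1 p.2 := continuous_eval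
  exact this.comp (h1.prodMap continuous_id)

end Basic

section FiniteDimensional

variable {X : Type*} [NormedAddCommGroup X] [NormedSpace ℝ X] [FiniteDimensional ℝ X]
  {Z ι : Type*} [TopologicalSpace Z]

theorem continuous_uncurry_ipd (n : ℕ) (v : Fin n → X) :
    Continuous fun p : SmoothFun X × X => ipd n v p.1 p.2 := by
  have := FiniteDimensional.proper ℝ X
  exact (ContinuousMultilinearMap.apply ℝ (fun _ : Fin n => X) ℝ v).continuous.comp
    (continuous_uncurry_iteratedFDeriv n)

theorem continuous_uncurry : Continuous fun p : SmoothFun X × X => p.1 p.2 := by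
  simpa [ipd_zero] using continuous_uncurry_ipd (X := X) 0 0

/-- Since the limit is continuous in the point, joint convergence along `l ×ˢ 𝓝 x` amounts to
locally uniform convergence. In finite dimension it can be tested on the scalar derivatives at fixed
vectors. -/
theorem tendsto_of_ipd {l : Filter ι} {f : ι → SmoothFun X} {g : SmoothFun X}
    (h : ∀ n v x, Tendsto (fun p : ι × X => ipd n v (f p.1) p.2) (l ×ˢ 𝓝 x) (𝓝 (ipd n v g x))) :
    Tendsto f l (𝓝 g) := by
  have := FiniteDimensional.proper ℝ X
  have hind : Topology.IsInducing fun (f : SmoothFun X) n => f.jet n := ⟨rfl⟩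
  rw [hind.tendsto_nhds_iff, tendsto_pi_nhds]
  intro n
  rw [ContinuousMap.tendsto_iff_tendstoLocallyUniformly, tendstoLocallyUniformly_iff_forall_tendsto]
  intro x
  have h1 : Tendsto (fun p : ι × X => iteratedFDeriv ℝ n g p.2) (l ×ˢ 𝓝 x)
      (𝓝 (iteratedFDeriv ℝ n g x)) := ((g.jet n).continuous.tendsto x).comp tendsto_snd
  have h2 : Tendsto (fun p : ι × X => iteratedFDeriv ℝ n (f p.1) p.2) (l ×ˢ 𝓝 x)
      (𝓝 (iteratedFDeriv ℝ n g x)) := ContinuousMultilinearMap.tendsto_of_apply fun v => h n v x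
  exact (h1.prodMk_nhds h2).mono_right (nhds_le_uniformity _)

/-- Convergence in `C^∞(X)` for a class of families which is stable under derivatives. -/
theorem tendsto_of_class {l : Filter ι} (S : (ι → SmoothFun X) → SmoothFun X → Prop)
    (h0 : ∀ f g, S f g → ∀ x, Tendsto (fun p : ι × X => f p.1 p.2) (l ×ˢ 𝓝 x) (𝓝 (g x)))
    (h1 : ∀ f g v, S f g → S (fun i => pd v (f i)) (pd v g)) {f g} (hS : S f g) :
    Tendsto f l (𝓝 g) := by
  have key : ∀ n v, S (fun i => ipd n v (f i)) (ipd n v g) := by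
    intro n
    induction n with
    | zero => intro v; simpa only [ipd_zero] using hS
    | succ n ih => intro v; simp only [ipd_succ]; exact h1 _ _ _ (ih _)
  exact tendsto_of_ipd fun n v x => h0 _ _ (key n v) x

/-- Continuity into `C^∞(X)` for a class of families which is stable under derivatives. -/
theorem continuous_of_class (S : (Z → SmoothFun X) → Prop)
    (h0 : ∀ f, S f → Continuous fun p : Z × X => f p.1 p.2)
    (h1 : ∀ f v, S f → S fun z => pd v (f z)) {f} (hS : S f) : Continuous f := by
  rw [continuous_iff_continuousAt]
  intro z
  refine tendsto_of_class (fun F G => S F ∧ G = F z) ?_ ?_ ⟨hS, rfl⟩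
  · rintro f g ⟨hf, rfl⟩ x
    rw [← nhds_prod_eq]
    exact (h0 f hf).tendsto (z, x)
  · rintro f g v ⟨hf, rfl⟩
    exact ⟨h1 f v hf, rfl⟩

theorem continuous_pd (v : X) : Continuous (pd v) := by
  rw [continuous_iff_continuousAt]
  intro f
  refine tendsto_of_ipd fun n w x => ?_
  simp only [ipd_pd]
  rw [← nhds_prod_eq]
  exact (continuous_uncurry_ipd _ _).tendsto (f, x)

theorem _root_.Continuous.smoothFun_pd {f : Z → SmoothFun X} (hf : Continuous f) (v : X) :
    Continuous fun z => pd v (f z) := (continuous_pd v).comp hf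

theorem _root_.Continuous.smoothFun_apply {f : Z → SmoothFun X} {g : Z → X} (hf : Continuous f)
    (hg : Continuous g) : Continuous fun z => f z (g z) :=
  continuous_uncurry.comp (hf.prodMk hg)

instance : ContinuousAdd (SmoothFun X) where
  continuous_add := by
    refine continuous_of_class (fun F => ∃ f g : SmoothFun X × SmoothFun X → SmoothFun X,
      Continuous f ∧ Continuous g ∧ F = fun z => f z + g z) ?_ ?_
      ⟨Prod.fst, Prod.snd, continuous_fst, continuous_snd, rfl⟩
    · rintro _ ⟨f, g, hf, hg, rfl⟩
      exact ((hf.comp continuous_fst).smoothFun_apply continuous_snd).add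
        ((hg.comp continuous_fst).smoothFun_apply continuous_snd)
    · rintro _ v ⟨f, g, hf, hg, rfl⟩
      exact ⟨_, _, hf.smoothFun_pd v, hg.smoothFun_pd v, funext fun z => pd_add _ _ _⟩

instance : ContinuousSMul ℝ (SmoothFun X) where
  continuous_smul := by
    refine continuous_of_class (fun F => ∃ f : ℝ × SmoothFun X → SmoothFun X,
      Continuous f ∧ F = fun z => z.1 • f z) ?_ ?_ ⟨Prod.snd, continuous_snd, rfl⟩
    · rintro _ ⟨f, hf, rfl⟩
      exact (continuous_fst.comp continuous_fst).mul
        ((hf.comp continuous_fst).smoothFun_apply continuous_snd)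
    · rintro _ v ⟨f, hf, rfl⟩
      exact ⟨_, hf.smoothFun_pd v, funext fun z => pd_smul _ _ _⟩

instance : IsTopologicalAddGroup (SmoothFun X) where
  continuous_neg := by
    have : (fun f : SmoothFun X => -f) = fun f => (-1 : ℝ) • f := by ext; simp
    rw [this]
    exact continuous_const_smul _

instance : ContinuousMul (SmoothFun X) where
  continuous_mul := by
    let W := SmoothFun X × SmoothFun X
    -- Products alone are not stable under derivatives, but finite sums of products are.
    let S : (W → SmoothFun X) → Prop := fun F => F ∈
      AddSubmonoid.closure {F | ∃ f g : W → SmoothFun X, Continuous f ∧ Continuous g ∧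
        F = fun z => f z * g z}
    refine continuous_of_class S ?_ ?_
      (AddSubmonoid.subset_closure ⟨Prod.fst, Prod.snd, continuous_fst, continuous_snd, rfl⟩)
    · intro F hF
      induction hF using AddSubmonoid.closure_induction with
      | mem F h =>
        obtain ⟨f, g, hf, hg, rfl⟩ := h
        exact ((hf.comp continuous_fst).smoothFun_apply continuous_snd).mul
          ((hg.comp continuous_fst).smoothFun_apply continuous_snd)
      | zero => exact continuous_const
      | add f g _ _ hf hg => exact hf.add hg
    · intro F v hF
      induction hF using AddSubmonoid.closure_induction with
      | mem F h =>
        obtain ⟨f, g, hf, hg, rfl⟩ := h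
        simp only [pd_mul]
        exact AddSubmonoid.add_mem _ (AddSubmonoid.subset_closure ⟨_, _, hf, hg.smoothFun_pd v, rfl⟩)
          (AddSubmonoid.subset_closure ⟨_, _, hf.smoothFun_pd v, hg, rfl⟩)
      | zero =>
        have : (fun z : W => pd v ((0 : W → SmoothFun X) z)) = 0 := by
          funext z
          simpa using pd_smul v 0 (0 : SmoothFun X)
        rw [this]
        exact AddSubmonoid.zero_mem _
      | add f g _ _ hf hg =>
        have : (fun z : W => pd v ((f + g) z)) = (fun z => pd v (f z)) + fun z => pd v (g z) :=
          funext fun z => pd_add _ _ _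
        rw [this]
        exact AddSubmonoid.add_mem _ hf hg

end FiniteDimensional

end SmoothFun

end

/-! ### Partial application and tensor products of distributions -/

section

namespace SmoothFun

section Pullback

variable {X Y Z : Type*} [NormedAddCommGroup X] [NormedSpace ℝ X] [NormedAddCommGroup Y]
  [NormedSpace ℝ Y] [TopologicalSpace Z]

theorem pd_add_left (v w : X) (f : SmoothFun X) : pd (v + w) f = pd v f + pd w f := by
  ext x; simp [pd_apply]

theorem pd_smul_left (c : ℝ) (v : X) (f : SmoothFun X) : pd (c • v) f = c • pd v f := by
  ext x; simp [pd_apply]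

/-- The pullback of a smooth function along a linear map. -/
def pullback (A : X →L[ℝ] Y) (f : SmoothFun Y) : SmoothFun X :=
  mk (fun x => f (A x)) (f.contDiff.comp A.contDiff)

@[simp] theorem pullback_apply (A : X →L[ℝ] Y) (f : SmoothFun Y) (x : X) :
    pullback A f x = f (A x) := rfl

theorem pd_pullback (A : X →L[ℝ] Y) (f : SmoothFun Y) (v : X) :
    pd v (pullback A f) = pullback A (pd (A v) f) := by
  ext x
  have := ((f.differentiable (A x)).hasFDerivAt.comp x A.hasFDerivAt).fderiv
  have h2 : ⇑(pullback A f) = f ∘ A := rfl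
  rw [pd_apply, h2, this]
  rfl

/-- The function `y ↦ w (x, y)`. -/
def slice (x : X) (w : SmoothFun (X × Y)) : SmoothFun Y :=
  mk (fun y => w (x, y)) (w.contDiff.comp (contDiff_const.prodMk contDiff_id))

@[simp] theorem slice_apply (x : X) (w : SmoothFun (X × Y)) (y : Y) : slice x w y = w (x, y) := rfl

theorem pd_slice (x : X) (w : SmoothFun (X × Y)) (v : Y) :
    pd v (slice x w) = slice x (pd (0, v) w) := by
  ext y
  have h1 : HasFDerivAt (fun y : Y => (x, y)) (ContinuousLinearMap.inr ℝ X Y) y :=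
    hasFDerivAt_prodMk_right x y
  have := ((w.differentiable (x, y)).hasFDerivAt.comp y h1).fderiv
  have h2 : ⇑(slice x w) = w ∘ fun y => (x, y) := rfl
  rw [pd_apply, h2, this]
  rfl

theorem slice_add (x : X) (w w' : SmoothFun (X × Y)) : slice x (w + w') = slice x w + slice x w' :=
  rfl

theorem slice_smul (x : X) (c : ℝ) (w : SmoothFun (X × Y)) : slice x (c • w) = c • slice x w := rfl

variable [FiniteDimensional ℝ Y]

/-- Differentiability of `x ↦ w (x, ·)` as a map into `C^∞(Y)`. Derivatives in `Y` commute with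
those in `X`, so the class of such remainders is stable under derivatives and only locally uniform
convergence to `0` remains to be checked. -/
theorem tendsto_slice_sub (w : SmoothFun (X × Y)) (x : X) :
    Tendsto (fun h : X => ‖h‖⁻¹ • (slice (x + h) w - slice x w - slice x (pd (h, 0) w)))
      (𝓝 0) (𝓝 (0 : SmoothFun Y)) := by
  refine tendsto_of_class (fun F G => ∃ w : SmoothFun (X × Y), F = (fun h : X => ‖h‖⁻¹ •
    (slice (x + h) w - slice x w - slice x (pd (h, 0) w))) ∧ G = 0) ?_ ?_ ⟨w, rfl, rfl⟩
  · rintro _ _ ⟨w, rfl, rfl⟩ y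
    rw [← nhds_prod_eq]
    have hs : HasStrictFDerivAt w (fderiv ℝ w (x, y)) (x, y) :=
      w.contDiff.contDiffAt.hasStrictFDerivAt (by simp)
    have hT : Tendsto (fun p : X × Y => ((x + p.1, p.2), (x, p.2))) (𝓝 (0, y))
        (𝓝 ((x, y), (x, y))) := by
      have : Continuous (fun p : X × Y => ((x + p.1, p.2), (x, p.2))) := by fun_prop
      simpa using this.tendsto (0, y)
    have h1 := (hs.isLittleO.comp_tendsto hT)
    -- Strict differentiability uses the derivative at the fixed point `(x, y)`; continuity of the
    -- derivative allows moving it to `(x, p.2)`.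
    have h2 : (fun p : X × Y => fderiv ℝ w (x, y) (p.1, 0) - fderiv ℝ w (x, p.2) (p.1, 0))
        =o[𝓝 (0, y)] fun p => ‖p.1‖ := by
      have hc : Tendsto (fun p : X × Y => fderiv ℝ w (x, y) - fderiv ℝ w (x, p.2)) (𝓝 (0, y))
          (𝓝 0) := by
        have : Continuous fun p : X × Y => fderiv ℝ w (x, y) - fderiv ℝ w (x, p.2) :=
          continuous_const.sub ((w.contDiff.continuous_fderiv (by simp)).comp (by fun_prop))
        simpa using this.tendsto (0, y)
      rw [← Asymptotics.isLittleO_one_iff ℝ] at hc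
      have := hc.norm_norm.mul_isBigO (Asymptotics.isBigO_refl (fun p : X × Y => ‖p.1‖) (𝓝 (0, y)))
      simp only [norm_one, one_mul] at this
      refine (Asymptotics.IsBigO.of_bound 1 (Eventually.of_forall fun p => ?_)).trans_isLittleO this
      rw [show fderiv ℝ w (x, y) (p.1, 0) - fderiv ℝ w (x, p.2) (p.1, 0) =
        (fderiv ℝ w (x, y) - fderiv ℝ w (x, p.2)) (p.1, 0) from rfl]
      refine (ContinuousLinearMap.le_opNorm _ _).trans ?_
      simp [Prod.norm_def]
    have h3 : (fun p : X × Y => w (x + p.1, p.2) - w (x, p.2) - fderiv ℝ w (x, p.2) (p.1, 0))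
        =o[𝓝 (0, y)] fun p => ‖p.1‖ := by
      have h1' : (fun p : X × Y => w (x + p.1, p.2) - w (x, p.2) - fderiv ℝ w (x, y) (p.1, 0))
          =o[𝓝 (0, y)] fun p => ‖p.1‖ := by
        refine (h1.congr_left fun p => ?_).trans_isBigO
          (Asymptotics.IsBigO.of_bound 1 (Eventually.of_forall fun p => ?_))
        · simp only [Function.comp_apply, Prod.mk_sub_mk, add_sub_cancel_left, sub_self]
        · simp [Prod.norm_def]
      exact (h1'.add h2).congr_left fun p => by ring
    refine h3.tendsto_div_nhds_zero.congr fun p => ?_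
    simp [pd_apply, div_eq_inv_mul]
  · rintro _ _ v ⟨w, rfl, rfl⟩
    refine ⟨pd (0, v) w, funext fun h => ?_, ?_⟩
    · rw [pd_smul, pd_sub, pd_sub, pd_slice, pd_slice, pd_slice, pd_comm]
    · exact pd_zero v

variable [FiniteDimensional ℝ X]

theorem _root_.Continuous.smoothFun_pullback {f : Z → SmoothFun Y} (hf : Continuous f)
    (A : X →L[ℝ] Y) : Continuous fun z => pullback A (f z) := by
  refine continuous_of_class (fun F => ∃ f : Z → SmoothFun Y, Continuous f ∧
    F = fun z => pullback A (f z)) ?_ ?_ ⟨f, hf, rfl⟩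
  · rintro _ ⟨f, hf, rfl⟩
    exact (hf.comp continuous_fst).smoothFun_apply (A.continuous.comp continuous_snd)
  · rintro _ v ⟨f, hf, rfl⟩
    exact ⟨_, hf.smoothFun_pd (A v), funext fun z => pd_pullback _ _ _⟩

theorem _root_.Continuous.smoothFun_slice {w : Z → SmoothFun (X × Y)} {x : Z → X}
    (hw : Continuous w) (hx : Continuous x) : Continuous fun z => slice (x z) (w z) := by
  refine continuous_of_class (fun F => ∃ w : Z → SmoothFun (X × Y), Continuous w ∧
    F = fun z => slice (x z) (w z)) ?_ ?_ ⟨w, hw, rfl⟩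
  · rintro _ ⟨w, hw, rfl⟩
    exact (hw.comp continuous_fst).smoothFun_apply
      ((hx.comp continuous_fst).prodMk continuous_snd)
  · rintro _ v ⟨w, hw, rfl⟩
    exact ⟨_, hw.smoothFun_pd (0, v), funext fun z => pd_slice _ _ _⟩

end Pullback

section ApplySnd

variable {X Y Z : Type*} [NormedAddCommGroup X] [NormedSpace ℝ X] [NormedAddCommGroup Y]
  [NormedSpace ℝ Y] [TopologicalSpace Z] [FiniteDimensional ℝ X] [FiniteDimensional ℝ Y]

theorem hasFDerivAt_apply_slice (T : SmoothFun Y →L[ℝ] ℝ) (w : SmoothFun (X × Y)) (x : X) :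
    HasFDerivAt (fun x => T (slice x w)) (LinearMap.toContinuousLinearMap
      { toFun := fun v => T (slice x (pd (v, 0) w))
        map_add' := fun v v' => by
          rw [← map_add, ← slice_add, ← pd_add_left]; simp
        map_smul' := fun c v => by
          rw [RingHom.id_apply, ← map_smul, ← slice_smul, ← pd_smul_left]; simp }) x := by
  rw [hasFDerivAt_iff_tendsto]
  have h1 : Tendsto (fun x' : X => x' - x) (𝓝 x) (𝓝 0) := by
    simpa using (continuous_id.sub continuous_const).tendsto (f := fun x' : X => x' - x) x
  have h2 := ((T.continuous.tendsto 0).comp ((tendsto_slice_sub w x).comp h1)).norm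
  rw [map_zero, norm_zero] at h2
  refine h2.congr fun x' => ?_
  simp [norm_mul]

/-- The smooth function `x ↦ T (w (x, ·))`. -/
def applySnd (T : SmoothFun Y →L[ℝ] ℝ) (w : SmoothFun (X × Y)) : SmoothFun X :=
  mk (fun x => T (slice x w)) <| by
    rw [contDiff_infty]
    intro n
    induction n generalizing w with
    | zero =>
      rw [Nat.cast_zero, contDiff_zero]
      exact T.continuous.comp (continuous_const.smoothFun_slice continuous_id)
    -- A partial derivative in `x` has the same form with `pd (v, 0) w` in place of `w`; hence the
    -- induction over all `w`.
    | succ n ih =>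
      rw [Nat.cast_succ, contDiff_succ_iff_fderiv_apply]
      refine ⟨fun x => (hasFDerivAt_apply_slice T w x).differentiableAt, by simp, fun v => ?_⟩
      simp_rw [(hasFDerivAt_apply_slice T w _).fderiv]
      exact ih _

@[simp] theorem applySnd_apply (T : SmoothFun Y →L[ℝ] ℝ) (w : SmoothFun (X × Y)) (x : X) :
    applySnd T w x = T (slice x w) := rfl

theorem pd_applySnd (T : SmoothFun Y →L[ℝ] ℝ) (w : SmoothFun (X × Y)) (v : X) :
    pd v (applySnd T w) = applySnd T (pd (v, 0) w) := by
  ext x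
  have h : ⇑(applySnd T w) = fun x => T (slice x w) := rfl
  rw [pd_apply, h, (hasFDerivAt_apply_slice T w x).fderiv]
  rfl

theorem applySnd_add (T : SmoothFun Y →L[ℝ] ℝ) (w w' : SmoothFun (X × Y)) :
    applySnd T (w + w') = applySnd T w + applySnd T w' := by
  ext x; simp [slice_add]

theorem applySnd_smul (T : SmoothFun Y →L[ℝ] ℝ) (c : ℝ) (w : SmoothFun (X × Y)) :
    applySnd T (c • w) = c • applySnd T w := by
  ext x; simp [slice_smul]

theorem continuous_applySnd {T : Z → SmoothFun Y →L[ℝ] ℝ} {w : Z → SmoothFun (X × Y)}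
    (hT : Continuous fun p : Z × SmoothFun Y => T p.1 p.2) (hw : Continuous w) :
    Continuous fun z => applySnd (T z) (w z) := by
  refine continuous_of_class (fun F => ∃ w : Z → SmoothFun (X × Y), Continuous w ∧
    F = fun z => applySnd (T z) (w z)) ?_ ?_ ⟨w, hw, rfl⟩
  · rintro _ ⟨w, hw, rfl⟩
    exact hT.comp (continuous_fst.prodMk
      ((hw.comp continuous_fst).smoothFun_slice continuous_snd))
  · rintro _ v ⟨w, hw, rfl⟩
    exact ⟨_, hw.smoothFun_pd (v, 0), funext fun z => pd_applySnd _ _ _⟩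

end ApplySnd

end SmoothFun

namespace CompDist

open SmoothFun

variable {X Y Z : Type*} [NormedAddCommGroup X] [NormedSpace ℝ X] [NormedAddCommGroup Y]
  [NormedSpace ℝ Y] [TopologicalSpace Z]

/-- The real part of a complex distribution. -/
def re (T : CompDist X) : SmoothFun X →L[ℝ] ℝ := Complex.reCLM.comp T

/-- The imaginary part of a complex distribution. -/
def im (T : CompDist X) : SmoothFun X →L[ℝ] ℝ := Complex.imCLM.comp T

@[simp] theorem re_apply (T : CompDist X) (u : SmoothFun X) : T.re u = (T u).re := rfl
@[simp] theorem im_apply (T : CompDist X) (u : SmoothFun X) : T.im u = (T u).im := rfl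

/-- The product function `(x, y) ↦ u x * v y`. -/
def _root_.SmoothFun.tprod (u : SmoothFun X) (v : SmoothFun Y) : SmoothFun (X × Y) :=
  pullback (.fst ℝ X Y) u * pullback (.snd ℝ X Y) v

@[simp] theorem _root_.SmoothFun.tprod_apply (u : SmoothFun X) (v : SmoothFun Y) (p : X × Y) :
    tprod u v p = u p.1 * v p.2 := rfl

variable [FiniteDimensional ℝ X] [FiniteDimensional ℝ Y]

/-- The tensor product `S ⊗ T` of two distributions: `T` acts on the second variable, then `S` acts
on the first. -/
def tens (S : CompDist X) (T : CompDist Y) : CompDist (X × Y) where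
  toFun w := S (applySnd T.re w) + Complex.I * S (applySnd T.im w)
  map_add' w w' := by simp only [applySnd_add, map_add]; ring
  map_smul' c w := by
    simp only [applySnd_smul, map_smul, RingHom.id_apply, smul_add, Complex.real_smul]; ring
  cont := by
    have h : ∀ T : SmoothFun Y →L[ℝ] ℝ, Continuous fun w : SmoothFun (X × Y) => S (applySnd T w) :=
      fun T => S.continuous.comp
        (continuous_applySnd (T := fun _ => T) (T.continuous.comp continuous_snd) continuous_id)
    exact (h _).add (continuous_const.mul (h _))

theorem tens_apply (S : CompDist X) (T : CompDist Y) (w : SmoothFun (X × Y)) :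
    tens S T w = S (applySnd T.re w) + Complex.I * S (applySnd T.im w) := rfl

theorem continuous_tens {S : Z → CompDist X} {T : Z → CompDist Y} {w : Z → SmoothFun (X × Y)}
    (hS : Continuous fun p : Z × SmoothFun X => S p.1 p.2)
    (hT : Continuous fun p : Z × SmoothFun Y => T p.1 p.2) (hw : Continuous w) :
    Continuous fun z => tens (S z) (T z) (w z) := by
  have h1 := continuous_applySnd (X := X) (T := fun z => (T z).re) (Complex.continuous_re.comp hT) hw
  have h2 := continuous_applySnd (X := X) (T := fun z => (T z).im) (Complex.continuous_im.comp hT) hw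
  exact (hS.comp (continuous_id.prodMk h1)).add
    (continuous_const.mul (hS.comp (continuous_id.prodMk h2)))

theorem _root_.SmoothFun.applySnd_tprod (T : SmoothFun Y →L[ℝ] ℝ) (u : SmoothFun X)
    (v : SmoothFun Y) : applySnd T (tprod u v) = T v • u := by
  ext x
  have : slice x (tprod u v) = u x • v := rfl
  simp [this, mul_comm]

@[simp] theorem tens_tprod (S : CompDist X) (T : CompDist Y) (u : SmoothFun X) (v : SmoothFun Y) :
    tens S T (tprod u v) = S u * T v := by
  rw [tens_apply, applySnd_tprod, applySnd_tprod, map_smul, map_smul, re_apply, im_apply,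
    Complex.real_smul, Complex.real_smul]
  conv_rhs => rw [← Complex.re_add_im (T v)]
  ring

end CompDist

end

/-! ### Density of exponentials in `C^∞(X)` -/

section

/-- Continuity of parametric integrals over compact sets, for an arbitrary parameter space. -/
theorem continuous_setIntegral_of_isCompact {Z X E : Type*} [TopologicalSpace Z]
    [TopologicalSpace X] [T2Space X] [MeasurableSpace X] [BorelSpace X] [NormedAddCommGroup E]
    [NormedSpace ℝ E] (μ : Measure X) [IsFiniteMeasureOnCompacts μ] {f : Z → X → E}
    (hf : Continuous (Function.uncurry f)) {K : Set X} (hK : IsCompact K) :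
    Continuous fun z => ∫ x in K, f z x ∂μ := by
  have hc : ∀ z, Continuous (f z) := fun z => hf.comp (Continuous.prodMk_right z)
  have hF : Continuous fun z => (⟨f z, hc z⟩ : C(X, E)) := ContinuousMap.continuous_of_continuous_uncurry _ hf
  rw [continuous_iff_continuousAt]
  intro z
  have h1 := ContinuousMap.tendsto_iff_forall_isCompact_tendstoUniformlyOn.1 (hF.tendsto z) K hK
  rw [Metric.tendstoUniformlyOn_iff] at h1
  rw [ContinuousAt, Metric.tendsto_nhds]
  intro ε hε
  have hpos : 0 < ε / (μ.real K + 1) := by positivity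
  filter_upwards [h1 _ hpos] with z' hz'
  rw [dist_comm, dist_eq_norm, ← integral_sub ((hc z).continuousOn.integrableOn_compact hK)
    ((hc z').continuousOn.integrableOn_compact hK)]
  refine (norm_setIntegral_le_of_norm_le_const hK.measure_lt_top fun x hx => by
    rw [← dist_eq_norm]; exact (hz' x hx).le).trans_lt ?_
  have := measureReal_nonneg (μ := μ) (s := K)
  rw [div_mul_eq_mul_div, div_lt_iff₀ (by positivity)]
  nlinarith

namespace SmoothFun

section Density

variable {X : Type*} [NormedAddCommGroup X] [NormedSpace ℝ X]

/-- The exponential function `x ↦ exp (ℓ x)`. -/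
def expFun (ℓ : X →L[ℝ] ℝ) : SmoothFun X :=
  mk (fun x => Real.exp (ℓ x)) ℓ.contDiff.exp

@[simp] theorem expFun_apply (ℓ : X →L[ℝ] ℝ) (x : X) : expFun ℓ x = Real.exp (ℓ x) := rfl

theorem hasCompactSupport_pd {u : SmoothFun X} (hu : HasCompactSupport u) (v : X) :
    HasCompactSupport (pd v u) := hu.fderiv_apply ℝ v

variable (X) in
/-- The span of the exponentials. -/
def expSpan : Submodule ℝ (SmoothFun X) := Submodule.span ℝ (range expFun)

/-- The subalgebra of `C(K, ℝ)` spanned by the exponentials. -/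
def expSubalgebra (K : Set X) : Subalgebra ℝ C(K, ℝ) :=
  (Submodule.span ℝ (range fun ℓ : X →L[ℝ] ℝ =>
    (⟨fun x => Real.exp (ℓ x), by fun_prop⟩ : C(K, ℝ)))).toSubalgebra
    (Submodule.subset_span ⟨0, by ext; simp⟩) fun f g hf hg => by
      refine Submodule.span_induction₂ (p := fun f g _ _ => f * g ∈ Submodule.span ℝ _)
        ?_ ?_ ?_ ?_ ?_ ?_ ?_ hf hg
      · rintro _ _ ⟨ℓ, rfl⟩ ⟨ℓ', rfl⟩
        exact Submodule.subset_span ⟨ℓ + ℓ', by ext; simp [Real.exp_add]⟩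
      · intro y hy; simp
      · intro y hy; simp
      · intro x y z _ _ _ h1 h2; rw [add_mul]; exact Submodule.add_mem _ h1 h2
      · intro x y z _ _ _ h1 h2; rw [mul_add]; exact Submodule.add_mem _ h1 h2
      · intro r x y _ _ h; rw [smul_mul_assoc]; exact Submodule.smul_mem _ _ h
      · intro r x y _ _ h; rw [mul_smul_comm]; exact Submodule.smul_mem _ _ h

/-- Stone–Weierstrass: sums of exponentials form an algebra because `exp ℓ · exp ℓ' = exp (ℓ + ℓ')`,
and linear forms separate points. -/
theorem exists_span_exp_near (p : C(X, ℝ)) {K : Set X} (hK : IsCompact K) {ε : ℝ} (hε : 0 < ε) :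
    ∃ q ∈ expSpan X, ∀ x ∈ K, |q x - p x| < ε := by
  have : CompactSpace K := isCompact_iff_compactSpace.1 hK
  have hsep : (expSubalgebra K).SeparatesPoints := by
    intro x y hxy
    obtain ⟨ℓ, hℓ⟩ := SeparatingDual.exists_separating_of_ne (R := ℝ) (fun h => hxy (Subtype.ext h))
    exact ⟨_, ⟨⟨fun x => Real.exp (ℓ x), by fun_prop⟩, Submodule.subset_span ⟨ℓ, rfl⟩, rfl⟩, by
      simpa using hℓ⟩
  obtain ⟨⟨g, hg⟩, hgp⟩ := ContinuousMap.exists_mem_subalgebra_near_continuousMap_of_separatesPoints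
    (expSubalgebra K) hsep (p.restrict K) ε hε
  have hlift : ∀ g ∈ Submodule.span ℝ (range fun ℓ : X →L[ℝ] ℝ =>
      (⟨fun x => Real.exp (ℓ x), by fun_prop⟩ : C(K, ℝ))),
      ∃ q ∈ expSpan X, ∀ x : K, q x = g x := by
    intro g hg
    induction hg using Submodule.span_induction with
    | mem g h =>
      obtain ⟨ℓ, rfl⟩ := h
      exact ⟨expFun ℓ, Submodule.subset_span ⟨ℓ, rfl⟩, fun x => rfl⟩
    | zero => exact ⟨0, Submodule.zero_mem _, fun x => rfl⟩
    | add g g' _ _ h h' =>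
      obtain ⟨q, hq, h⟩ := h
      obtain ⟨q', hq', h'⟩ := h'
      exact ⟨q + q', Submodule.add_mem _ hq hq', fun x => by simp [h, h']⟩
    | smul c g _ h =>
      obtain ⟨q, hq, h⟩ := h
      exact ⟨c • q, Submodule.smul_mem _ _ hq, fun x => by simp [h]⟩
  obtain ⟨q, hq, hqg⟩ := hlift g hg
  refine ⟨q, hq, fun x hx => ?_⟩
  have := (ContinuousMap.norm_lt_iff _ hε).1 hgp ⟨x, hx⟩
  simpa [hqg ⟨x, hx⟩] using this

variable [FiniteDimensional ℝ X]

theorem exists_cutoff (R : ℝ) :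
    ∃ χ : SmoothFun X, HasCompactSupport χ ∧ ∀ x, ‖x‖ ≤ R → χ x = 1 := by
  have := FiniteDimensional.proper ℝ X
  let b : ContDiffBump (0 : X) := ⟨|R| + 1, |R| + 2, by positivity, by linarith⟩
  refine ⟨mk b b.contDiff, b.hasCompactSupport, fun x hx => b.one_of_mem_closedBall ?_⟩
  rw [mem_closedBall_zero_iff]
  exact hx.trans ((le_abs_self R).trans (by simp [b]))

/-- The topology of `C^∞(X)` only sees bounded sets, so what happens outside growing balls is
irrelevant. -/
theorem tendsto_of_eq_on_ball {f : ℕ → SmoothFun X} {g : SmoothFun X}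
    (h : ∀ (n : ℕ) x, ‖x‖ ≤ n → f n x = g x) : Tendsto f atTop (𝓝 g) := by
  refine tendsto_of_ipd fun n v x => ?_
  have h : ∀ᶠ p : ℕ × X in atTop ×ˢ 𝓝 x, ipd n v (f p.1) p.2 = ipd n v g p.2 := by
    obtain ⟨N, hN⟩ := exists_nat_gt (‖x‖ + 1)
    filter_upwards [(eventually_ge_atTop N).prod_mk (Metric.ball_mem_nhds x one_pos)] with p hp
    have hn : ‖p.2‖ < p.1 := by
      have h3 : dist p.2 x < 1 := hp.2
      have h4 : ‖p.2‖ ≤ dist p.2 x + ‖x‖ := by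
        rw [dist_eq_norm]; simpa using norm_add_le (p.2 - x) x
      have h5 : (N : ℝ) ≤ p.1 := by exact_mod_cast hp.1
      linarith
    rw [ipd_apply, ipd_apply]
    congr 1
    refine (Filter.EventuallyEq.iteratedFDeriv (𝕜 := ℝ) ?_ n).eq_of_nhds
    filter_upwards [(isOpen_lt continuous_norm continuous_const).mem_nhds hn] with y hy
    exact h p.1 y (le_of_lt hy)
  refine Tendsto.congr' (EventuallyEq.symm h) ?_
  exact ((ipd n v g).continuous.tendsto x).comp tendsto_snd

theorem exists_cutoff_seq :
    ∃ χ : ℕ → SmoothFun X, (∀ n, HasCompactSupport (χ n)) ∧ (∀ (n : ℕ) x, ‖x‖ ≤ n → χ n x = 1) ∧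
      ∀ u, Tendsto (fun n => χ n * u) atTop (𝓝 u) := by
  choose χ h1 h2 using fun n : ℕ => exists_cutoff (X := X) n
  exact ⟨χ, h1, h2, fun u => tendsto_of_eq_on_ball fun n x hx => by simp [h2 n x hx]⟩

/-- Every neighbourhood of `0` contains all functions vanishing on some ball. -/
theorem exists_ball_of_mem_nhds_zero {V : Set (SmoothFun X)} (hV : V ∈ 𝓝 (0 : SmoothFun X)) :
    ∃ R : ℝ, ∀ u : SmoothFun X, (∀ x, ‖x‖ ≤ R → u x = 0) → u ∈ V := by
  -- Otherwise there are functions outside `V` vanishing on the balls of radius `n`; these converge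
  -- to `0`.
  by_contra! h
  choose u h1 h2 using fun n : ℕ => h n
  obtain ⟨n, hn⟩ := ((tendsto_of_eq_on_ball (g := 0) h1).eventually_mem hV).exists
  exact h2 n hn

theorem exists_cutoff_of_isCompact {K U : Set X} (hK : IsCompact K) (hU : IsOpen U) (hKU : K ⊆ U) :
    ∃ χ : SmoothFun X, HasCompactSupport χ ∧ tsupport χ ⊆ U ∧ ∀ x ∈ K, χ x = 1 := by
  have := FiniteDimensional.proper ℝ X
  obtain ⟨L, hL, hKL, hLU⟩ := exists_compact_between hK hU hKU
  obtain ⟨f, h0, h1, -⟩ := exists_contMDiffMap_zero_one_of_isClosed (n := ⊤)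
    (modelWithCornersSelf ℝ X) isOpen_interior.isClosed_compl hK.isClosed
    (disjoint_left.2 fun x hx hxK => hx (hKL hxK))
  have hs : tsupport f ⊆ L := by
    refine closure_minimal (fun x hx => ?_) hL.isClosed
    by_contra hxL
    exact hx (h0 fun h => hxL (interior_subset h))
  refine ⟨mk f f.contMDiff.contDiff, ?_, hs.trans hLU, fun x hx => h1 hx⟩
  exact hL.of_isClosed_subset (isClosed_tsupport _) hs

variable [MeasurableSpace X] [BorelSpace X] (μ : Measure X) [μ.IsAddHaarMeasure]

open scoped Convolution in
/-- The convolution of a compactly supported smooth function with a continuous function. -/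
def conv (u : SmoothFun X) (hu : HasCompactSupport u) (p : C(X, ℝ)) : SmoothFun X :=
  mk (u ⋆[ContinuousLinearMap.lsmul ℝ ℝ, μ] p)
    (hu.contDiff_convolution_left _ u.contDiff p.continuous.locallyIntegrable)

theorem pd_conv (u : SmoothFun X) (hu : HasCompactSupport u) (p : C(X, ℝ)) (v : X) :
    pd v (conv μ u hu p) = conv μ (pd v u) (hasCompactSupport_pd hu v) p := by
  ext x
  have h := (hu.hasFDerivAt_convolution_left (ContinuousLinearMap.lsmul ℝ ℝ) (μ := μ)
    (u.contDiff.of_le (by simp)) p.continuous.locallyIntegrable x).fderiv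
  rw [pd_apply]
  refine (congrArg (fun L => L v) h).trans ?_
  have hint : ConvolutionExistsAt (fderiv ℝ u) p x
      (ContinuousLinearMap.precompL X (ContinuousLinearMap.lsmul ℝ ℝ)) μ :=
    (hu.fderiv ℝ).convolutionExists_left _ (u.contDiff.continuous_fderiv (by simp))
      p.continuous.locallyIntegrable x
  simp only [convolution_def]
  rw [ContinuousLinearMap.integral_apply hint]
  simp [conv, convolution_def, pd_apply]

/-- All derivatives fall on `u`. So locally uniform convergence of `p` already gives convergence of
the convolutions in `C^∞`, which upgrades Stone–Weierstrass to the smooth topology. -/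
theorem continuous_conv (u : SmoothFun X) (hu : HasCompactSupport u) :
    Continuous (conv μ u hu) := by
  have := FiniteDimensional.proper ℝ X
  refine continuous_of_class (fun F => ∃ u hu, F = conv μ u hu) ?_ ?_ ⟨u, hu, rfl⟩
  · rintro _ ⟨u, hu, rfl⟩
    have h : ∀ p : C(X, ℝ) × X, conv μ u hu p.1 p.2 =
        ∫ t in tsupport u, u t * p.1 (p.2 - t) ∂μ := by
      intro p
      refine (setIntegral_eq_integral_of_forall_compl_eq_zero fun t ht => ?_).symm
      simp [image_eq_zero_of_notMem_tsupport ht]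
    simp_rw [h]
    refine continuous_setIntegral_of_isCompact μ (f := fun (p : C(X, ℝ) × X) t =>
      u t * p.1 (p.2 - t)) ?_ hu.isCompact
    have h1 : Continuous fun q : (C(X, ℝ) × X) × X => q.1.1 (q.1.2 - q.2) :=
      continuous_eval.comp (by fun_prop : Continuous fun q : (C(X, ℝ) × X) × X =>
        (q.1.1, q.1.2 - q.2))
    exact (u.continuous.comp continuous_snd).mul h1
  · rintro _ v ⟨u, hu, rfl⟩
    exact ⟨_, hasCompactSupport_pd hu v, funext fun p => pd_conv μ u hu p v⟩

/-- Exponentials are eigenfunctions of convolution, so convolving keeps their span. -/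
theorem conv_expFun (u : SmoothFun X) (hu : HasCompactSupport u) (ℓ : X →L[ℝ] ℝ) :
    conv μ u hu ⟨expFun ℓ, (expFun ℓ).continuous⟩ =
      (∫ t, u t * Real.exp (-ℓ t) ∂μ) • expFun ℓ := by
  ext x
  simp only [conv, mk_apply, convolution_def, ContinuousLinearMap.lsmul_apply, smul_apply,
    ContinuousMap.coe_mk, expFun_apply, smul_eq_mul, map_sub, ← integral_mul_const]
  congr 1
  ext t
  rw [sub_eq_neg_add, Real.exp_add]
  ring

theorem tendsto_conv_bump (u : SmoothFun X) (hu : HasCompactSupport u)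
    (φ : ℕ → ContDiffBump (0 : X)) (hφ : Tendsto (fun n => (φ n).rOut) atTop (𝓝 0)) :
    Tendsto (fun n => conv μ u hu ⟨(φ n).normed μ, (φ n).continuous_normed⟩) atTop (𝓝 u) := by
  refine tendsto_of_class (fun F G => ∃ u hu, F = (fun n => conv μ u hu
    ⟨(φ n).normed μ, (φ n).continuous_normed⟩) ∧ G = u) ?_ ?_ ⟨u, hu, rfl, rfl⟩
  · rintro _ g ⟨u, hu, rfl, hg⟩ x
    rw [hg]
    have hφ' : Tendsto (fun p : ℕ × X => (φ p.1).rOut) (atTop ×ˢ 𝓝 x) (𝓝 0) := hφ.comp tendsto_fst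
    have h := ContDiffBump.convolution_tendsto_right (μ := μ) (l := (atTop : Filter ℕ) ×ˢ 𝓝 x)
      (φ := fun p => φ p.1) (g := fun _ => u) (k := fun p => p.2) (x₀ := x) (z₀ := u x)
      hφ'
      (Eventually.of_forall fun _ => u.continuous.aestronglyMeasurable)
      ((u.continuous.tendsto x).comp tendsto_snd) tendsto_snd
    refine h.congr fun p => ?_
    rw [← convolution_flip]
    simp only [convolution_def, conv, mk_apply]
    congr 1
    ext t
    simp [mul_comm]
  · rintro _ _ v ⟨u, hu, rfl, rfl⟩
    exact ⟨_, hasCompactSupport_pd hu v, funext fun p => pd_conv μ _ hu _ v, rfl⟩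

end Density

variable {X : Type*} [NormedAddCommGroup X] [NormedSpace ℝ X] [FiniteDimensional ℝ X]

/-- Three approximations: `u * p` is a limit of `u * q` with `q` in the span of exponentials; a
compactly supported `u` is a limit of `u * p` with `p` running through bump functions; every `u` is
a limit of its cutoffs. -/
theorem dense_expSpan_of_measure [MeasurableSpace X] [BorelSpace X] (μ : Measure X)
    [μ.IsAddHaarMeasure] : Dense (expSpan X : Set (SmoothFun X)) := by
  have := FiniteDimensional.proper ℝ X
  have h1 : ∀ (u : SmoothFun X) (hu : HasCompactSupport u) (p : C(X, ℝ)),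
      conv μ u hu p ∈ closure (expSpan X : Set (SmoothFun X)) := by
    intro u hu p
    have happ : ∀ n : ℕ, ∃ q ∈ expSpan X, ∀ x ∈ Metric.closedBall (0 : X) n,
        |q x - p x| < 1 / ((n : ℝ) + 1) := fun n =>
      exists_span_exp_near p (isCompact_closedBall (0 : X) n) (by positivity)
    choose q hq hqp using happ
    have ht : Tendsto (fun n => (⟨q n, (q n).continuous⟩ : C(X, ℝ))) atTop (𝓝 p) := by
      rw [ContinuousMap.tendsto_iff_forall_isCompact_tendstoUniformlyOn]
      intro K hK
      obtain ⟨R, hR⟩ := hK.isBounded.subset_closedBall 0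
      rw [Metric.tendstoUniformlyOn_iff]
      intro ε hε
      obtain ⟨N, hN⟩ := exists_nat_ge R
      filter_upwards [eventually_ge_atTop N,
        (tendsto_one_div_add_atTop_nhds_zero_nat (𝕜 := ℝ)).eventually_lt_const hε] with n hn h x hx
      rw [dist_comm, Real.dist_eq]
      refine (hqp n x ?_).trans h
      exact Metric.closedBall_subset_closedBall (hN.trans (by exact_mod_cast hn)) (hR hx)
    refine mem_closure_of_tendsto (((continuous_conv μ u hu).tendsto p).comp ht)
      (Eventually.of_forall fun n => ?_)
    have : ∀ f ∈ expSpan X, conv μ u hu ⟨f, f.continuous⟩ ∈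
        expSpan X := by
      intro f hf
      have hint : ∀ (f : SmoothFun X) (x : X), Integrable (fun t => u t * f (x - t)) μ := by
        intro f x
        refine Continuous.integrable_of_hasCompactSupport ?_ hu.mul_right
        exact u.continuous.mul (f.continuous.comp (by fun_prop))
      induction hf using Submodule.span_induction with
      | mem f h =>
        obtain ⟨ℓ, rfl⟩ := h
        rw [conv_expFun]
        exact Submodule.smul_mem _ _ (Submodule.subset_span ⟨ℓ, rfl⟩)
      | zero =>
        convert! Submodule.zero_mem _
        ext x
        simp [conv, convolution_def]
      | add f g _ _ hf hg =>
        convert! Submodule.add_mem _ hf hg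
        ext x
        simp only [conv, mk_apply, convolution_def, ContinuousLinearMap.lsmul_apply, smul_eq_mul,
          add_apply, ContinuousMap.coe_mk, mul_add]
        exact integral_add (hint f x) (hint g x)
      | smul c f _ hf =>
        convert! Submodule.smul_mem _ c hf
        ext x
        simp only [conv, mk_apply, convolution_def, ContinuousLinearMap.lsmul_apply, smul_eq_mul,
          smul_apply, ContinuousMap.coe_mk]
        rw [← integral_const_mul]
        congr 1
        ext t
        ring
    exact this _ (hq n)
  have h2 : ∀ u : SmoothFun X, HasCompactSupport u →
      u ∈ closure (expSpan X : Set (SmoothFun X)) := by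
    intro u hu
    let φ : ℕ → ContDiffBump (0 : X) := fun n =>
      ⟨1 / (n + 1 : ℝ) / 2, 1 / (n + 1 : ℝ), by positivity, half_lt_self (by positivity)⟩
    exact isClosed_closure.mem_of_tendsto
      (tendsto_conv_bump μ u hu φ tendsto_one_div_add_atTop_nhds_zero_nat)
      (Eventually.of_forall fun n => h1 _ _ _)
  intro u
  obtain ⟨χ, hχ, -, ht⟩ := exists_cutoff_seq (X := X)
  exact isClosed_closure.mem_of_tendsto (ht u) (Eventually.of_forall fun n => h2 _ (hχ n).mul_right)

theorem dense_expSpan : Dense (expSpan X : Set (SmoothFun X)) := by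
  let _ : MeasurableSpace X := borel X
  have : BorelSpace X := ⟨rfl⟩
  exact dense_expSpan_of_measure (Module.finBasis ℝ X).addHaar

end SmoothFun

end

/-! ### Consequences of density: Fubini and differentiation of families -/

section

namespace SmoothFun

variable {X Y : Type*} [NormedAddCommGroup X] [NormedSpace ℝ X] [FiniteDimensional ℝ X]
  [NormedAddCommGroup Y] [NormedSpace ℝ Y] [FiniteDimensional ℝ Y]

/-- Continuous linear maps on `C^∞(X)` are determined by their values at exponentials. -/
theorem ext_expFun {E : Type*} [AddCommGroup E] [Module ℝ E] [TopologicalSpace E] [T2Space E]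
    {S T : SmoothFun X →L[ℝ] E} (h : ∀ ℓ, S (expFun ℓ) = T (expFun ℓ)) : S = T := by
  refine ContinuousLinearMap.ext_on (s := range expFun) dense_expSpan ?_
  rintro _ ⟨ℓ, rfl⟩
  exact h ℓ

/-- Integration of smooth functions against a compactly supported continuous function. -/
def intDist [MeasurableSpace X] [BorelSpace X] (μ : Measure X) [IsFiniteMeasureOnCompacts μ]
    (g : X → ℝ) (hg : Continuous g) (hs : HasCompactSupport g) : SmoothFun X →L[ℝ] ℝ where
  toFun u := ∫ x, g x * u x ∂μ
  map_add' u v := by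
    simp only [add_apply, mul_add]
    exact integral_add ((hg.mul u.continuous).integrable_of_hasCompactSupport hs.mul_right)
      ((hg.mul v.continuous).integrable_of_hasCompactSupport hs.mul_right)
  map_smul' c u := by
    simp only [smul_apply, RingHom.id_apply, smul_eq_mul, ← integral_const_mul]
    congr 1; ext x; ring
  cont := by
    have h : ∀ u : SmoothFun X, ∫ x, g x * u x ∂μ = ∫ x in tsupport g, g x * u x ∂μ := fun u =>
      (setIntegral_eq_integral_of_forall_compl_eq_zero fun x hx => by
        simp [image_eq_zero_of_notMem_tsupport hx]).symm
    change Continuous fun u : SmoothFun X => ∫ x, g x * u x ∂μ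
    simp_rw [h]
    exact continuous_setIntegral_of_isCompact μ (f := fun (u : SmoothFun X) x => g x * u x)
      ((hg.comp continuous_snd).mul (continuous_fst.smoothFun_apply continuous_snd)) hs.isCompact

/-- Exchange of the two variables. -/
def swap (w : SmoothFun (X × Y)) : SmoothFun (Y × X) :=
  pullback ((ContinuousLinearMap.snd ℝ Y X).prod (ContinuousLinearMap.fst ℝ Y X)) w

@[simp] theorem swap_apply (w : SmoothFun (X × Y)) (p : Y × X) : swap w p = w (p.2, p.1) := rfl

theorem expFun_prod (ℓ : X × Y →L[ℝ] ℝ) : expFun ℓ =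
    tprod (expFun (ℓ.comp (.inl ℝ X Y))) (expFun (ℓ.comp (.inr ℝ X Y))) := by
  ext p
  simp only [expFun_apply, tprod_apply, ContinuousLinearMap.comp_apply,
    ContinuousLinearMap.inl_apply, ContinuousLinearMap.inr_apply]
  rw [← Real.exp_add, ← map_add]
  simp

theorem swap_tprod (u : SmoothFun X) (v : SmoothFun Y) : swap (tprod u v) = tprod v u := by
  ext p; simp [mul_comm]

/-- Fubini's theorem for distributions of compact support. -/
theorem _root_.CompDist.tens_swap (S : CompDist X) (T : CompDist Y) (w : SmoothFun (X × Y)) :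
    CompDist.tens S T w = CompDist.tens T S (swap w) := by
  let A : SmoothFun (X × Y) →L[ℝ] SmoothFun (Y × X) :=
    { toFun := swap
      map_add' := fun _ _ => rfl
      map_smul' := fun _ _ => rfl
      cont := continuous_id.smoothFun_pullback _ }
  -- Both sides are continuous and linear in `w`, and an exponential on a product space is a tensor
  -- product.
  have : CompDist.tens S T = (CompDist.tens T S).comp A := ext_expFun fun ℓ => by
    change _ = CompDist.tens T S (swap _)
    rw [expFun_prod, swap_tprod, CompDist.tens_tprod, CompDist.tens_tprod, mul_comm]
  exact congrArg (fun L => L w) this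

/-- Fubini's theorem for real distributions of compact support. -/
theorem apply_applySnd_swap (S : SmoothFun X →L[ℝ] ℝ) (T : SmoothFun Y →L[ℝ] ℝ)
    (w : SmoothFun (X × Y)) : S (applySnd T w) = T (applySnd S (swap w)) := by
  let A : SmoothFun (X × Y) →L[ℝ] ℝ :=
    { toFun := fun w => S (applySnd T w)
      map_add' := fun _ _ => by rw [applySnd_add, map_add]
      map_smul' := fun _ _ => by rw [applySnd_smul, map_smul]; rfl
      cont := S.continuous.comp
        (continuous_applySnd (T := fun _ => T) (T.continuous.comp continuous_snd) continuous_id) }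
  let B : SmoothFun (X × Y) →L[ℝ] ℝ :=
    { toFun := fun w => T (applySnd S (swap w))
      map_add' := fun w w' => by
        rw [show swap (w + w') = swap w + swap w' from rfl, applySnd_add, map_add]
      map_smul' := fun c w => by
        rw [show swap (c • w) = c • swap w from rfl, applySnd_smul, map_smul]; rfl
      cont := T.continuous.comp
        (continuous_applySnd (T := fun _ => S) (S.continuous.comp continuous_snd)
          (continuous_id.smoothFun_pullback _)) }
  have : A = B := ext_expFun fun ℓ => by
    change S (applySnd T _) = T (applySnd S (swap _))
    rw [expFun_prod, swap_tprod, applySnd_tprod, applySnd_tprod, map_smul, map_smul, smul_eq_mul,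
      smul_eq_mul, mul_comm]
  exact congrArg (fun L => L w) this

/-- A family of distributions whose values at exponentials are differentiable in the parameter is
differentiable on all smooth functions, provided that the derivatives depend continuously on the
parameter. -/
theorem hasDerivAt_of_expFun {A A' : ℝ → CompDist X}
    (hA' : Continuous fun p : ℝ × SmoothFun X => A' p.1 p.2)
    (h : ∀ ℓ t, HasDerivAt (fun t => A t (expFun ℓ)) (A' t (expFun ℓ)) t) (u : SmoothFun X) (t : ℝ) :
    HasDerivAt (fun t => A t u) (A' t u) t := by
  have hc : ∀ u, Continuous fun s => A' s u := fun u => hA'.comp (Continuous.prodMk_left u)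
  -- Differentiability does not pass to limits in `u`, but its integrated form is an identity
  -- between continuous linear maps and does.
  have hI : ∀ u t, A t u = A 0 u + ∫ s in (0 : ℝ)..t, A' s u := by
    intro u t
    let I : CompDist X :=
      { toFun := fun u => ∫ s in (0 : ℝ)..t, A' s u
        map_add' := fun u v => by
          simp only [map_add]
          exact intervalIntegral.integral_add ((hc u).intervalIntegrable _ _)
            ((hc v).intervalIntegrable _ _)
        map_smul' := fun c u => by simp
        cont := by
          refine intervalIntegral.continuous_parametric_intervalIntegral_of_continuous'
            (f := fun (u : SmoothFun X) s => A' s u) ?_ 0 t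
          exact hA'.comp continuous_swap }
    have : A t = A 0 + I := ext_expFun fun ℓ => by
      have := intervalIntegral.integral_eq_sub_of_hasDerivAt (a := 0) (b := t)
        (fun s _ => h ℓ s) ((hc _).intervalIntegrable _ _)
      change _ = A 0 (expFun ℓ) + ∫ s in (0 : ℝ)..t, A' s (expFun ℓ)
      rw [this]; ring
    exact congrArg (fun L => L u) this
  have h1 := (intervalIntegral.integral_hasDerivAt_right ((hc u).intervalIntegrable 0 t)
    (hc u).aestronglyMeasurable.stronglyMeasurableAtFilter (hc u).continuousAt).const_add (A 0 u)
  exact h1.congr_of_eventuallyEq (Eventually.of_forall fun s => hI u s)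

end SmoothFun

end

/-! ### Supports of distributions -/

section

theorem SmoothFun.tsupport_mul_subset {X : Type*} [NormedAddCommGroup X] [NormedSpace ℝ X]
    (u v : SmoothFun X) : tsupport (u * v) ⊆ tsupport v :=
  closure_mono (Function.support_mul_subset_right u v)

namespace CompDist

open SmoothFun Distribution

variable {X : Type*} [NormedAddCommGroup X] [NormedSpace ℝ X] [FiniteDimensional ℝ X]

/-- A subordinate partition of unity splits `u` into pieces that `T` annihilates. -/
theorem apply_eq_zero_of_cover (T : CompDist X) {ι : Type*} [Fintype ι] {U : ι → Set X}
    (hU : ∀ i, IsOpen (U i)) (hT : ∀ i, IsVanishingOn T (U i)) {u : SmoothFun X}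
    (hu : tsupport u ⊆ ⋃ i, U i) : T u = 0 := by
  have := FiniteDimensional.proper ℝ X
  obtain ⟨ρ, hρ⟩ := SmoothPartitionOfUnity.exists_isSubordinate (modelWithCornersSelf ℝ X)
    (isClosed_tsupport u) U hU hu
  have hsum : u = ∑ a, SmoothFun.mk (ρ a) (ρ a).contMDiff.contDiff * u := by
    ext x
    simp only [SmoothFun.sum_apply, mul_apply, mk_apply, ← Finset.sum_mul]
    by_cases hx : x ∈ tsupport u
    · rw [← finsum_eq_sum_of_fintype, ρ.sum_eq_one hx, one_mul]
    · simp [image_eq_zero_of_notMem_tsupport hx]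
  rw [hsum, map_sum]
  refine Finset.sum_eq_zero fun a _ => hT a _ ?_
  exact (tsupport_mul_subset_left (f := ρ a) (g := u)).trans (hρ a)

/-- A distribution vanishes on the complement of its support. -/
theorem isVanishingOn_compl_dsupport (T : CompDist X) : IsVanishingOn T (dsupport T)ᶜ := by
  -- For compact support, finitely many of the open sets on which `T` vanishes cover `tsupport u`.
  -- Cutoffs extend this to all `u`.
  have hcomp : ∀ u : SmoothFun X, HasCompactSupport u → tsupport u ⊆ (dsupport T)ᶜ → T u = 0 := by
    intro u hu hT
    have hV : ∀ x ∈ tsupport u, ∃ s, IsVanishingOn T s ∧ IsOpen s ∧ x ∈ s := fun x hx =>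
      (notMem_dsupport_iff x).1 (hT hx)
    choose! V hV1 hV2 hV3 using hV
    obtain ⟨t, ht, hcov⟩ := hu.isCompact.elim_nhds_subcover V
      fun x hx => (hV2 x hx).mem_nhds (hV3 x hx)
    refine T.apply_eq_zero_of_cover (ι := t) (U := fun a => V a) (fun a => hV2 a (ht a a.2))
      (fun a => hV1 a (ht a a.2)) (hcov.trans ?_)
    exact iUnion₂_subset fun a ha => subset_iUnion (fun a : t => V a) ⟨a, ha⟩
  intro u hu
  obtain ⟨χ, hχ, -, ht⟩ := exists_cutoff_seq (X := X)
  have h0 : ∀ n, T (χ n * u) = 0 := fun n =>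
    hcomp _ (hχ n).mul_right ((tsupport_mul_subset _ _).trans hu)
  have h1 : Tendsto (fun n => T (χ n * u)) atTop (𝓝 (T u)) := (T.continuous.tendsto u).comp (ht u)
  simp only [h0] at h1
  exact tendsto_nhds_unique h1 tendsto_const_nhds

/-- Agreement on the support alone would not suffice, as `T` may contain transversal derivatives; on
an open set `U` the support of the difference avoids that of `T`. -/
theorem apply_eq_of_eqOn (T : CompDist X) {U : Set X} (hU : IsOpen U) (hT : dsupport T ⊆ U)
    {u v : SmoothFun X} (h : EqOn u v U) : T u = T v := by
  rw [← sub_eq_zero, ← map_sub]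
  refine T.isVanishingOn_compl_dsupport _ fun x hx hxT => ?_
  refine (closure_minimal (s := Function.support ⇑(u - v)) (t := Uᶜ) (fun y hy hyU => ?_)
    hU.isClosed_compl) hx (hT hxT)
  refine hy ?_
  simp [h hyU]

theorem dsupport_subset_iff (T : CompDist X) {s : Set X} (hs : IsClosed s) :
    dsupport T ⊆ s ↔ IsVanishingOn T sᶜ :=
  ⟨fun h => T.isVanishingOn_compl_dsupport.mono (compl_subset_compl.2 h),
    fun h => sInter_subset_of_mem ⟨h, hs⟩⟩

/-- A continuous family of distributions of compact support is locally supported in a fixed compact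
set. -/
theorem exists_dsupport_subset_of_continuous {Z : Type*} [TopologicalSpace Z] {T : Z → CompDist X}
    (hT : Continuous fun p : Z × SmoothFun X => T p.1 p.2) (z : Z) :
    ∃ R : ℝ, ∀ᶠ z' in 𝓝 z, dsupport (T z') ⊆ Metric.closedBall 0 R := by
  have h1 : {p : Z × SmoothFun X | ‖T p.1 p.2‖ < 1} ∈ 𝓝 (z, (0 : SmoothFun X)) := by
    refine (isOpen_lt hT.norm continuous_const).mem_nhds ?_
    simp
  rw [nhds_prod_eq, mem_prod_iff] at h1
  obtain ⟨W, hW, V, hV, hWV⟩ := h1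
  obtain ⟨R, hR⟩ := exists_ball_of_mem_nhds_zero hV
  refine ⟨R, ?_⟩
  filter_upwards [hW] with z' hz'
  rw [dsupport_subset_iff _ Metric.isClosed_closedBall]
  intro u hu
  by_contra hne
  have hu0 : ∀ x, ‖x‖ ≤ R → u x = 0 := fun x hx =>
    image_eq_zero_of_notMem_tsupport fun h => hu h (mem_closedBall_zero_iff.2 hx)
  -- Functions vanishing on the ball form a linear space inside `V`, on which `T z'` is bounded by
  -- `1`. Rescaling `u` so that the value has norm exactly `1` is a contradiction.
  have h2 : ((‖T z' u‖⁻¹ : ℝ) • u) ∈ V := hR _ fun x hx => by simp [hu0 x hx]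
  have h3 := hWV (mk_mem_prod hz' h2)
  simp only [mem_ofPred_eq, map_smul, norm_smul, norm_inv, norm_norm] at h3
  rw [inv_mul_cancel₀ (norm_ne_zero_iff.2 hne)] at h3
  exact lt_irrefl _ h3

end CompDist

end

/-! ### The distribution `P` on functions and its defining equation -/

section

namespace SmoothFun

variable {X : Type*} [NormedAddCommGroup X] [NormedSpace ℝ X] [FiniteDimensional ℝ X]

/-- A compactly supported smooth function as a test function. -/
def toTest (u : SmoothFun X) (hu : HasCompactSupport u) : 𝓓((⊤ : Opens X), ℝ) :=
  ⟨u, u.contDiff, hu, subset_univ _⟩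

@[simp] theorem toTest_apply (u : SmoothFun X) (hu : HasCompactSupport u) (x : X) :
    toTest u hu x = u x := rfl

/-- Multiplication with a cutoff function, as a map to functions with support in a fixed compact. -/
def cutSupp (χ : SmoothFun X) (hχ : HasCompactSupport χ) (u : SmoothFun X) :
    𝓓_{(⟨tsupport χ, hχ.isCompact⟩ : Compacts X)}(X, ℝ) :=
  ContDiffMapSupportedIn.of_support_subset (f := ⇑(χ * u)) (χ * u).contDiff
    ((Function.support_mul_subset_left χ u).trans (subset_tsupport χ))

theorem continuous_cutSupp (χ : SmoothFun X) (hχ : HasCompactSupport χ) :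
    Continuous (cutSupp χ hχ) := by
  have := FiniteDimensional.proper ℝ X
  rw [ContDiffMapSupportedIn.continuous_iff_comp]
  intro i
  rw [continuous_iff_continuousAt]
  intro u
  have h1 : Continuous fun u : SmoothFun X => (χ * u).jet i :=
    (continuous_pi_iff.1 (continuous_induced_dom (f := fun (f : SmoothFun X) n => f.jet n)) i).comp
      (continuous_const.mul continuous_id)
  have h2 := ContinuousMap.tendsto_iff_forall_isCompact_tendstoUniformlyOn.1 (h1.tendsto u) _
    hχ.isCompact
  rw [Metric.tendstoUniformlyOn_iff] at h2
  rw [ContinuousAt, Metric.tendsto_nhds]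
  intro ε hε
  filter_upwards [h2 (ε / 2) (by positivity)] with v hv
  refine lt_of_le_of_lt ((BoundedContinuousFunction.dist_le (half_pos hε).le).2 fun x => ?_)
    (half_lt_self hε)
  by_cases hx : x ∈ tsupport χ
  · rw [dist_comm]
    exact (hv x hx).le
  · have h0 : ∀ w : SmoothFun X, iteratedFDeriv ℝ i (χ * w) x = 0 := by
      intro w
      apply ContDiffMapSupportedIn.iteratedFDeriv_zero_on_compl (cutSupp χ hχ w) hx
    have h3 : ∀ w : SmoothFun X,
        (ContDiffMapSupportedIn.structureMapCLM ℝ ⊤ i (cutSupp χ hχ w)) x = 0 := h0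
    simp only [Function.comp_apply]
    rw [h3, h3, dist_self]
    positivity

/-- The inclusion of functions with compact support in `C^∞(X)`. -/
def ofSupp {K : Compacts X} (f : 𝓓_{K}(X, ℝ)) : SmoothFun X := mk f f.contDiff

theorem continuous_ofSupp {K : Compacts X} : Continuous (ofSupp (X := X) (K := K)) := by
  have := FiniteDimensional.proper ℝ X
  refine continuous_induced_rng.2 (continuous_pi fun n => ?_)
  rw [continuous_iff_continuousAt]
  intro f
  refine ContinuousMap.tendsto_iff_forall_isCompact_tendstoUniformlyOn.2 fun L _ => ?_
  have h1 := (ContDiffMapSupportedIn.structureMapCLM ℝ ⊤ n (K := K) (E := X) (F := ℝ)).continuous.tendsto f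
  rw [Metric.tendsto_nhds] at h1
  rw [Metric.tendstoUniformlyOn_iff]
  intro ε hε
  filter_upwards [h1 ε hε] with g hg x _
  rw [dist_comm]
  exact (BoundedContinuousFunction.dist_coe_le_dist x).trans_lt hg

/-- The distribution of compact support `u ↦ P (χ u)`. -/
def _root_.distCut (P : 𝓓'((⊤ : Opens X), ℝ)) (χ : SmoothFun X) (hχ : HasCompactSupport χ) :
    SmoothFun X →L[ℝ] ℝ where
  toFun u := P (toTest (χ * u) hχ.mul_right)
  map_add' u v := by
    rw [← map_add]
    congr 1
    ext x
    exact mul_add (χ x) (u x) (v x)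
  map_smul' c u := by
    rw [← map_smul]
    congr 1
    ext x
    exact mul_left_comm (χ x) c (u x)
  cont := P.continuous.comp ((TestFunction.continuous_ofSupportedIn (subset_univ _)).comp
    (continuous_cutSupp χ hχ))

end SmoothFun

open SmoothFun

section ApplyDist

variable {d : ℕ} (P : 𝓓'((⊤ : Opens (Euc d)), ℝ))

theorem applyDist_eq {f : Euc d → ℝ} (hf : ContDiff ℝ ∞ f) (hs : HasCompactSupport f) :
    applyDist P f = P (toTest (SmoothFun.mk f hf) hs) := by
  rw [applyDist, dif_pos ⟨hf, hs⟩]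
  rfl

/-- `applyDist` is defined by cases, whereas `distCut` is a continuous linear form on all of `C^∞`.
Wherever supports are bounded in advance, the second can stand for the first. -/
theorem applyDist_eq_distCut {u : SmoothFun (Euc d)} {χ : SmoothFun (Euc d)}
    (hχ : HasCompactSupport χ) (h : ∀ x, u x ≠ 0 → χ x = 1) :
    applyDist P u = distCut P χ hχ u := by
  have h1 : χ * u = u := by
    ext x
    by_cases hx : u x = 0
    · simp [hx]
    · simp [h x hx]
  have hs : HasCompactSupport u := h1 ▸ hχ.mul_right
  rw [applyDist_eq P u.contDiff hs]
  change P _ = P _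
  congr 1
  ext x
  exact congrArg (fun f : SmoothFun (Euc d) => f x) h1.symm

variable {X : Type*} [NormedAddCommGroup X] [NormedSpace ℝ X] [FiniteDimensional ℝ X]

theorem applyDist_slice_eq (f : SmoothFun (X × Euc d)) {M R : ℝ}
    (h : ∀ x z, ‖x‖ ≤ M → f (x, z) ≠ 0 → ‖z‖ ≤ R) {χ : SmoothFun (Euc d)}
    (hχ : HasCompactSupport χ) (hχ1 : ∀ z, ‖z‖ ≤ R → χ z = 1) {x : X} (hx : ‖x‖ ≤ M) :
    applyDist P (fun z => f (x, z)) = applySnd (distCut P χ hχ) f x :=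
  applyDist_eq_distCut P (u := slice x f) hχ fun z hz => hχ1 z (h x z hx hz)

/-- For `x` in a ball the slices have supports in a common ball, so locally in `x` a single cutoff
serves and `applySnd` gives smoothness. -/
theorem contDiff_applyDist_slice (f : SmoothFun (X × Euc d))
    (h : ∀ M, ∃ R, ∀ x z, ‖x‖ ≤ M → f (x, z) ≠ 0 → ‖z‖ ≤ R) :
    ContDiff ℝ ∞ fun x => applyDist P fun z => f (x, z) := by
  rw [contDiff_iff_contDiffAt]
  intro x
  obtain ⟨R, hR⟩ := h (‖x‖ + 1)
  obtain ⟨χ, hχ, hχ1⟩ := exists_cutoff (X := Euc d) R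
  refine (applySnd (distCut P χ hχ) f).contDiff.contDiffAt.congr_of_eventuallyEq ?_
  filter_upwards [(isOpen_lt continuous_norm continuous_const).mem_nhds (lt_add_one ‖x‖)] with y hy
  exact applyDist_slice_eq P f hR hχ hχ1 (le_of_lt hy)

end ApplyDist

section Invariant

variable {d : ℕ} {m : ℝ} {P : 𝓓'((⊤ : Opens (Euc d)), ℝ)}

theorem _root_.SmoothFun.tsupport_pd_subset {X : Type*} [NormedAddCommGroup X] [NormedSpace ℝ X]
    (v : X) (u : SmoothFun X) : tsupport (pd v u) ⊆ tsupport u :=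
  tsupport_fderiv_apply_subset ℝ v

/-- The Laplace operator. -/
def laplace (u : SmoothFun (Euc d)) : SmoothFun (Euc d) :=
  ∑ i, pd (EuclideanSpace.single i 1) (pd (EuclideanSpace.single i 1) u)

/-- The differential equation in transposed form; moving two derivatives onto the test function
costs no sign. -/
theorem IsInvariantFundamentalSolution.apply_helmholtz (hP : IsInvariantFundamentalSolution m P)
    (u : SmoothFun (Euc d)) (hu : HasCompactSupport u) :
    applyDist P (m ^ 2 • u - laplace u : SmoothFun (Euc d)) = u 0 := by
  have h := congrArg (fun T => T (toTest u hu)) hP.helmholtz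
  have hpd : ∀ (v : Euc d) (u : SmoothFun (Euc d)) (hu : HasCompactSupport u),
      (∂_{v} (toTest u hu) : 𝓓((⊤ : Opens (Euc d)), ℝ)) =
        toTest (pd v u) (hasCompactSupport_pd hu v) := by
    intro v u hu
    ext x
    rw [TestFunction.lineDerivOp_eq_lineDerivCLM (𝕜 := ℝ), TestFunction.lineDerivCLM_apply]
    exact (u.differentiable x).lineDeriv_eq_fderiv
  have hs : HasCompactSupport (m ^ 2 • u - laplace u : SmoothFun (Euc d)) := by
    refine HasCompactSupport.intro hu.isCompact fun x hx => ?_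
    have h2 : ∀ v w : Euc d, pd v (pd w u) x = 0 := fun v w =>
      image_eq_zero_of_notMem_tsupport fun h =>
        hx (tsupport_pd_subset w u (tsupport_pd_subset v (pd w u) h))
    simp [laplace, h2, image_eq_zero_of_notMem_tsupport hx]
  rw [applyDist_eq P (SmoothFun.contDiff _) hs]
  have h1 : toTest (m ^ 2 • u - laplace u) hs = m ^ 2 • toTest u hu -
      ∑ i : Fin d, ∂_{EuclideanSpace.single i (1 : ℝ)} (∂_{EuclideanSpace.single i (1 : ℝ)} (toTest u hu)) := by
    simp only [hpd]
    ext x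
    simp [laplace]
  change P (toTest (m ^ 2 • u - laplace u) hs) = _
  rw [h1, map_sub, map_smul, map_sum]
  simp at h
  rw [← h, smul_eq_mul]
  ring

theorem IsInvariantFundamentalSolution.apply_neg (hP : IsInvariantFundamentalSolution m P)
    (u : SmoothFun (Euc d)) : applyDist P (fun x => u (-x)) = applyDist P u := by
  by_cases hu : HasCompactSupport u
  · have hu' : HasCompactSupport fun x => u (-x) := hu.comp_homeomorph (Homeomorph.neg _)
    rw [applyDist_eq P u.contDiff hu, applyDist_eq P (f := fun x => u (-x)) (u.contDiff.comp contDiff_neg) hu']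
    exact hP.invariant (LinearIsometryEquiv.neg ℝ) _ _ fun x => rfl
  -- Without compact support both sides are the default value `0`.
  · have hu' : ¬ HasCompactSupport fun x => u (-x) := fun h => hu (by
      simpa [Function.comp_def] using h.comp_homeomorph (Homeomorph.neg (Euc d)))
    rw [applyDist, applyDist, dif_neg (fun h => hu' h.2), dif_neg (fun h => hu h.2)]

end Invariant

end

/-! ### Smoothness of `P` away from the origin -/

section

namespace SmoothFun

variable {X : Type*} [NormedAddCommGroup X] [NormedSpace ℝ X]

theorem pd_eq_of_hasDerivAt {u : SmoothFun X} {x v : X} {c : ℝ}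
    (h : HasDerivAt (fun s : ℝ => u (x + s • v)) c 0) : pd v u x = c := by
  have h1 : HasDerivAt (fun s : ℝ => x + s • v) ((1 : ℝ) • v) 0 :=
    ((hasDerivAt_id (0 : ℝ)).smul_const v).const_add x
  have h2 : HasFDerivAt u (fderiv ℝ u x) (x + (0 : ℝ) • v) := by
    simpa using (u.differentiable x).hasFDerivAt
  have h3 := h2.comp_hasDerivAt (0 : ℝ) h1
  rw [pd_apply, h.unique h3, one_smul]

theorem hasDerivAt_comp (u : SmoothFun X) {γ : ℝ → X} {v : X} {t : ℝ} (h : HasDerivAt γ v t) :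
    HasDerivAt (fun s => u (γ s)) (pd v u (γ t)) t :=
  (u.differentiable (γ t)).hasFDerivAt.comp_hasDerivAt t h

theorem pd_neg_left (v : X) (u : SmoothFun X) : pd (-v) u = -pd v u := by
  ext x; simp [pd_apply]

theorem pd_eq_sum {d : ℕ} (v : Euc d) (u : SmoothFun (Euc d)) (x : Euc d) :
    pd v u x = ∑ i : Fin d, v i * pd (EuclideanSpace.single i 1) u x := by
  conv_lhs => rw [← (EuclideanSpace.basisFun (Fin d) ℝ).sum_repr v]
  simp [pd_apply]

theorem integral_mul_pd [FiniteDimensional ℝ X] [MeasurableSpace X] [BorelSpace X] (μ : Measure X)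
    [μ.IsAddHaarMeasure] {u : SmoothFun X} (hu : HasCompactSupport u) (w : SmoothFun X) (v : X) :
    ∫ x, u x * pd v w x ∂μ = -∫ x, pd v u x * w x ∂μ := by
  refine integral_mul_fderiv_eq_neg_fderiv_mul_of_integrable
    (((pd v u).continuous.mul w.continuous).integrable_of_hasCompactSupport
      (hasCompactSupport_pd hu v).mul_right)
    ((u.continuous.mul (pd v w).continuous).integrable_of_hasCompactSupport hu.mul_right)
    ((u.continuous.mul w.continuous).integrable_of_hasCompactSupport hu.mul_right)
    (fun x _ => u.differentiable x) (fun x _ => w.differentiable x)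

end SmoothFun

open SmoothFun

section Parametrix

/-- The antiderivative of a bump function around `0` that vanishes on `[1, ∞)`. -/
theorem exists_radial_profile : ∃ b b' : ℝ → ℝ, ContDiff ℝ ∞ b ∧ ContDiff ℝ ∞ b' ∧
    (∀ s, HasDerivAt b (b' s) s) ∧ (∀ s, 1 ≤ s → b s = 0 ∧ b' s = 0) ∧ (∀ s, 0 ≤ b' s) ∧
    b' 0 = 1 := by
  let ρ : ContDiffBump (0 : ℝ) := ⟨1 / 2, 1, by norm_num, by norm_num⟩
  have hρ : ∀ s, 1 ≤ s → ρ s = 0 := fun s hs => ρ.zero_of_le_dist (by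
    rw [Real.dist_eq, sub_zero, abs_of_nonneg (by linarith)]; exact hs)
  have hd : ∀ s, HasDerivAt (fun s => ∫ x in (1 : ℝ)..s, ρ x) (ρ s) s := fun s =>
    intervalIntegral.integral_hasDerivAt_right (ρ.continuous.intervalIntegrable _ _)
      ρ.continuous.aestronglyMeasurable.stronglyMeasurableAtFilter ρ.continuous.continuousAt
  refine ⟨fun s => ∫ x in (1 : ℝ)..s, ρ x, ρ, ?_, ρ.contDiff, hd, fun s hs => ⟨?_, hρ s hs⟩,
    fun s => ρ.nonneg, ρ.one_of_mem_closedBall (by simp [ρ])⟩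
  · rw [contDiff_infty_iff_deriv]
    refine ⟨fun s => (hd s).differentiableAt, ?_⟩
    rw [show deriv (fun s => ∫ x in (1 : ℝ)..s, ρ x) = ρ from funext fun s => (hd s).deriv]
    exact ρ.contDiff
  · refine (intervalIntegral.integral_congr (g := fun _ => 0) fun x hx => ?_).trans (by simp)
    rw [uIcc_of_le hs] at hx
    exact hρ x hx.1

variable {d : ℕ}

/-- A pair of functions of compact support in the unit cylinder of `𝔼 × ℝ`, the gradient of the
first one being the position vector times the second one. -/
theorem exists_radial_pair (d : ℕ) : ∃ ψ ρ : SmoothFun (Euc d × ℝ),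
    HasCompactSupport ψ ∧ HasCompactSupport ρ ∧ (∀ z t, ψ (z, t) ≠ 0 → ‖z‖ ≤ 1) ∧
    (∀ z t, ρ (z, t) ≠ 0 → ‖z‖ ≤ 1) ∧ (∀ p, pd (0, 1) ψ p = p.2 * ρ p) ∧
    (∀ i p, pd (EuclideanSpace.single i 1, 0) ψ p = p.1 i * ρ p) ∧
    (∀ z t, ρ (-z, t) = ρ (z, t)) ∧ 0 < ∫ x, ρ x := by
  obtain ⟨b, b', hb, hb', hd, h1, hnn, h0⟩ := exists_radial_profile
  have hq : ContDiff ℝ ∞ fun p : Euc d × ℝ => ‖p.1‖ ^ 2 + p.2 ^ 2 :=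
    ((contDiff_norm_sq ℝ).comp contDiff_fst).add (contDiff_snd.pow 2)
  -- The norm on the product is the maximum; outside its unit ball the Euclidean length is at least
  -- `1`.
  have hbig : ∀ p : Euc d × ℝ, ¬ ‖p‖ ≤ 1 → 1 ≤ ‖p.1‖ ^ 2 + p.2 ^ 2 := by
    intro p hp
    rw [Prod.norm_def, max_le_iff, not_and_or, not_le, not_le] at hp
    rcases hp with hp | hp
    · nlinarith [sq_nonneg p.2]
    · rw [Real.norm_eq_abs] at hp
      nlinarith [sq_nonneg ‖p.1‖, sq_abs p.2]
  have hsupp : ∀ f : Euc d × ℝ → ℝ, (∀ p, 1 ≤ ‖p.1‖ ^ 2 + p.2 ^ 2 → f p = 0) →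
      HasCompactSupport f ∧ ∀ z t, f (z, t) ≠ 0 → ‖z‖ ≤ 1 := by
    refine fun f hf => ⟨HasCompactSupport.intro (isCompact_closedBall 0 1) fun p hp => hf p
      (hbig p fun h => hp (mem_closedBall_zero_iff.2 h)), fun z t hz => ?_⟩
    by_contra hz1
    exact hz (hf _ (hbig _ fun h => hz1 ((norm_fst_le (z, t)).trans h)))
  have hψ := hsupp (fun p => b (‖p.1‖ ^ 2 + p.2 ^ 2)) fun p hp => (h1 _ hp).1
  have hρ := hsupp (fun p => 2 * b' (‖p.1‖ ^ 2 + p.2 ^ 2)) fun p hp => by simp [(h1 _ hp).2]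
  -- The squared length has gradient twice the position vector, whence the factor `2` in `ρ`.
  refine ⟨SmoothFun.mk (fun p => b (‖p.1‖ ^ 2 + p.2 ^ 2)) (hb.comp hq),
    SmoothFun.mk (fun p => 2 * b' (‖p.1‖ ^ 2 + p.2 ^ 2)) (contDiff_const.mul (hb'.comp hq)),
    hψ.1, hρ.1, hψ.2, hρ.2, fun ⟨z, t⟩ => ?_, fun i ⟨z, t⟩ => ?_, by simp, ?_⟩
  · refine pd_eq_of_hasDerivAt ?_
    have h : HasDerivAt (fun s : ℝ => ‖z‖ ^ 2 + (t + s) ^ 2) (2 * t) 0 := by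
      have := (((hasDerivAt_id (0 : ℝ)).const_add t).pow 2).const_add (‖z‖ ^ 2)
      simpa using this
    have h2 : HasDerivAt b (b' (‖z‖ ^ 2 + t ^ 2)) (‖z‖ ^ 2 + (t + 0) ^ 2) := by simpa using hd _
    have := h2.comp (0 : ℝ) h
    simpa [Function.comp_def, mul_comm, mul_left_comm, mul_assoc] using this
  · refine pd_eq_of_hasDerivAt ?_
    have h : HasDerivAt (fun s : ℝ => ‖z + s • EuclideanSpace.single i (1 : ℝ)‖ ^ 2 + t ^ 2)
        (2 * z i) 0 := by
      have := (((hasDerivAt_id (0 : ℝ)).smul_const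
        (EuclideanSpace.single i (1 : ℝ))).const_add z).norm_sq.add_const (t ^ 2)
      simpa [EuclideanSpace.inner_single_right] using this
    have h2 : HasDerivAt b (b' (‖z‖ ^ 2 + t ^ 2))
        (‖z + (0 : ℝ) • EuclideanSpace.single i (1 : ℝ)‖ ^ 2 + t ^ 2) := by simpa using hd _
    have := h2.comp (0 : ℝ) h
    simpa [Function.comp_def, mul_comm, mul_left_comm, mul_assoc] using this
  · refine Continuous.integral_pos_of_hasCompactSupport_nonneg_nonzero (x := 0)
      (SmoothFun.continuous _) hρ.1 (fun p => ?_) ?_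
    · exact mul_nonneg zero_le_two (hnn _)
    · simp [h0]

/-- The function `((σ, y), (z, t)) ↦ cos (m σ t) g (y - σ z)`. -/
def waveShift (m : ℝ) (g : SmoothFun (Euc d)) : SmoothFun ((ℝ × Euc d) × (Euc d × ℝ)) :=
  SmoothFun.mk (fun p => Real.cos (m * p.1.1 * p.2.2) * g (p.1.2 - p.1.1 • p.2.1)) <| by
    refine ContDiff.mul ?_ (g.contDiff.comp ?_) <;> fun_prop

@[simp] theorem waveShift_apply (m : ℝ) (g : SmoothFun (Euc d)) (σ t : ℝ) (y z : Euc d) :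
    waveShift m g ((σ, y), (z, t)) = Real.cos (m * σ * t) * g (y - σ • z) := rfl

theorem pd_waveShift_snd (m : ℝ) (g : SmoothFun (Euc d)) (v : Euc d) :
    pd ((0, v), 0) (waveShift m g) = waveShift m (pd v g) := by
  ext ⟨⟨σ, y⟩, ⟨z, t⟩⟩
  refine pd_eq_of_hasDerivAt ?_
  have h : HasDerivAt (fun s : ℝ => y + s • v - σ • z) v 0 := by
    simpa using (((hasDerivAt_id (0 : ℝ)).smul_const v).const_add y).sub_const (σ • z)
  simpa using (g.hasDerivAt_comp h).const_mul (Real.cos (m * σ * t))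

/-- The `σ`-derivative of `cos (m σ t) g (y - σ z)` produces the factors `t` and `zᵢ`. With `ρ` they
are the partial derivatives of `ψ`, and integrating by parts yields `m² g` from the `t`-direction
and `-Δg` from the others, each with a factor `σ`. -/
theorem apply_pd_waveShift (m : ℝ) (g : SmoothFun (Euc d)) {ψ ρ : SmoothFun (Euc d × ℝ)}
    (hψ : HasCompactSupport ψ) (hρ : HasCompactSupport ρ)
    (h1 : ∀ p, pd (0, 1) ψ p = p.2 * ρ p)
    (h2 : ∀ i p, pd (EuclideanSpace.single i 1, 0) ψ p = p.1 i * ρ p) (σ : ℝ) (y : Euc d) :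
    ∫ p, ρ p * pd ((1, 0), 0) (waveShift m g) ((σ, y), p) =
      σ * ∫ p, ψ p * waveShift m (m ^ 2 • g - laplace g) ((σ, y), p) := by
  let C (u : SmoothFun (Euc d)) : SmoothFun (Euc d × ℝ) := slice (σ, y) (waveShift m u)
  let A : SmoothFun (Euc d × ℝ) :=
    SmoothFun.mk (fun p => Real.sin (m * σ * p.2) * g (y - σ • p.1)) <| by
      refine ContDiff.mul ?_ (g.contDiff.comp ?_) <;> fun_prop
  have hA : pd (0, 1) A = (m * σ) • C g := by
    ext ⟨z, t⟩
    refine pd_eq_of_hasDerivAt ?_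
    have h : HasDerivAt (fun s : ℝ => m * σ * (t + s)) (m * σ) 0 := by
      simpa using ((hasDerivAt_id (0 : ℝ)).const_add t).const_mul (m * σ)
    have := h.sin.mul_const (g (y - σ • z))
    simpa [A, C, mul_comm, mul_left_comm, mul_assoc] using this
  have hC : ∀ i u, pd (EuclideanSpace.single i 1, 0) (C u) =
      -(σ • C (pd (EuclideanSpace.single i 1) u)) := by
    intro i u
    ext ⟨z, t⟩
    refine pd_eq_of_hasDerivAt ?_
    have h : HasDerivAt (fun s : ℝ => y - σ • (z + s • EuclideanSpace.single i (1 : ℝ)))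
        (-(σ • EuclideanSpace.single i (1 : ℝ))) 0 := by
      simpa using ((((hasDerivAt_id (0 : ℝ)).smul_const
        (EuclideanSpace.single i (1 : ℝ))).const_add z).const_smul σ).const_sub y
    have := (u.hasDerivAt_comp h).const_mul (Real.cos (m * σ * t))
    simpa [C, pd_neg_left, pd_smul_left, mul_left_comm] using this
  have hD : ∀ p, pd ((1, 0), 0) (waveShift m g) ((σ, y), p) =
      -(m * p.2 * A p) - ∑ i : Fin d, p.1 i * C (pd (EuclideanSpace.single i 1) g) p := by
    rintro ⟨z, t⟩
    refine pd_eq_of_hasDerivAt ?_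
    have h : HasDerivAt (fun s : ℝ => y - (σ + s) • z) (-z) 0 := by
      simpa using (((hasDerivAt_id (0 : ℝ)).const_add σ).smul_const z).const_sub y
    have h' : HasDerivAt (fun s : ℝ => m * (σ + s) * t) (m * t) 0 := by
      simpa using (((hasDerivAt_id (0 : ℝ)).const_add σ).const_mul m).mul_const t
    have h3 := h'.cos.mul (g.hasDerivAt_comp h)
    have e : Real.cos (m * σ * t) * pd z g (y - σ • z) =
        ∑ i : Fin d, z i * C (pd (EuclideanSpace.single i 1) g) (z, t) := by
      rw [pd_eq_sum, Finset.mul_sum]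
      exact Finset.sum_congr rfl fun i _ => mul_left_comm _ _ _
    rw [← e]
    refine (h3.congr_deriv ?_).congr_of_eventuallyEq (Eventually.of_forall fun s => ?_)
    · simp only [pd_neg_left, A, add_zero, mk_apply, SmoothFun.neg_apply]; ring
    · simp
  have hint : ∀ u : SmoothFun (Euc d × ℝ), Integrable fun p => ψ p * u p := fun u =>
    (ψ.continuous.mul u.continuous).integrable_of_hasCompactSupport hψ.mul_right
  have hintρ : ∀ u : Euc d × ℝ → ℝ, Continuous u → Integrable fun p => ρ p * u p := fun u hu =>
    (ρ.continuous.mul hu).integrable_of_hasCompactSupport hρ.mul_right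
  have hHaar : (volume : Measure (Euc d × ℝ)).IsAddHaarMeasure :=
    inferInstanceAs (Measure.prod volume volume).IsAddHaarMeasure
  have e1 : ∫ p, ρ p * (p.2 * A p) = -((m * σ) * ∫ p, ψ p * C g p) := by
    have := integral_mul_pd volume hψ A (0, 1)
    simp only [hA, h1, SmoothFun.smul_apply] at this
    rw [← integral_const_mul, ← integral_congr_ae (Eventually.of_forall fun p =>
      mul_left_comm (ψ p) (m * σ) (C g p)), this, neg_neg]
    exact integral_congr_ae (Eventually.of_forall fun p => by ring)
  have e2 : ∀ i, ∫ p, ρ p * (p.1 i * C (pd (EuclideanSpace.single i 1) g) p) =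
      σ * ∫ p, ψ p * C (pd (EuclideanSpace.single i 1) (pd (EuclideanSpace.single i 1) g)) p := by
    intro i
    have := integral_mul_pd volume hψ (C (pd (EuclideanSpace.single i 1) g))
      (EuclideanSpace.single i 1, 0)
    simp only [hC, h2, SmoothFun.smul_apply, SmoothFun.neg_apply, mul_neg, integral_neg,
      neg_inj] at this
    rw [← integral_const_mul, ← integral_congr_ae (Eventually.of_forall fun p =>
      mul_left_comm (ψ p) σ _), this]
    exact integral_congr_ae (Eventually.of_forall fun p => by ring)
  have e3 : ∀ p, ψ p * waveShift m (m ^ 2 • g - laplace g) ((σ, y), p) = m ^ 2 * (ψ p * C g p) -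
      ∑ i, ψ p * C (pd (EuclideanSpace.single i 1) (pd (EuclideanSpace.single i 1) g)) p := by
    rintro ⟨z, t⟩
    simp only [C, slice_apply, waveShift_apply, laplace, SmoothFun.sub_apply, SmoothFun.smul_apply,
      SmoothFun.sum_apply, ← Finset.mul_sum]
    ring
  have e4 : ∀ p, ρ p * pd ((1, 0), 0) (waveShift m g) ((σ, y), p) = (-m) * (ρ p * (p.2 * A p)) -
      ∑ i : Fin d, ρ p * (p.1 i * C (pd (EuclideanSpace.single i 1) g) p) := by
    intro p
    rw [hD, ← Finset.mul_sum]
    ring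
  have hcoord : ∀ i : Fin d, Continuous fun p : Euc d × ℝ => p.1 i := fun i => by fun_prop
  have i1 : Integrable fun p => ρ p * (p.2 * A p) := hintρ _ (continuous_snd.mul A.continuous)
  have i2 : ∀ i : Fin d, Integrable fun p =>
      ρ p * (p.1 i * C (pd (EuclideanSpace.single i 1) g) p) :=
    fun i => hintρ _ ((hcoord i).mul (C _).continuous)
  simp only [e3, e4]
  rw [integral_sub (i1.const_mul _) (integrable_finsetSum _ fun i _ => i2 i),
    integral_sub ((hint _).const_mul _) (integrable_finsetSum _ fun i _ => hint _),
    integral_finsetSum _ fun i _ => i2 i,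
    integral_finsetSum _ fun i _ => hint _, integral_const_mul, integral_const_mul, e1]
  simp only [e2, ← Finset.mul_sum]
  ring

/-- The average `y ↦ ∫ η(z, t) cos (m σ t) g (y - σ z) d(z, t)`, as a linear map in `g`. -/
def waveAverage (m σ : ℝ) (η : SmoothFun (Euc d × ℝ)) (hη : HasCompactSupport η) :
    SmoothFun (Euc d) →ₗ[ℝ] SmoothFun (Euc d) where
  toFun g := slice σ (applySnd (intDist volume η η.continuous hη) (waveShift m g))
  map_add' g g' := by
    rw [← slice_add, ← applySnd_add]
    congr 2
    ext ⟨⟨σ, y⟩, ⟨z, t⟩⟩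
    exact mul_add _ _ _
  map_smul' c g := by
    rw [RingHom.id_apply, ← slice_smul, ← applySnd_smul]
    congr 2
    ext ⟨⟨σ, y⟩, ⟨z, t⟩⟩
    exact mul_left_comm _ _ _

theorem waveAverage_apply (m σ : ℝ) (η : SmoothFun (Euc d × ℝ)) (hη : HasCompactSupport η)
    (g : SmoothFun (Euc d)) (y : Euc d) :
    waveAverage m σ η hη g y = ∫ p, η p * waveShift m g ((σ, y), p) := rfl

theorem pd_waveAverage (m σ : ℝ) (η : SmoothFun (Euc d × ℝ)) (hη : HasCompactSupport η)
    (g : SmoothFun (Euc d)) (v : Euc d) :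
    pd v (waveAverage m σ η hη g) = waveAverage m σ η hη (pd v g) := by
  change pd v (slice σ (applySnd _ _)) = slice σ (applySnd _ _)
  rw [pd_slice, pd_applySnd, pd_waveShift_snd]

theorem waveAverage_helmholtz (m σ a : ℝ) (η : SmoothFun (Euc d × ℝ)) (hη : HasCompactSupport η)
    (g : SmoothFun (Euc d)) : waveAverage m σ η hη (a • g - laplace g) =
      a • waveAverage m σ η hη g - laplace (waveAverage m σ η hη g) := by
  simp only [laplace, map_sub, map_smul, map_sum, pd_waveAverage]

/-- The average at `y` only sees the ball of radius `σ` about `y`. -/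
theorem waveAverage_eq_zero {m σ : ℝ} {η : SmoothFun (Euc d × ℝ)} (hη : HasCompactSupport η)
    (h1 : ∀ z t, η (z, t) ≠ 0 → ‖z‖ ≤ 1) {g : SmoothFun (Euc d)} (hσ : 0 ≤ σ) {y : Euc d}
    (hg : ∀ x, ‖x - y‖ ≤ σ → g x = 0) : waveAverage m σ η hη g y = 0 := by
  rw [waveAverage_apply]
  refine integral_eq_zero_of_ae (Eventually.of_forall ?_)
  rintro ⟨z, t⟩
  by_cases hz : η (z, t) = 0
  · simp [hz]
  · have : g (y - σ • z) = 0 := hg _ (by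
      rw [sub_sub_cancel_left, norm_neg, norm_smul, Real.norm_of_nonneg hσ]
      exact mul_le_of_le_one_right hσ (h1 z t hz))
    simp [this]

/-- Away from the origin, an invariant fundamental solution is given by an even smooth function. -/
theorem IsInvariantFundamentalSolution.exists_smooth {m : ℝ} {P : 𝓓'((⊤ : Opens (Euc d)), ℝ)}
    (hP : IsInvariantFundamentalSolution m P) {r : ℝ} (hr : 0 < r) :
    ∃ p : SmoothFun (Euc d), (∀ x, p (-x) = p x) ∧
      ∀ f : SmoothFun (Euc d), HasCompactSupport f → (∀ x, ‖x‖ ≤ r → f x = 0) →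
        applyDist P f = ∫ x, f x * p x := by
  obtain ⟨ψ, ρ, hψ, hρ, hψ1, hρ1, h1, h2, heven, hc⟩ := exists_radial_pair d
  obtain ⟨R₁, hR₁⟩ := hρ.isCompact.isBounded.exists_norm_le
  -- `χ₁` is `1` for all `t` occurring in the support of `ρ`. It makes the weight `θ` compactly
  -- supported, so that the integral of `ρ` over `t` against `cos (m r t)` is smooth as a value of
  -- `applySnd`.
  obtain ⟨χ₁, hχ₁, hχ₁'⟩ := exists_cutoff (X := ℝ) R₁
  let θ : SmoothFun ℝ := SmoothFun.mk (fun t => χ₁ t * Real.cos (m * r * t))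
    (χ₁.contDiff.mul (by fun_prop))
  have hθ : HasCompactSupport θ := hχ₁.mul_right
  let g : SmoothFun (Euc d) := applySnd (intDist volume θ θ.continuous hθ) ρ
  have hg : ∀ z, g z = ∫ t, ρ (z, t) * Real.cos (m * r * t) := by
    intro z
    change ∫ t, _ = _
    refine integral_congr_ae (Eventually.of_forall fun t => ?_)
    change χ₁ t * Real.cos (m * r * t) * ρ (z, t) = _
    by_cases hz : ρ (z, t) = 0
    · simp [hz]
    · rw [hχ₁' t ((norm_snd_le (z, t)).trans (hR₁ _ (subset_tsupport _ hz))), one_mul, mul_comm]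
  have hg1 : ∀ z, g z ≠ 0 → ‖z‖ ≤ 1 := by
    intro z hz
    by_contra hz1
    refine hz ((hg z).trans (integral_eq_zero_of_ae (Eventually.of_forall fun t => ?_)))
    have : ρ (z, t) = 0 := by
      by_contra h
      exact hz1 (hρ1 z t h)
    simp [this]
  have hgeven : ∀ z, g (-z) = g z := fun z => by simp [hg, heven]
  let w : SmoothFun (Euc d × Euc d) := SmoothFun.mk (fun q => g (r⁻¹ • (q.2 - q.1)))
    (g.contDiff.comp (by fun_prop))
  have hw : ∀ (M : ℝ) (x z : Euc d), ‖x‖ ≤ M → w (x, z) ≠ 0 → ‖z‖ ≤ M + r := by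
    intro M x z hx hz
    have h := hg1 _ hz
    rw [norm_smul, norm_inv, Real.norm_of_nonneg hr.le, inv_mul_le_iff₀ hr, mul_one] at h
    have := norm_le_norm_add_norm_sub' z x
    linarith
  -- `κ` is the Jacobian of the substitution `x = y - r z`, and `c` is the total mass of `ρ`. The
  -- witness `p` is read off from `c · P f = P (W_r f)`.
  let κ : ℝ := |(r ^ d)⁻¹|
  let c : ℝ := ∫ p, ρ p
  refine ⟨(c⁻¹ * κ) • SmoothFun.mk (fun x => applyDist P fun z => w (x, z))
    (contDiff_applyDist_slice P w fun M => ⟨M + r, hw M⟩), fun x => ?_, fun f hf hf0 => ?_⟩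
  · simp only [SmoothFun.smul_apply, SmoothFun.mk_apply]
    congr 1
    refine Eq.trans ?_ (hP.apply_neg (slice x w))
    congr 1
    ext z
    simp only [w, slice_apply, SmoothFun.mk_apply]
    rw [← hgeven]
    congr 1
    simp only [← smul_neg]
    congr 1
    abel
  obtain ⟨R, hR⟩ := hf.isCompact.isBounded.exists_norm_le
  have hfR : ∀ x, f x ≠ 0 → ‖x‖ ≤ R := fun x hx => hR x (subset_tsupport _ hx)
  -- The averages of `f` at scales `σ ≤ r`, and the functions `w (x, ·)` with `‖x‖ ≤ R`, live in the
  -- ball of radius `R + r`; on them `Q` agrees with `P`.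
  obtain ⟨χ, hχ, hχ1⟩ := exists_cutoff (X := Euc d) (R + r)
  let Q := distCut P χ hχ
  let h : SmoothFun ℝ := applySnd Q (applySnd (intDist volume ρ ρ.continuous hρ) (waveShift m f))
  have hh : ∀ σ, h σ = Q (waveAverage m σ ρ hρ f) := fun σ => rfl
  -- The derivative is `σ P((m² - Δ) u) = σ u(0)`, and `u(0)` averages `f` over the ball of radius
  -- `σ ≤ r`, where `f` vanishes.
  have hderiv : ∀ σ ∈ Icc 0 r, pd 1 h σ = 0 := by
    intro σ hσ
    let u := waveAverage m σ ψ hψ f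
    have e1 : slice σ (applySnd (intDist volume ρ ρ.continuous hρ)
        (pd ((1, 0), 0) (waveShift m f))) = σ • (m ^ 2 • u - laplace u) := by
      rw [← waveAverage_helmholtz]
      ext y
      exact apply_pd_waveShift m f hψ hρ h1 h2 σ y
    have hu : ∀ y, y ∈ tsupport u → ‖y‖ ≤ R + r := by
      intro y hy
      refine mem_closedBall_zero_iff.1 (closure_minimal (fun y hy => ?_)
        Metric.isClosed_closedBall hy)
      by_contra hy1
      refine hy (waveAverage_eq_zero hψ hψ1 hσ.1 fun x hx => ?_)
      by_contra hx0
      refine hy1 (mem_closedBall_zero_iff.2 ?_)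
      have := norm_le_norm_add_norm_sub x y
      linarith [hfR x hx0, hσ.2]
    have hus : HasCompactSupport u := HasCompactSupport.of_support_subset_isCompact
      (isCompact_closedBall 0 (R + r)) fun y hy =>
        mem_closedBall_zero_iff.2 (hu y (subset_tsupport _ hy))
    rw [pd_applySnd, pd_applySnd, applySnd_apply]
    change Q (slice σ (applySnd _ (pd ((1, 0), 0) (waveShift m f)))) = 0
    have e2 : ∀ y, (m ^ 2 • u - laplace u : SmoothFun (Euc d)) y ≠ 0 → χ y = 1 := by
      intro y hy
      refine hχ1 y (hu y ?_)
      by_contra hyu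
      refine hy ?_
      have h2 : ∀ v w : Euc d, pd v (pd w u) y = 0 := fun v w =>
        image_eq_zero_of_notMem_tsupport fun h =>
          hyu (tsupport_pd_subset w u (tsupport_pd_subset v (pd w u) h))
      simp [laplace, h2, image_eq_zero_of_notMem_tsupport hyu]
    rw [e1, map_smul, ← applyDist_eq_distCut P hχ e2, hP.apply_helmholtz u hus,
      waveAverage_eq_zero hψ hψ1 hσ.1 fun x hx => ?_, smul_zero]
    exact hf0 x (by rw [sub_zero] at hx; exact hx.trans hσ.2)
  have hconst : h r = h 0 := by
    refine constant_of_has_deriv_right_zero h.continuous.continuousOn (fun σ hσ => ?_) r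
      (right_mem_Icc.2 hr.le)
    have := (h.hasDerivAt_comp (hasDerivAt_id σ)).hasDerivWithinAt (s := Ici σ)
    rwa [id, hderiv σ (Ico_subset_Icc_self hσ)] at this
  have h0 : waveAverage m 0 ρ hρ f = c • f := by
    ext y
    simp only [waveAverage_apply, waveShift, SmoothFun.mk_apply, mul_zero, zero_mul, Real.cos_zero,
      zero_smul, sub_zero, one_mul, integral_mul_const]
    rfl
  have hrκ : waveAverage m r ρ hρ f = κ • applySnd (intDist volume f f.continuous hf) (swap w) := by
    ext y
    have e1 : waveAverage m r ρ hρ f y = ∫ z, f (y - r • z) * g z := by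
      rw [waveAverage_apply]
      have hi : Integrable (fun p => ρ p * waveShift m f ((r, y), p)) :=
        (ρ.continuous.mul (slice (r, y) (waveShift m f)).continuous).integrable_of_hasCompactSupport
          hρ.mul_right
      rw [Measure.volume_eq_prod, integral_prod _ hi]
      refine integral_congr_ae (Eventually.of_forall fun z => ?_)
      simp only [hg, ← integral_const_mul]
      refine integral_congr_ae (Eventually.of_forall fun t => ?_)
      simp only [waveShift_apply]
      ring
    let Φ : Euc d → ℝ := fun x => f x * g (r⁻¹ • (y - x))
    have e2 : ∀ z, f (y - r • z) * g z = Φ (y - r • z) := fun z => by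
      simp [Φ, inv_smul_smul₀ hr.ne']
    rw [e1]
    simp only [e2]
    rw [Measure.integral_comp_smul volume (fun x => Φ (y - x)) r, integral_sub_left_eq_self Φ,
      finrank_euclideanSpace_fin]
    rfl
  have e0 : h 0 = c * applyDist P f := by
    rw [hh, h0, map_smul, smul_eq_mul, applyDist_eq_distCut P hχ fun x hx =>
      hχ1 x ((hfR x hx).trans (by linarith))]
  have er : h r = κ * ∫ x, f x * applyDist P fun z => w (x, z) := by
    rw [hh, hrκ, map_smul, smul_eq_mul, apply_applySnd_swap]
    congr 1
    refine integral_congr_ae (Eventually.of_forall fun x => ?_)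
    by_cases hx : f x = 0
    · simp [hx]
    · simp only
      rw [applyDist_slice_eq P w (hw R) hχ hχ1 (hfR x hx)]
      rfl
  have hc0 : c ≠ 0 := hc.ne'
  have e3 : applyDist P f = c⁻¹ * h r := by rw [hconst, e0, inv_mul_cancel_left₀ hc0]
  rw [e3, er, ← mul_assoc, ← integral_const_mul]
  refine integral_congr_ae (Eventually.of_forall fun x => ?_)
  simp only [SmoothFun.smul_apply, SmoothFun.mk_apply]
  ring

end Parametrix

end

/-! ### Existence of `P^{⊗k} T` and uniqueness of pairings -/

section

open SmoothFun

variable {d k : ℕ}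

namespace SmoothFun

/-- The function `y ↦ Q (z ↦ f (y₁, …, yᵢ + z, …, yₖ))`. -/
def shiftSlot (Q : Config d →L[ℝ] ℝ) (i : Fin k) :
    SmoothFun (Fin k → Euc d) →L[ℝ] SmoothFun (Fin k → Euc d) :=
  let A : (Fin k → Euc d) × Euc d →L[ℝ] (Fin k → Euc d) := .fst ℝ _ _ +
    (ContinuousLinearMap.single ℝ (fun _ : Fin k => Euc d) i).comp (.snd ℝ _ _)
  { toFun := fun f => applySnd Q (pullback A f)
    map_add' := fun f g => applySnd_add Q (pullback A f) (pullback A g)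
    map_smul' := fun c f => applySnd_smul Q c (pullback A f)
    cont := continuous_applySnd (T := fun _ => Q) (Q.continuous.comp continuous_snd)
      (continuous_id.smoothFun_pullback A) }

theorem shiftSlot_apply (Q : Config d →L[ℝ] ℝ) (i : Fin k) (f : SmoothFun (Fin k → Euc d))
    (y : Fin k → Euc d) : shiftSlot Q i f y = Q (SmoothFun.mk
      (fun z => f (Function.update y i (y i + z)))
      (f.contDiff.comp ((contDiff_update _ y i).comp (contDiff_const.add contDiff_id)))) := by
  change Q _ = Q _
  congr 1
  ext z
  change f (y + Pi.single i z) = f _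
  congr 1
  ext j : 1
  by_cases h : j = i
  · subst h; simp
  · simp [h]

/-- Iterated application of a distribution in the arguments from a list. -/
def shiftList (Q : Config d →L[ℝ] ℝ) :
    List (Fin k) → (SmoothFun (Fin k → Euc d) →L[ℝ] SmoothFun (Fin k → Euc d))
  | [] => .id ℝ _
  | i :: l => (shiftSlot Q i).comp (shiftList Q l)

theorem shiftList_cons (Q : Config d →L[ℝ] ℝ) (i : Fin k) (l : List (Fin k))
    (f : SmoothFun (Fin k → Euc d)) :
    shiftList Q (i :: l) f = shiftSlot Q i (shiftList Q l f) := rfl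

/-- Slots outside the list are not integrated over, so the bound on the support survives there. This
keeps the next slot bounded, as needed for a cutoff. -/
theorem shiftList_eq_zero (Q : Config d →L[ℝ] ℝ) {f : SmoothFun (Fin k → Euc d)} {R : ℝ}
    (hf : ∀ x, f x ≠ 0 → ‖x‖ ≤ R) (l : List (Fin k)) {y : Fin k → Euc d} {j : Fin k} (hj : j ∉ l)
    (hy : R < ‖y j‖) : shiftList Q l f y = 0 := by
  induction l generalizing y with
  | nil =>
    by_contra h
    exact (hy.trans_le ((norm_le_pi_norm y j).trans (hf y h))).false
  | cons i l ih =>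
    rw [List.mem_cons, not_or] at hj
    rw [shiftList_cons, shiftSlot_apply]
    refine (congrArg Q (SmoothFun.ext fun z => ?_)).trans (map_zero Q)
    exact ih hj.2 (by rwa [Function.update_of_ne hj.1])

/-- The tensor product of functions of one variable. -/
def prodFun (f : Fin k → Config d) : SmoothFun (Fin k → Euc d) :=
  SmoothFun.mk (fun x => ∏ i, f i (x i))
    (contDiff_prod fun i _ => (f i).contDiff.comp (contDiff_apply ℝ (Euc d) i))

@[simp] theorem prodFun_apply (f : Fin k → Config d) (x : Fin k → Euc d) :
    prodFun f x = ∏ i, f i (x i) := rfl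

theorem prodFun_mul (f g : Fin k → Config d) :
    prodFun f * prodFun g = prodFun fun i => f i * g i := by
  ext x; simp [Finset.prod_mul_distrib]

theorem expFun_pi (ℓ : (Fin k → Euc d) →L[ℝ] ℝ) : expFun ℓ = prodFun fun i =>
    expFun (ℓ.comp (ContinuousLinearMap.single ℝ (fun _ : Fin k => Euc d) i)) := by
  ext x
  simp only [expFun_apply, prodFun_apply, ← Real.exp_sum]
  congr 1
  conv_lhs => rw [← Finset.univ_sum_single x, map_sum]
  rfl

/-- Translation of a function. -/
def shiftArg (y : Euc d) (f : Config d) : Config d :=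
  SmoothFun.mk (fun z => f (y + z)) (f.contDiff.comp (contDiff_const.add contDiff_id))

theorem shiftList_prodFun (Q : Config d →L[ℝ] ℝ) (f : Fin k → Config d) {l : List (Fin k)}
    (hl : l.Nodup) (y : Fin k → Euc d) : shiftList Q l (prodFun f) y =
      ∏ i, if i ∈ l then Q (shiftArg (y i) (f i)) else f i (y i) := by
  induction l generalizing y with
  | nil => simp [shiftList]
  | cons i l ih =>
    rw [List.nodup_cons] at hl
    rw [shiftList_cons, shiftSlot_apply, ← Finset.mul_prod_erase _ _ (Finset.mem_univ i),
      if_pos List.mem_cons_self, mul_comm, ← smul_eq_mul, ← map_smul]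
    congr 1
    ext z
    rw [SmoothFun.mk_apply, ih hl.2, ← Finset.mul_prod_erase _ _ (Finset.mem_univ i),
      if_neg hl.1, Function.update_self, mul_comm]
    change _ * _ = _ * f i (y i + z)
    congr 1
    refine Finset.prod_congr rfl fun j hj => ?_
    have hj' := Finset.ne_of_mem_erase hj
    rw [Function.update_of_ne hj']
    simp [hj']

end SmoothFun

open SmoothFun

section Convolve

variable (P : 𝓓'((⊤ : Opens (Euc d)), ℝ))

/-- If `‖yⱼ‖ ≤ M` and `‖yⱼ + z‖ ≤ R` then `‖z‖ ≤ R + M`, so one cutoff of that radius serves in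
every slot. -/
theorem foldr_convolveSlot_eq {f : SmoothFun (Fin k → Euc d)} {R M : ℝ}
    (hf : ∀ x, f x ≠ 0 → ‖x‖ ≤ R) {χ : Config d} (hχ : HasCompactSupport χ)
    (hχ1 : ∀ z, ‖z‖ ≤ R + M → χ z = 1) {l : List (Fin k)} (hl : l.Nodup) {y : Fin k → Euc d}
    (hy : ∀ j ∈ l, ‖y j‖ ≤ M) :
    l.foldr (convolveSlot P) f y = shiftList (distCut P χ hχ) l f y := by
  induction l generalizing y with
  | nil => rfl
  | cons i l ih =>
    rw [List.nodup_cons] at hl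
    rw [List.foldr_cons, shiftList_cons, shiftSlot_apply, ← applyDist_eq_distCut P hχ, convolveSlot]
    · congr 1
      ext z
      refine ih hl.2 fun j hj => ?_
      rw [Function.update_of_ne (ne_of_mem_of_not_mem hj hl.1)]
      exact hy j (List.mem_cons_of_mem _ hj)
    · intro z hz
      refine hχ1 z (not_lt.1 fun h => hz (shiftList_eq_zero _ hf l hl.1 ?_))
      rw [Function.update_self]
      have := norm_le_norm_add_norm_sub' z (y i + z)
      have h1 := hy i List.mem_cons_self
      rw [sub_add_cancel_right, norm_neg] at this
      linarith

theorem convolveAll_eq {f : SmoothFun (Fin k → Euc d)} {R M : ℝ}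
    (hf : ∀ x, f x ≠ 0 → ‖x‖ ≤ R) {χ : Config d} (hχ : HasCompactSupport χ)
    (hχ1 : ∀ z, ‖z‖ ≤ R + M → χ z = 1) {y : Fin k → Euc d} (hy : ‖y‖ ≤ M) :
    convolveAll P f y = shiftList (distCut P χ hχ) (List.finRange k) f y :=
  foldr_convolveSlot_eq P hf hχ hχ1 (List.nodup_finRange k) fun j _ =>
    (norm_le_pi_norm y j).trans hy

theorem contDiff_convolveAll {f : SmoothFun (Fin k → Euc d)} (hf : HasCompactSupport f) :
    ContDiff ℝ ∞ (convolveAll P f) := by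
  obtain ⟨R, hR⟩ := hf.isCompact.isBounded.exists_norm_le
  rw [contDiff_iff_contDiffAt]
  intro y
  obtain ⟨χ, hχ, hχ1⟩ := exists_cutoff (X := Euc d) (R + (‖y‖ + 1))
  refine (shiftList (distCut P χ hχ) (List.finRange k) f).contDiff.contDiffAt.congr_of_eventuallyEq
    ?_
  filter_upwards [(isOpen_lt continuous_norm continuous_const).mem_nhds (lt_add_one ‖y‖)] with z hz
  exact convolveAll_eq P (fun x hx => hR x (subset_tsupport _ hx)) hχ hχ1 (le_of_lt hz)

/-- The distribution `P^{⊗k} T` exists. -/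
theorem exists_isTensorConvolution (T : CompDist (Fin k → Euc d)) :
    ∃ S, IsTensorConvolution P T S := by
  obtain ⟨M, hM⟩ := CompDist.exists_dsupport_subset_of_continuous (T := fun _ : Unit => T)
    (T.continuous.comp continuous_snd) ()
  replace hM := hM.self_of_nhds
  have hR : ∀ K : Compacts (Fin k → Euc d), ∃ R : ℝ, ∀ x ∈ K, ‖x‖ ≤ R := fun K =>
    K.isCompact.isBounded.exists_norm_le
  choose R hR using hR
  -- The summand `M + 1` belongs to the open ball of that radius, a neighbourhood of the support of
  -- `T`; `R K` bounds the test functions supported in `K`.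
  choose χ hχ hχ1 using fun K : Compacts (Fin k → Euc d) =>
    exists_cutoff (X := Euc d) (R K + (M + 1))
  have hcd : ∀ f : 𝓓((⊤ : Opens (Fin k → Euc d)), ℝ), ContDiff ℝ ∞ (convolveAll P f) := fun f =>
    contDiff_convolveAll P (f := SmoothFun.mk f f.contDiff) f.hasCompactSupport
  -- On functions supported in a fixed `K` a single cutoff works, and the map is a composition of
  -- continuous ones. Continuity on test functions is continuity on each such space.
  refine ⟨TestFunction.limitCLM ℝ (fun f => T (SmoothFun.mk _ (hcd f))) (fun K _ =>
    { toFun := fun f => T (shiftList (distCut P (χ K) (hχ K)) (List.finRange k) (ofSupp f))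
      map_add' := fun f g => by
        rw [show ofSupp (f + g) = ofSupp f + ofSupp g from rfl, map_add, map_add]
      map_smul' := fun c f => by
        rw [show ofSupp (c • f) = c • ofSupp f from rfl, map_smul, map_smul, RingHom.id_apply]
      cont := T.continuous.comp ((ContinuousLinearMap.continuous _).comp continuous_ofSupp) })
    fun K hK f => ?_, fun f => ⟨hcd f, rfl⟩⟩
  refine T.apply_eq_of_eqOn (U := Metric.ball 0 (M + 1)) Metric.isOpen_ball
    (hM.trans (Metric.closedBall_subset_ball (lt_add_one M))) fun y hy => ?_
  refine convolveAll_eq P (f := ofSupp f) (R := R K) (fun x hx => hR K x ?_) (hχ K) (hχ1 K)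
    (mem_ball_zero_iff.1 hy).le
  by_contra h
  exact hx (f.zero_on_compl h)

theorem IsTensorConvolution.unique {P : 𝓓'((⊤ : Opens (Euc d)), ℝ)} {T : CompDist (Fin k → Euc d)}
    {S S' : 𝓓'((⊤ : Opens (Fin k → Euc d)), ℂ)} (h : IsTensorConvolution P T S)
    (h' : IsTensorConvolution P T S') (f : 𝓓((⊤ : Opens (Fin k → Euc d)), ℝ)) : S f = S' f := by
  obtain ⟨_, h⟩ := h f
  obtain ⟨_, h'⟩ := h' f
  rw [h, h']

/-- By the fundamental lemma of the calculus of variations the two smooth representatives agree on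
the open set `U ∩ U'`, which still contains the support of `T`. -/
theorem IsPairing.unique {T : CompDist (Fin k → Euc d)}
    {S S' : 𝓓'((⊤ : Opens (Fin k → Euc d)), ℂ)} (hS : ∀ f, S f = S' f) {c c' : ℂ}
    (h : IsPairing T S c) (h' : IsPairing T S' c') : c = c' := by
  obtain ⟨U, u, v, hU, hTU, hS1, rfl⟩ := h
  obtain ⟨U', u', v', hU', hTU', hS2, rfl⟩ := h'
  have hW : IsOpen (U ∩ U') := hU.inter hU'
  have hTW : Distribution.dsupport T ⊆ U ∩ U' := subset_inter hTU hTU'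
  let a (u v : SmoothFun (Fin k → Euc d)) (x : Fin k → Euc d) : ℂ := u x + Complex.I * v x
  have ha : ∀ u v, Continuous (a u v) := fun u v => by
    have := u.continuous; have := v.continuous; fun_prop
  have hae : ∀ᵐ x, x ∈ U ∩ U' → a u v x - a u' v' x = 0 := by
    refine hW.ae_eq_zero_of_integral_contDiff_smul_eq_zero
      (((ha u v).sub (ha u' v')).locallyIntegrable.locallyIntegrableOn _) fun g hg hgs hgU => ?_
    have hi : ∀ u v, Integrable fun x => (g x : ℂ) * a u v x := fun u v =>
      ((Complex.continuous_ofReal.comp hg.continuous).mul (ha u v)).integrable_of_hasCompactSupport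
        (HasCompactSupport.mul_right (hgs.comp_left (g := fun x : ℝ => (x : ℂ)) rfl))
    have h := hS (toTest (SmoothFun.mk g hg) hgs)
    rw [hS1 _ (hgU.trans inter_subset_left), hS2 _ (hgU.trans inter_subset_right)] at h
    simp only [Complex.real_smul, mul_sub]
    rw [integral_sub (hi u v) (hi u' v')]
    exact sub_eq_zero.2 h
  have heq : EqOn (a u v) (a u' v') (U ∩ U') := by
    refine Measure.eqOn_open_of_ae_eq (μ := volume) ?_ hW (ha u v).continuousOn (ha u' v').continuousOn
    rw [EventuallyEq, ae_restrict_iff' hW.measurableSet]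
    filter_upwards [hae] with x hx hxW using sub_eq_zero.1 (hx hxW)
  have hre : EqOn u u' (U ∩ U') := fun x hx => by simpa [a] using congrArg Complex.re (heq hx)
  have him : EqOn v v' (U ∩ U') := fun x hx => by simpa [a] using congrArg Complex.im (heq hx)
  rw [T.apply_eq_of_eqOn hW hTW hre, T.apply_eq_of_eqOn hW hTW him]

theorem IsContraction.unique {P : 𝓓'((⊤ : Opens (Euc d)), ℝ)} {T T' : CompDist (Fin k → Euc d)}
    {c c' : ℂ} (h : IsContraction P T T' c) (h' : IsContraction P T T' c') : c = c' := by
  obtain ⟨S, hS, hc⟩ := h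
  obtain ⟨S', hS', hc'⟩ := h'
  exact hc.unique (hS.unique hS') hc'

end Convolve

end

/-! ### Contraction of distributions with separated supports by a smooth kernel -/

section

open SmoothFun

variable {d k : ℕ}

namespace SmoothFun

/-- The kernel `K(x₁, y₁) ⋯ K(xₖ, yₖ)`. -/
def kerPow (k : ℕ) (K : SmoothFun (Euc d × Euc d)) :
    SmoothFun ((Fin k → Euc d) × (Fin k → Euc d)) :=
  SmoothFun.mk (fun p => ∏ i, K (p.1 i, p.2 i)) <| contDiff_prod fun i _ =>
    K.contDiff.comp (((contDiff_apply ℝ (Euc d) i).comp contDiff_fst).prodMk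
      ((contDiff_apply ℝ (Euc d) i).comp contDiff_snd))

@[simp] theorem kerPow_apply (K : SmoothFun (Euc d × Euc d)) (p : (Fin k → Euc d) × (Fin k → Euc d)) :
    kerPow k K p = ∏ i, K (p.1 i, p.2 i) := rfl

/-- The kernel `p(x - y)`. -/
def diffKernel (p : Config d) : SmoothFun (Euc d × Euc d) :=
  pullback (ContinuousLinearMap.fst ℝ _ _ - ContinuousLinearMap.snd ℝ _ _) p

@[simp] theorem diffKernel_apply (p : Config d) (q : Euc d × Euc d) :
    diffKernel p q = p (q.1 - q.2) := rfl

end SmoothFun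

section Separated

variable {P : 𝓓'((⊤ : Opens (Euc d)), ℝ)} {p : Config d} {r : ℝ}

/-- On products of one-variable functions supported in `A` the claim factors into the one-variable
formula for `P`. Multiplying by the cutoff `X`, which is `1` on the support of `f`, makes both sides
continuous linear in an arbitrary smooth function, so exponentials suffice. -/
theorem convolveAll_eq_integral
    (hp : ∀ f : Config d, HasCompactSupport f → (∀ x, ‖x‖ ≤ r → f x = 0) →
      applyDist P f = ∫ x, f x * p x) {A B : Set (Euc d)} (hA : IsOpen A)
    (hAB : ∀ a ∈ A, ∀ b ∈ B, r < ‖a - b‖) {f : SmoothFun (Fin k → Euc d)}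
    (hf : HasCompactSupport f) (hfA : tsupport f ⊆ pi univ fun _ => A) {y : Fin k → Euc d}
    (hy : ∀ i, y i ∈ B) :
    convolveAll P f y = ∫ x, f x * kerPow k (diffKernel p) (x, y) := by
  have hL : IsCompact (⋃ i : Fin k, (fun x : Fin k → Euc d => x i) '' tsupport f) :=
    isCompact_iUnion fun i => hf.isCompact.image (continuous_apply i)
  obtain ⟨χ, hχ, hχA, hχ1⟩ := exists_cutoff_of_isCompact hL hA (iUnion_subset fun i => by
    rintro _ ⟨x, hx, rfl⟩
    exact hfA hx i (mem_univ i))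
  let X : SmoothFun (Fin k → Euc d) := prodFun fun _ => χ
  have hX : X * f = f := by
    ext x
    by_cases hx : f x = 0
    · simp [hx]
    · have : X x = 1 := (prodFun_apply _ x).trans (Finset.prod_eq_one fun i _ =>
        hχ1 (x i) (mem_iUnion.2 ⟨i, x, subset_tsupport _ hx, rfl⟩))
      simp [this]
  obtain ⟨R, hR⟩ := hχ.isCompact.isBounded.exists_norm_le
  have hXR : ∀ x, X x ≠ 0 → ‖x‖ ≤ max R 0 := fun x hx =>
    (pi_norm_le_iff_of_nonneg (le_max_right _ _)).2 fun i =>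
      (hR _ (subset_tsupport _ (Finset.prod_ne_zero_iff.1 ((prodFun_apply _ x).symm.trans_ne hx) i (Finset.mem_univ i)))).trans
        (le_max_left _ _)
  have hXs : HasCompactSupport X := HasCompactSupport.of_support_subset_isCompact
    (isCompact_closedBall 0 (max R 0)) fun x hx => mem_closedBall_zero_iff.2 (hXR x hx)
  obtain ⟨η, hη, hη1⟩ := exists_cutoff (X := Euc d) (max R 0 + ‖y‖)
  let L₁ : SmoothFun (Fin k → Euc d) →L[ℝ] ℝ :=
    { toFun := fun g => shiftList (distCut P η hη) (List.finRange k) (X * g) y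
      map_add' := fun g h => by
        rw [show X * (g + h) = X * g + X * h from SmoothFun.ext fun x => mul_add _ _ _, map_add]
        rfl
      map_smul' := fun c g => by
        rw [show X * (c • g) = c • (X * g) from SmoothFun.ext fun x => mul_left_comm _ _ _, map_smul]
        rfl
      cont := Continuous.smoothFun_apply ((ContinuousLinearMap.continuous _).comp
        (continuous_const.mul continuous_id)) continuous_const }
  let G : SmoothFun (Fin k → Euc d) := X * prodFun fun i => shiftArg (-y i) p
  let L₂ : SmoothFun (Fin k → Euc d) →L[ℝ] ℝ := intDist volume G G.continuous hXs.mul_right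
  have hL : L₁ = L₂ := by
    refine ext_expFun fun ℓ => ?_
    change shiftList (distCut P η hη) (List.finRange k) (X * expFun ℓ) y = ∫ x, G x * expFun ℓ x
    simp only [expFun_pi, G, X, prodFun_mul]
    simp only [prodFun_apply, ← Finset.prod_mul_distrib]
    rw [shiftList_prodFun _ _ (List.nodup_finRange k), integral_fintype_prod_volume_eq_prod
      (f := fun i x => (χ * shiftArg (-y i) p) x * expFun (ℓ.comp (ContinuousLinearMap.single ℝ
        (fun _ : Fin k => Euc d) i)) x)]
    refine Finset.prod_congr rfl fun i _ => ?_
    rw [if_pos (List.mem_finRange i)]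
    set e := expFun (ℓ.comp (ContinuousLinearMap.single ℝ (fun _ : Fin k => Euc d) i))
    have hz : ∀ z, shiftArg (y i) (χ * e) z ≠ 0 → y i + z ∈ tsupport χ := fun z hz =>
      subset_tsupport _ (left_ne_zero_of_mul hz)
    have hs : HasCompactSupport (shiftArg (y i) (χ * e)) :=
      (hχ.mul_right (f' := e)).comp_homeomorph (Homeomorph.addLeft (y i))
    rw [← applyDist_eq_distCut P hη, hp _ hs]
    · rw [← integral_add_left_eq_self _ (-y i)]
      refine integral_congr_ae (Eventually.of_forall fun x => ?_)
      simp only [shiftArg, SmoothFun.mk_apply, SmoothFun.mul_apply, add_neg_cancel_left]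
      ring
    · intro z hzr
      by_contra h
      have := hAB _ (hχA (hz z h)) _ (hy i)
      rw [add_sub_cancel_left] at this
      exact (this.trans_le hzr).false
    · intro z h
      refine hη1 z ?_
      have h1 := (hR _ (hz z h)).trans (le_max_left R 0)
      have h2 := norm_le_norm_add_norm_sub' z (y i + z)
      rw [sub_add_cancel_right, norm_neg] at h2
      linarith [norm_le_pi_norm y i]
  have h1 : convolveAll P f y = L₁ f := by
    change _ = shiftList (distCut P η hη) (List.finRange k) (X * f) y
    rw [hX]
    refine convolveAll_eq P (R := max R 0) (fun x hx => hXR x fun h0 => hx ?_) hη hη1 le_rfl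
    rw [← hX, SmoothFun.mul_apply, h0, zero_mul]
  rw [h1, hL]
  change ∫ x, G x * f x = _
  refine integral_congr_ae (Eventually.of_forall fun x => ?_)
  have h2 := congrArg (fun g : SmoothFun (Fin k → Euc d) => g x) hX
  simp only [SmoothFun.mul_apply] at h2
  simp only [G, SmoothFun.mul_apply, prodFun_apply, kerPow_apply, diffKernel_apply, shiftArg,
    SmoothFun.mk_apply, neg_add_eq_sub]
  conv_rhs => rw [← h2]
  ring

/-- By Fubini, `P^{⊗k} T'` is represented near the support of `T` by the kernel with `T'` applied in
the second group of variables; the pairing with `T` is then the tensor product by definition. -/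
theorem isContraction_tens
    (hp : ∀ f : Config d, HasCompactSupport f → (∀ x, ‖x‖ ≤ r → f x = 0) →
      applyDist P f = ∫ x, f x * p x) (hr : 0 < r) {A B : Set (Euc d)}
    (hAB : ∀ a ∈ A, ∀ b ∈ B, 3 * r ≤ ‖a - b‖) {T T' : CompDist (Fin k → Euc d)}
    (hT : Distribution.dsupport T ⊆ pi univ fun _ => A)
    (hT' : Distribution.dsupport T' ⊆ pi univ fun _ => B) :
    IsContraction P T T' (CompDist.tens T T' (kerPow k (diffKernel p))) := by
  obtain ⟨S, hS⟩ := exists_isTensorConvolution P T'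
  -- Pairings need open neighbourhoods: widening both sets by `r` reduces the distance `3r` to more
  -- than `r`, the range in which `p` represents `P`.
  have hAB' : ∀ a ∈ Metric.thickening r A, ∀ b ∈ Metric.thickening r B, r < ‖a - b‖ := by
    intro a ha b hb
    obtain ⟨a', ha', ha⟩ := Metric.mem_thickening_iff.1 ha
    obtain ⟨b', hb', hb⟩ := Metric.mem_thickening_iff.1 hb
    have h1 := hAB a' ha' b' hb'
    rw [← dist_eq_norm] at h1 ⊢
    have := dist_triangle4 a' a b b'
    rw [dist_comm a' a] at this
    linarith
  have hopen : ∀ C : Set (Euc d), IsOpen (pi univ fun _ : Fin k => Metric.thickening r C) :=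
    fun C => isOpen_set_pi finite_univ fun _ _ => Metric.isOpen_thickening
  have hsub : ∀ C : Set (Euc d), (pi univ fun _ : Fin k => C) ⊆
      pi univ fun _ : Fin k => Metric.thickening r C := fun C =>
    pi_mono fun _ _ => Metric.self_subset_thickening hr C
  refine ⟨S, hS, pi univ fun _ => Metric.thickening r A, applySnd T'.re (kerPow k (diffKernel p)),
    applySnd T'.im (kerPow k (diffKernel p)), hopen A, hT.trans (hsub A), fun f hf => ?_, rfl⟩
  obtain ⟨hcd, hSf⟩ := hS f
  let g : SmoothFun (Fin k → Euc d) := SmoothFun.mk f f.contDiff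
  have hg : HasCompactSupport g := f.hasCompactSupport
  let D := intDist volume g g.continuous hg
  have h1 : T' (SmoothFun.mk _ hcd) = T' (applySnd D (swap (kerPow k (diffKernel p)))) := by
    refine T'.apply_eq_of_eqOn (hopen B) (hT'.trans (hsub B)) fun y hy => ?_
    exact convolveAll_eq_integral (f := g) hp Metric.isOpen_thickening hAB' hg hf
      fun i => hy i (mem_univ i)
  have h2 : ∀ Q : SmoothFun (Fin k → Euc d) →L[ℝ] ℝ,
      Q (applySnd D (swap (kerPow k (diffKernel p)))) =
        ∫ x, f x * applySnd Q (kerPow k (diffKernel p)) x := fun Q => apply_applySnd_swap Q D _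
  have hi : ∀ u : SmoothFun (Fin k → Euc d), Integrable fun x => ((f x * u x : ℝ) : ℂ) := fun u =>
    ((g.continuous.mul u.continuous).integrable_of_hasCompactSupport hg.mul_right).ofReal
  rw [hSf, h1, ← Complex.re_add_im (T' _), ← CompDist.re_apply, ← CompDist.im_apply, h2, h2,
    ← integral_complex_ofReal, ← integral_complex_ofReal, ← integral_mul_const,
    ← integral_add (hi _) ((hi _).mul_const _)]
  refine integral_congr_ae (Eventually.of_forall fun x => ?_)
  push_cast
  ring

theorem contraction_eq_tens
    (hp : ∀ f : Config d, HasCompactSupport f → (∀ x, ‖x‖ ≤ r → f x = 0) →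
      applyDist P f = ∫ x, f x * p x) (hr : 0 < r) {A B : Set (Euc d)}
    (hAB : ∀ a ∈ A, ∀ b ∈ B, 3 * r ≤ ‖a - b‖) {T T' : CompDist (Fin k → Euc d)}
    (hT : Distribution.dsupport T ⊆ pi univ fun _ => A)
    (hT' : Distribution.dsupport T' ⊆ pi univ fun _ => B) :
    (∃! c, IsContraction P T T' c) ∧
      contraction P T T' = CompDist.tens T T' (kerPow k (diffKernel p)) := by
  have h := isContraction_tens hp hr hAB hT hT'
  have hu : ∃! c, IsContraction P T T' c := ⟨_, h, fun c hc => hc.unique h⟩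
  refine ⟨hu, ?_⟩
  rw [contraction, dif_pos hu]
  exact hu.exists.choose_spec.unique h

end Separated

end

/-! ### Polarisation and derivatives along lines -/

section

section Polarization

/-- A symmetric multilinear map is determined by its values on the diagonal. -/
theorem MultilinearMap.eq_of_diagonal {n : ℕ} {V W : Type*} [AddCommGroup V] [Module ℝ V]
    [AddCommGroup W] [Module ℝ W] {f g : MultilinearMap ℝ (fun _ : Fin n => V) W}
    (hf : ∀ (σ : Equiv.Perm (Fin n)) v, (f fun i => v (σ i)) = f v)
    (hg : ∀ (σ : Equiv.Perm (Fin n)) v, (g fun i => v (σ i)) = g v)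
    (h : ∀ v, (f fun _ => v) = g fun _ => v) : f = g := by
  classical
  suffices H : ∀ f : MultilinearMap ℝ (fun _ : Fin n => V) W,
      (∀ (σ : Equiv.Perm (Fin n)) v, (f fun i => v (σ i)) = f v) → (∀ v, (f fun _ => v) = 0) →
      f = 0 by
    rw [← sub_eq_zero]
    exact H (f - g) (fun σ v => by simp only [_root_.sub_apply, hf, hg])
      fun v => by simp only [_root_.sub_apply, h, sub_self]
  clear! f g
  intro f hf h
  ext v
  -- Inclusion–exclusion: expand the product over `j` of `1 - 1[j ∉ range r]`, which is `1` exactly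
  -- for surjective `r`.
  have hc : ∀ r : Fin n → Fin n, ∑ s : Finset (Fin n), (∏ j ∈ Finset.univ \ s, (-1 : ℝ)) *
      (if ∀ i, r i ∈ s then 1 else 0) = if Function.Surjective r then 1 else 0 := by
    intro r
    have h1 := Finset.prod_add (fun _ : Fin n => (1 : ℝ))
      (fun j => -1 * if j ∈ Set.range r then 0 else 1) Finset.univ
    rw [Finset.powerset_univ] at h1
    have h2 : ∀ s : Finset (Fin n), (∏ j ∈ Finset.univ \ s, if j ∈ Set.range r then (0 : ℝ) else 1) =
        if ∀ i, r i ∈ s then 1 else 0 := by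
      intro s
      by_cases hs : ∀ i, r i ∈ s
      · rw [if_pos hs]
        refine Finset.prod_eq_one fun j hj => if_neg ?_
        rintro ⟨i, rfl⟩
        exact (Finset.mem_sdiff.1 hj).2 (hs i)
      · rw [if_neg hs]
        push Not at hs
        obtain ⟨i, hi⟩ := hs
        exact Finset.prod_eq_zero (Finset.mem_sdiff.2 ⟨Finset.mem_univ _, hi⟩)
          (if_pos (Set.mem_range_self i))
    simp only [Finset.prod_mul_distrib, h2, Finset.prod_const_one, one_mul] at h1
    rw [← h1]
    by_cases hr : Function.Surjective r
    · rw [if_pos hr]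
      exact Finset.prod_eq_one fun j _ => by simp [Set.mem_range.2 (hr j)]
    · rw [if_neg hr]
      simp only [Function.Surjective, not_forall] at hr
      obtain ⟨j, hj⟩ := hr
      exact Finset.prod_eq_zero (Finset.mem_univ j) (by simp [Set.mem_range, hj])
  -- Expanding the diagonal values at partial sums leaves only permutations of `v`. The left side
  -- vanishes by `h`; by symmetry the right side is a nonzero multiple of `f v`.
  have h1 : ∑ s : Finset (Fin n), (∏ j ∈ Finset.univ \ s, (-1 : ℝ)) •
      f (fun _ => ∑ j ∈ s, v j) = ∑ r : Fin n → Fin n,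
        (if Function.Surjective r then 1 else 0 : ℝ) • f fun i => v (r i) := by
    simp only [← hc, Finset.sum_smul]
    rw [Finset.sum_comm]
    refine Finset.sum_congr rfl fun s _ => ?_
    rw [f.map_sum_finset (fun _ j => v j) (fun _ => s), Finset.smul_sum]
    refine Finset.sum_subset_zero_on_sdiff (Finset.subset_univ _) (fun r hr => ?_) fun r hr => ?_
    · rw [if_neg fun h => (Finset.mem_sdiff.1 hr).2 (Fintype.mem_piFinset.2 h), mul_zero, zero_smul]
    · rw [if_pos (Fintype.mem_piFinset.1 hr), mul_one]
  simp only [h, smul_zero, Finset.sum_const_zero, ite_smul, one_smul, zero_smul,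
    ← Finset.sum_filter] at h1
  rw [Finset.sum_congr rfl (g := fun _ => f v) fun r hr => hf (Equiv.ofBijective r
    (Finite.surjective_iff_bijective.1 (Finset.mem_filter.1 hr).2)) v, Finset.sum_const,
    ← Nat.cast_smul_eq_nsmul ℝ] at h1
  refine (smul_eq_zero.1 h1.symm).resolve_left (Nat.cast_ne_zero.2 (Finset.card_ne_zero.2 ?_))
  exact ⟨id, Finset.mem_filter.2 ⟨Finset.mem_univ _, Function.surjective_id⟩⟩

end Polarization

open SmoothFun

section LineDerivatives

variable {V : Type*} [NormedAddCommGroup V] [NormedSpace ℝ V] [FiniteDimensional ℝ V]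
  [MeasurableSpace V] [BorelSpace V] (μ : Measure V) [μ.IsAddHaarMeasure]

theorem SmoothFun.conv_apply (u : SmoothFun V) (hu : HasCompactSupport u) (p : C(V, ℝ)) (x : V) :
    conv μ u hu p x = ∫ t, u t * p (x - t) ∂μ := rfl

/-- Integration by parts along lines moves the derivative from `u` to `p`; differentiability of `p`
in the one direction `v` is enough. -/
theorem SmoothFun.pd_conv_of_hasDerivAt (u : SmoothFun V) (hu : HasCompactSupport u)
    {p q : C(V, ℝ)} {v : V} (h : ∀ x, HasDerivAt (fun t : ℝ => p (x + t • v)) (q x) 0) :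
    pd v (conv μ u hu p) = conv μ u hu q := by
  rw [pd_conv]
  ext x
  have hc : ∀ p : C(V, ℝ), Continuous fun t => p (x - t) := fun p =>
    p.continuous.comp (continuous_const.sub continuous_id)
  have hi : ∀ (u : SmoothFun V) (_ : HasCompactSupport u) (p : C(V, ℝ)),
      Integrable (fun t => u t * p (x - t)) μ := fun u hu p =>
    (u.continuous.mul (hc p)).integrable_of_hasCompactSupport hu.mul_right
  have h1 := integral_bilinear_hasLineDerivAt_right_eq_neg_left_of_integrable (μ := μ) (f := u)
    (f' := pd v u) (g := fun t => p (x - t)) (g' := fun t => -q (x - t)) (v := v)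
    (B := ContinuousLinearMap.mul ℝ ℝ) (hi _ (hasCompactSupport_pd hu v) p)
    (by simpa using (hi u hu q).neg) (hi u hu p)
    (fun t _ => (u.differentiable t).hasFDerivAt.hasLineDerivAt v) fun t _ => by
      have h2 := (h (x - t))
      rw [← neg_zero (G := ℝ)] at h2
      have h3 := h2.comp (0 : ℝ) (hasDerivAt_neg 0)
      rw [mul_neg_one] at h3
      refine h3.congr_of_eventuallyEq (Eventually.of_forall fun s => ?_)
      simp only [Function.comp_apply]
      congr 1
      rw [neg_smul]
      abel
  simp only [ContinuousLinearMap.mul_apply', mul_neg, integral_neg, neg_inj] at h1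
  rw [conv_apply, conv_apply, h1]

/-- If `q` is the derivative of `p` in the direction `w` after convolution with smooth functions, it
is the derivative of `p`. -/
theorem hasDerivAt_of_conv {p q : C(V, ℝ)} {w : V}
    (h : ∀ (u : SmoothFun V) (hu : HasCompactSupport u), pd w (conv μ u hu p) = conv μ u hu q)
    (x : V) : HasDerivAt (fun t : ℝ => p (x + t • w)) (q x) 0 := by
  obtain ⟨φ, hφ⟩ : ∃ φ : ℕ → ContDiffBump (0 : V), Tendsto (fun n => (φ n).rOut) atTop (𝓝 0) :=
    ⟨fun n => ⟨1 / (n + 2), 1 / (n + 1), by positivity, by gcongr; norm_num⟩,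
      tendsto_one_div_add_atTop_nhds_zero_nat⟩
  obtain ⟨U, hU, ht⟩ : ∃ (U : ℕ → SmoothFun V) (hU : ∀ n, HasCompactSupport (U n)),
      ∀ (p : C(V, ℝ)) (y : V), Tendsto (fun z : ℕ × V => conv μ (U z.1) (hU z.1) p z.2)
        (atTop ×ˢ 𝓝 y) (𝓝 (p y)) := by
    refine ⟨fun n => SmoothFun.mk ((φ n).normed μ) (φ n).contDiff_normed,
      fun n => (φ n).hasCompactSupport_normed, ?_⟩
    intro p y
    have hφ' : Tendsto (fun z : ℕ × V => (φ z.1).rOut) (atTop ×ˢ 𝓝 y) (𝓝 0) := hφ.comp tendsto_fst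
    have h1 := ContDiffBump.convolution_tendsto_right (μ := μ) (l := (atTop : Filter ℕ) ×ˢ 𝓝 y)
      (φ := fun z => φ z.1) (g := fun _ => ⇑p) (k := fun z => z.2) (x₀ := y) (z₀ := p y)
      hφ' (Eventually.of_forall fun _ => p.continuous.aestronglyMeasurable)
      ((p.continuous.tendsto y).comp tendsto_snd) tendsto_snd
    refine h1.congr fun z => ?_
    rfl
  have hline : Continuous fun t : ℝ => x + t • w := by fun_prop
  -- Along the line the mollified `p` have the mollified `q` as derivatives; these converge locally
  -- uniformly, so the limit may be differentiated.
  have hloc : TendstoLocallyUniformlyOn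
      (fun (n : ℕ) (t : ℝ) => conv μ (U n) (hU n) q (x + t • w)) (fun t => q (x + t • w)) atTop
      univ := by
    rw [tendstoLocallyUniformlyOn_univ, tendstoLocallyUniformly_iff_forall_tendsto]
    intro t
    have h1 : Tendsto (fun y : ℕ × ℝ => q (x + y.2 • w)) (atTop ×ˢ 𝓝 t) (𝓝 (q (x + t • w))) :=
      ((q.continuous.comp hline).tendsto t).comp tendsto_snd
    have h3 : Tendsto (fun y : ℕ × ℝ => (y.1, x + y.2 • w)) (atTop ×ˢ 𝓝 t)
        (atTop ×ˢ 𝓝 (x + t • w)) := tendsto_fst.prodMk ((hline.tendsto t).comp tendsto_snd)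
    have h2 := (ht q (x + t • w)).comp h3
    exact (h1.prodMk_nhds h2).mono_right (nhds_le_uniformity _)
  have := hasDerivAt_of_tendstoLocallyUniformlyOn isOpen_univ hloc
    (f := fun n t => conv μ (U n) (hU n) p (x + t • w)) (g := fun t => p (x + t • w)) (x := 0)
    (Eventually.of_forall fun n t _ => ?_) (fun t _ => ?_) (mem_univ _)
  · simpa using this
  · have h1 : HasDerivAt (fun t : ℝ => x + t • w) w t := by
      simpa using ((hasDerivAt_id t).smul_const w).const_add x
    rw [← h]
    exact (conv μ (U n) (hU n) p).hasDerivAt_comp h1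
  · have h3 : Tendsto (fun n : ℕ => (n, x + t • w)) atTop (atTop ×ˢ 𝓝 (x + t • w)) :=
      tendsto_id.prodMk tendsto_const_nhds
    have h4 := (ht p (x + t • w)).comp h3
    simp only [Function.comp_def] at h4
    exact h4

theorem SmoothFun.pd_expFun (v : V) (ℓ : V →L[ℝ] ℝ) : pd v (expFun ℓ) = ℓ v • expFun ℓ := by
  ext x
  refine pd_eq_of_hasDerivAt ?_
  have h : HasDerivAt (fun s : ℝ => ℓ (x + s • v)) (ℓ v) 0 := by
    simpa using ((hasDerivAt_id (0 : ℝ)).mul_const (ℓ v)).const_add (ℓ x)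
  simpa [mul_comm] using h.exp

theorem SmoothFun.ipd_expFun (n : ℕ) (v : Fin n → V) (ℓ : V →L[ℝ] ℝ) :
    ipd n v (expFun ℓ) = (∏ i, ℓ (v i)) • expFun ℓ := by
  induction n with
  | zero => simp [ipd_zero]
  | succ n ih =>
    rw [ipd_succ, ih, pd_smul, pd_expFun, smul_smul, Fin.prod_univ_succ, mul_comm]
    rfl

/-- Partial derivatives of smooth functions commute. -/
theorem SmoothFun.ipd_perm (n : ℕ) (v : Fin n → V) (σ : Equiv.Perm (Fin n)) (f : SmoothFun V) :
    ipd n (fun i => v (σ i)) f = ipd n v f := by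
  ext x
  have hadd : ∀ (n : ℕ) (v : Fin n → V) (f g : SmoothFun V),
      ipd n v (f + g) = ipd n v f + ipd n v g := by
    intro n v f g
    induction n with
    | zero => simp [ipd_zero]
    | succ n ih => rw [ipd_succ, ih, pd_add, ipd_succ, ipd_succ]
  have hsmul : ∀ (n : ℕ) (v : Fin n → V) (c : ℝ) (f : SmoothFun V),
      ipd n v (c • f) = c • ipd n v f := by
    intro n v c f
    induction n with
    | zero => simp [ipd_zero]
    | succ n ih => rw [ipd_succ, ih, pd_smul, ipd_succ]
  let D (v : Fin n → V) : SmoothFun V →L[ℝ] ℝ :=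
    { toFun := fun f => ipd n v f x
      map_add' := fun f g => by rw [hadd, SmoothFun.add_apply]
      map_smul' := fun c f => by rw [hsmul, SmoothFun.smul_apply]; rfl
      cont := (continuous_uncurry_ipd n v).comp (Continuous.prodMk_left x) }
  have h : D (fun i => v (σ i)) = D v := ext_expFun fun ℓ => by
    change ipd n _ (expFun ℓ) x = ipd n v (expFun ℓ) x
    rw [ipd_expFun, ipd_expFun, Equiv.prod_comp σ fun i => ℓ (v i)]
  exact congrArg (fun L => L f) h

end LineDerivatives

/-- If the `n`-th derivatives of a function along lines are given by symmetric multilinear maps that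
depend continuously on the point, these are differentiable in all directions. -/
theorem hasDerivAt_of_diagonal {V : Type*} [NormedAddCommGroup V] [NormedSpace ℝ V]
    [FiniteDimensional ℝ V] (B : ∀ n, V → MultilinearMap ℝ (fun _ : Fin n => V) ℝ)
    (hsymm : ∀ n x (σ : Equiv.Perm (Fin n)) v, (B n x fun i => v (σ i)) = B n x v)
    (hcont : ∀ n v, Continuous fun x => B n x v)
    (hderiv : ∀ n x v, HasDerivAt (fun t : ℝ => B n (x + t • v) fun _ => v)
      (B (n + 1) x fun _ => v) 0) (n : ℕ) (x w : V) (v : Fin n → V) :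
    HasDerivAt (fun t : ℝ => B n (x + t • w) v) (B (n + 1) x (Fin.cons w v)) 0 := by
  let _ : MeasurableSpace V := borel V
  have : BorelSpace V := ⟨rfl⟩
  let μ := (Module.finBasis ℝ V).addHaar
  let b (n : ℕ) (v : Fin n → V) : C(V, ℝ) := ⟨fun x => B n x v, hcont n v⟩
  refine hasDerivAt_of_conv μ (p := b n v) (q := b (n + 1) (Fin.cons w v)) (fun u hu => ?_) x
  -- After mollification `hderiv` makes all diagonal values iterated derivatives of the single
  -- smooth function `conv μ u hu (b 0 0)`.
  have hdiag : ∀ n v, conv μ u hu (b n fun _ => v) = ipd n (fun _ => v) (conv μ u hu (b 0 0)) := by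
    intro n v
    induction n with
    | zero =>
      rw [ipd_zero, Subsingleton.elim (fun _ : Fin 0 => v) 0]
    | succ n ih =>
      rw [ipd_succ, ← pd_conv_of_hasDerivAt μ u hu (p := b n fun _ => v)
        (q := b (n + 1) fun _ => v) (fun x => hderiv n x v), ih]
      rfl
  -- Both sides are symmetric multilinear in `v`, so polarisation extends the diagonal case.
  have hall : ∀ n v, conv μ u hu (b n v) = ipd n v (conv μ u hu (b 0 0)) := by
    intro n v
    ext x
    have hi : ∀ v, Integrable (fun t => u t * b n v (x - t)) μ := fun v =>
      (u.continuous.mul ((b n v).continuous.comp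
        (continuous_const.sub continuous_id))).integrable_of_hasCompactSupport hu.mul_right
    let f : MultilinearMap ℝ (fun _ : Fin n => V) ℝ :=
      { toFun := fun v => conv μ u hu (b n v) x
        map_update_add' := fun v i y z => by
          simp only [conv_apply]
          rw [← integral_add (hi _) (hi _)]
          refine integral_congr_ae (Eventually.of_forall fun t => ?_)
          simp [b, mul_add]
        map_update_smul' := fun v i c y => by
          simp only [conv_apply]
          rw [smul_eq_mul, ← integral_const_mul]
          refine integral_congr_ae (Eventually.of_forall fun t => ?_)
          simp [b, mul_left_comm] }
    have hfg : f = (iteratedFDeriv ℝ n (conv μ u hu (b 0 0)) x).toMultilinearMap := by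
      refine MultilinearMap.eq_of_diagonal (fun σ v => ?_) (fun σ v => ?_) fun v => ?_
      · change ∫ t, _ ∂μ = ∫ t, _ ∂μ
        refine integral_congr_ae (Eventually.of_forall fun t => ?_)
        simp only [b, ContinuousMap.coe_mk]
        rw [← hsymm n (x - t) σ v]
      · exact congrArg (fun f : SmoothFun V => f x) (ipd_perm n v σ _)
      · exact congrArg (fun f : SmoothFun V => f x) (hdiag n v)
    exact congrArg (fun g : MultilinearMap ℝ (fun _ : Fin n => V) ℝ => g v) hfg
  rw [hall n v, hall (n + 1) (Fin.cons w v), ipd_succ, Fin.cons_zero, Fin.tail_cons]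

end

/-! ### Functional derivatives and their derivatives -/

section

open SmoothFun

variable {d n : ℕ}

namespace SmoothFun

theorem permuteVars_prodFun (σ : Equiv.Perm (Fin n)) (v : Fin n → Config d) :
    permuteVars σ (prodFun fun i => v (σ i)) = prodFun v := by
  ext x
  change ∏ i, v (σ i) (x (σ i)) = ∏ i, v i (x i)
  exact Equiv.prod_comp σ fun i => v i (x i)

/-- The function `x ↦ u (x₁, …, xₙ) h (xₙ₊₁)`. -/
def snocFun (u : SmoothFun (Fin n → Euc d)) (h : Config d) : SmoothFun (Fin (n + 1) → Euc d) :=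
  pullback (ContinuousLinearMap.pi fun i : Fin n => .proj i.castSucc) u *
    pullback (.proj (Fin.last n)) h

@[simp] theorem snocFun_apply (u : SmoothFun (Fin n → Euc d)) (h : Config d)
    (x : Fin (n + 1) → Euc d) :
    snocFun u h x = u (fun i => x i.castSucc) * h (x (Fin.last n)) := rfl

theorem _root_.Continuous.smoothFun_snocFun {Z : Type*} [TopologicalSpace Z]
    {u : Z → SmoothFun (Fin n → Euc d)} {h : Z → Config d} (hu : Continuous u)
    (hh : Continuous h) : Continuous fun z => snocFun (u z) (h z) :=
  (hu.smoothFun_pullback _).mul (hh.smoothFun_pullback _)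

/-- `snocFun` as a continuous linear map in the first argument. -/
def snocCLM (h : Config d) : SmoothFun (Fin n → Euc d) →L[ℝ] SmoothFun (Fin (n + 1) → Euc d) where
  toFun u := snocFun u h
  map_add' u v := by ext x; exact add_mul _ _ _
  map_smul' c u := by ext x; exact mul_assoc _ _ _
  cont := continuous_id.smoothFun_snocFun continuous_const

theorem snocFun_prodFun (v : Fin n → Config d) (h : Config d) :
    snocFun (prodFun v) h = prodFun (Fin.snoc (α := fun _ => Config d) v h) := by
  ext x
  simp [Fin.prod_univ_castSucc]

theorem snocFun_tensorPow (n : ℕ) (h : Config d) :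
    snocFun (tensorPow n h) h = tensorPow (n + 1) h := by
  ext x
  exact (Fin.prod_univ_castSucc fun i => h (x i)).symm

end SmoothFun

namespace CompDist

/-- A distribution, as a multilinear map on tensor products. -/
def multilinear (T : CompDist (Fin n → Euc d)) :
    MultilinearMap ℝ (fun _ : Fin n => Config d) ℂ where
  toFun v := T (prodFun v)
  map_update_add' v i f g := by
    rw [← map_add]
    congr 1
    ext x
    simp only [prodFun_apply, SmoothFun.add_apply]
    have h : ∀ f : Config d, ∏ j, Function.update v i f j (x j) =
        f (x i) * ∏ j ∈ Finset.univ.erase i, v j (x j) := fun f => by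
      rw [← Finset.mul_prod_erase _ _ (Finset.mem_univ i), Function.update_self]
      congr 1
      exact Finset.prod_congr rfl fun j hj => by
        rw [Function.update_of_ne (Finset.ne_of_mem_erase hj)]
    convert add_mul (f (x i)) (g (x i)) (∏ j ∈ Finset.univ.erase i, v j (x j)) using 1
    · convert h (f + g)
      rfl
    · congr 1
      · convert h f
      · convert h g
  map_update_smul' v i c f := by
    rw [← map_smul]
    congr 1
    ext x
    simp only [prodFun_apply, SmoothFun.smul_apply]
    have h : ∀ f : Config d, ∏ j, Function.update v i f j (x j) =
        f (x i) * ∏ j ∈ Finset.univ.erase i, v j (x j) := fun f => by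
      rw [← Finset.mul_prod_erase _ _ (Finset.mem_univ i), Function.update_self]
      congr 1
      exact Finset.prod_congr rfl fun j hj => by
        rw [Function.update_of_ne (Finset.ne_of_mem_erase hj)]
    convert mul_assoc c (f (x i)) (∏ j ∈ Finset.univ.erase i, v j (x j)) using 1
    · convert h (c • f)
      rfl
    · congr 1
      convert h f

theorem ext_prodFun {S T : CompDist (Fin n → Euc d)} (h : ∀ v, S (prodFun v) = T (prodFun v)) :
    S = T :=
  ext_expFun fun ℓ => by rw [expFun_pi, h]

theorem apply_prodFun_perm {T : CompDist (Fin n → Euc d)} (hT : ∀ σ u, T (permuteVars σ u) = T u)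
    (σ : Equiv.Perm (Fin n)) (v : Fin n → Config d) :
    T (prodFun fun i => v (σ i)) = T (prodFun v) := by
  rw [← hT σ, permuteVars_prodFun]

/-- Polarisation gives agreement on all tensor products, and these include the exponentials. This is
the uniqueness of functional derivatives. -/
theorem ext_tensorPow {S T : CompDist (Fin n → Euc d)} (hS : ∀ σ u, S (permuteVars σ u) = S u)
    (hT : ∀ σ u, T (permuteVars σ u) = T u) (h : ∀ v, S (tensorPow n v) = T (tensorPow n v)) :
    S = T := by
  refine ext_prodFun fun v => congrArg (fun f => f v) (?_ : S.multilinear = T.multilinear)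
  exact MultilinearMap.eq_of_diagonal (apply_prodFun_perm hS) (apply_prodFun_perm hT) h

theorem apply_snocFun_snocFun {T : CompDist (Fin (n + 2) → Euc d)}
    (hT : ∀ σ u, T (permuteVars σ u) = T u) (u : SmoothFun (Fin n → Euc d)) (h g : Config d) :
    T (snocFun (snocFun u h) g) = T (snocFun (snocFun u g) h) := by
  let σ : Equiv.Perm (Fin (n + 2)) := Equiv.swap (Fin.last (n + 1)) (Fin.last n).castSucc
  rw [← hT σ]
  congr 1
  ext x
  have h1 : ∀ i : Fin n, σ i.castSucc.castSucc = i.castSucc.castSucc := fun i => by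
    refine Equiv.swap_apply_of_ne_of_ne (Fin.castSucc_lt_last _).ne fun h => ?_
    exact (Fin.castSucc_lt_last i).ne (Fin.castSucc_injective _ h)
  change u (fun i => x (σ i.castSucc.castSucc)) * h (x (σ (Fin.last n).castSucc)) *
    g (x (σ (Fin.last (n + 1)))) = _
  simp only [h1, snocFun_apply, σ, Equiv.swap_apply_left, Equiv.swap_apply_right]
  ring

theorem apply_snocFun_permuteVars {T : CompDist (Fin (n + 1) → Euc d)}
    (hT : ∀ σ u, T (permuteVars σ u) = T u) (σ : Equiv.Perm (Fin n))
    (u : SmoothFun (Fin n → Euc d)) (h : Config d) :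
    T (snocFun (permuteVars σ u) h) = T (snocFun u h) := by
  rw [← hT ((finSuccEquivLast.trans (Equiv.optionCongr σ)).trans finSuccEquivLast.symm)
    (snocFun u h)]
  congr 1
  ext x
  change u _ * h _ = u _ * h _
  simp

end CompDist

section FunctionalDeriv

variable {F : Config d → ℂ}

theorem IsSmoothFunctional.isFunctionalDeriv (hF : IsSmoothFunctional F) (n : ℕ) :
    IsFunctionalDeriv F n (functionalDeriv F n) := by
  have h := hF.exists_deriv n
  have h1 : functionalDeriv F n = h.choose := funext fun φ => by rw [functionalDeriv, dif_pos h]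
  rw [h1]
  exact h.choose_spec

/-- The defining line derivatives only involve the germ at `φ`. Hence functional derivatives may be
computed from any local representative. -/
theorem IsFunctionalDeriv.eq_of_eventuallyEq {G : Config d → ℂ}
    {S T : Config d → CompDist (Fin n → Euc d)} (hS : IsFunctionalDeriv F n S)
    (hT : IsFunctionalDeriv G n T) {φ : Config d} (h : F =ᶠ[𝓝 φ] G) : S φ = T φ := by
  refine CompDist.ext_tensorPow (hS.symm φ) (hT.symm φ) fun v => ?_
  rw [hS.deriv_eq, hT.deriv_eq]
  refine Filter.EventuallyEq.iteratedDeriv_eq n ?_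
  have hc : Continuous fun t : ℝ => φ + t • v := by fun_prop
  have := hc.tendsto 0
  simp only [zero_smul, add_zero] at this
  exact this.eventually h

theorem IsFunctionalDeriv.eq {T : Config d → CompDist (Fin n → Euc d)}
    (hT : IsFunctionalDeriv F n T) : functionalDeriv F n = T := by
  have h : ∃ T, IsFunctionalDeriv F n T := ⟨T, hT⟩
  funext φ
  rw [functionalDeriv, dif_pos h]
  exact h.choose_spec.eq_of_eventuallyEq hT (EventuallyEq.refl _ _)

/-- By iteration, the values of `A n` on `h^{⊗n}` are the derivatives of order `n` along all lines,
so a consistent tower of candidates proves smoothness and identifies all derivatives. -/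
theorem isSmoothFunctional_of_hasDerivAt (A : ∀ n, Config d → CompDist (Fin n → Euc d))
    (hsymm : ∀ n φ σ u, A n φ (permuteVars σ u) = A n φ u)
    (hcont : ∀ n, Continuous fun p : Config d × SmoothFun (Fin n → Euc d) => A n p.1 p.2)
    (hzero : ∀ φ h, A 0 φ (tensorPow 0 h) = F φ)
    (hderiv : ∀ n φ h, HasDerivAt (fun t : ℝ => A n (φ + t • h) (tensorPow n h))
      (A (n + 1) φ (tensorPow (n + 1) h)) 0) :
    IsSmoothFunctional F ∧ ∀ n, IsFunctionalDeriv F n (A n) := by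
  have hd : ∀ n φ h t, HasDerivAt (fun t : ℝ => A n (φ + t • h) (tensorPow n h))
      (A (n + 1) (φ + t • h) (tensorPow (n + 1) h)) t := by
    intro n φ h t
    have h1 := hderiv n (φ + t • h) h
    rw [← sub_self t] at h1
    have h2 := h1.comp_sub_const t t
    refine h2.congr_of_eventuallyEq (Eventually.of_forall fun s => ?_)
    simp only
    rw [add_assoc, ← add_smul, add_sub_cancel]
  have key : ∀ n φ h, iteratedDeriv n (fun t : ℝ => F (φ + t • h)) =
      fun t => A n (φ + t • h) (tensorPow n h) := by
    intro n φ h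
    induction n with
    | zero => funext t; rw [iteratedDeriv_zero, hzero]
    | succ n ih =>
      rw [iteratedDeriv_succ, ih]
      exact funext fun t => (hd n φ h t).deriv
  have hall : ∀ n, IsFunctionalDeriv F n (A n) := fun n =>
    ⟨hsymm n, hcont n, fun φ h => by rw [key]; simp⟩
  refine ⟨⟨fun φ h => contDiff_of_differentiable_iteratedDeriv fun n _ => ?_, fun n =>
    ⟨A n, hall n⟩⟩, hall⟩
  rw [key]
  exact fun t => (hd n φ h t).differentiableAt

namespace IsSmoothFunctional

theorem functionalDeriv_permuteVars (hF : IsSmoothFunctional F) (φ : Config d)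
    (σ : Equiv.Perm (Fin n)) (u : SmoothFun (Fin n → Euc d)) :
    functionalDeriv F n φ (permuteVars σ u) = functionalDeriv F n φ u :=
  (hF.isFunctionalDeriv n).symm φ σ u

theorem continuous_functionalDeriv (hF : IsSmoothFunctional F) (n : ℕ) :
    Continuous fun p : Config d × SmoothFun (Fin n → Euc d) => functionalDeriv F n p.1 p.2 :=
  (hF.isFunctionalDeriv n).continuous

theorem functionalDeriv_zero (hF : IsSmoothFunctional F) (φ h : Config d) :
    functionalDeriv F 0 φ (tensorPow 0 h) = F φ := by
  simp [(hF.isFunctionalDeriv 0).deriv_eq]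

theorem hasDerivAt_functionalDeriv_tensorPow (hF : IsSmoothFunctional F) (n : ℕ)
    (φ h : Config d) : HasDerivAt (fun t : ℝ => functionalDeriv F n (φ + t • h) (tensorPow n h))
      (functionalDeriv F (n + 1) φ (tensorPow (n + 1) h)) 0 := by
  have h1 : ∀ t : ℝ, functionalDeriv F n (φ + t • h) (tensorPow n h) =
      iteratedDeriv n (fun s : ℝ => F (φ + s • h)) t := by
    intro t
    rw [(hF.isFunctionalDeriv n).deriv_eq]
    have := congrFun (iteratedDeriv_comp_const_add n (fun s : ℝ => F (φ + s • h)) t) 0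
    rw [add_zero] at this
    rw [← this]
    congr 1
    ext s
    rw [add_smul, add_assoc]
  simp only [h1]
  rw [(hF.isFunctionalDeriv (n + 1)).deriv_eq, iteratedDeriv_succ]
  exact ((hF.contDiff_line φ h).differentiable_iteratedDeriv n
    (by exact_mod_cast ENat.natCast_lt_top n)).differentiableAt.hasDerivAt

/-- The axioms only give derivatives in the direction that is also inserted in every slot. On the
finite-dimensional span of the `vᵢ` and `h`, `hasDerivAt_of_diagonal` frees the direction from the
slots. -/
theorem hasDerivAt_functionalDeriv_prodFun (hF : IsSmoothFunctional F) (φ : Config d)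
    (v : Fin n → Config d) (h : Config d) :
    HasDerivAt (fun t : ℝ => functionalDeriv F n (φ + t • h) (prodFun v))
      (functionalDeriv F (n + 1) φ (snocFun (prodFun v) h)) 0 := by
  let w : Fin (n + 1) → Config d := Fin.snoc (α := fun _ => Config d) v h
  -- Coordinates on the span; `L` need not be injective, so linear dependencies are harmless.
  let L : (Fin (n + 1) → ℝ) →ₗ[ℝ] Config d := Fintype.linearCombination ℝ w
  have hL : Continuous L := L.continuous_of_finiteDimensional
  have hLv : ∀ i, L (Pi.single i 1) = w i := fun i => by
    simp [L, Fintype.linearCombination_apply_single]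
  -- The multilinear criterion is real, so real and imaginary parts are treated separately.
  have key : ∀ π : ℂ →L[ℝ] ℝ,
      HasDerivAt (fun t : ℝ => π (functionalDeriv F n (φ + t • h) (prodFun v)))
        (π (functionalDeriv F (n + 1) φ (snocFun (prodFun v) h))) 0 := by
    intro π
    let B (k : ℕ) (x : Fin (n + 1) → ℝ) : MultilinearMap ℝ (fun _ : Fin k => Fin (n + 1) → ℝ) ℝ :=
      (π.toLinearMap.compMultilinearMap (functionalDeriv F k (φ + L x)).multilinear).compLinearMap
        fun _ => L
    have hB : ∀ k x y, B k x y = π (functionalDeriv F k (φ + L x) (prodFun fun i => L (y i))) :=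
      fun k x y => rfl
    have h1 := hasDerivAt_of_diagonal B (fun k x σ y => ?_) (fun k y => ?_) (fun k x y => ?_) n 0
      (Pi.single (Fin.last n) 1) fun i => Pi.single i.castSucc 1
    · have e1 : (fun i : Fin n => w i.castSucc) = v := funext fun i => by simp [w]
      have e2 : prodFun (fun i : Fin (n + 1) => L (Fin.cons (α := fun _ => Fin (n + 1) → ℝ)
          (Pi.single (Fin.last n) 1) (fun i : Fin n => Pi.single i.castSucc 1) i)) =
          prodFun (Fin.cons (α := fun _ => Config d) h v) := by
        congr 1
        funext i
        refine Fin.cases ?_ (fun i => ?_) i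
        · simp [hLv, w]
        · simp [hLv, w]
      simp only [hB, zero_add, map_zero, add_zero, map_smul, hLv] at h1
      rw [e1, e2, show w (Fin.last n) = h by simp [w]] at h1
      refine h1.congr_deriv ?_
      rw [snocFun_prodFun, Fin.snoc_eq_cons_rotate,
        CompDist.apply_prodFun_perm (hF.functionalDeriv_permuteVars φ)]
    · rw [hB, hB]
      exact congrArg π (CompDist.apply_prodFun_perm (hF.functionalDeriv_permuteVars _) σ
        fun i => L (y i))
    · exact π.continuous.comp ((hF.continuous_functionalDeriv k).comp
        ((continuous_const.add hL).prodMk continuous_const))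
    · have h2 := π.hasFDerivAt.comp_hasDerivAt (0 : ℝ)
        (hF.hasDerivAt_functionalDeriv_tensorPow k (φ + L x) (L y))
      refine h2.congr_of_eventuallyEq (Eventually.of_forall fun t => ?_)
      simp only [hB, map_add, map_smul, Function.comp_apply, add_assoc]
      rfl
  have h1 := ((key Complex.reCLM).ofReal_comp).add
    ((key Complex.imCLM).ofReal_comp.mul_const Complex.I)
  refine (h1.congr_deriv ?_).congr_of_eventuallyEq (Eventually.of_forall fun t => ?_)
  · exact Complex.re_add_im _
  · exact (Complex.re_add_im _).symm

/-- The derivative of `F⁽ⁿ⁾` in a direction is given by `F⁽ⁿ⁺¹⁾`. -/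
theorem hasDerivAt_functionalDeriv (hF : IsSmoothFunctional F) (φ h : Config d)
    (u : SmoothFun (Fin n → Euc d)) (t : ℝ) :
    HasDerivAt (fun t : ℝ => functionalDeriv F n (φ + t • h) u)
      (functionalDeriv F (n + 1) (φ + t • h) (snocFun u h)) t := by
  refine hasDerivAt_of_expFun (A := fun t => functionalDeriv F n (φ + t • h))
    (A' := fun t => (functionalDeriv F (n + 1) (φ + t • h)).comp (snocCLM h)) ?_ (fun ℓ t => ?_) u t
  · refine (hF.continuous_functionalDeriv (n + 1)).comp (Continuous.prodMk (by fun_prop) ?_)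
    exact (snocCLM h).continuous.comp continuous_snd
  · have h1 := hF.hasDerivAt_functionalDeriv_prodFun (φ + t • h) (fun i => expFun (ℓ.comp
      (ContinuousLinearMap.single ℝ (fun _ : Fin n => Euc d) i))) h
    rw [← expFun_pi, ← sub_self t] at h1
    refine (h1.comp_sub_const t t).congr_of_eventuallyEq (Eventually.of_forall fun s => ?_)
    simp only
    rw [add_assoc, ← add_smul, add_sub_cancel]

end IsSmoothFunctional

/-- The derivative of the functional `F` in the direction `h`. -/
def dirDeriv (h : Config d) (F : Config d → ℂ) : Config d → ℂ :=
  fun φ => functionalDeriv F 1 φ (tensorPow 1 h)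

namespace IsSmoothFunctional

/-- Freezing one slot of `F⁽ⁿ⁺¹⁾` at `h` gives the tower of candidates. Symmetry of the derivatives
lets the new direction pass the frozen slot. -/
theorem dirDeriv_aux (hF : IsSmoothFunctional F) (h : Config d) :
    IsSmoothFunctional (dirDeriv h F) ∧ ∀ n, IsFunctionalDeriv (dirDeriv h F) n
      fun φ => (functionalDeriv F (n + 1) φ).comp (snocCLM h) := by
  refine isSmoothFunctional_of_hasDerivAt
    (fun n φ => (functionalDeriv F (n + 1) φ).comp (snocCLM h)) (fun n φ σ u => ?_) (fun n => ?_)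
    (fun φ g => ?_) fun n φ g => ?_
  · exact CompDist.apply_snocFun_permuteVars (hF.functionalDeriv_permuteVars φ) σ u h
  · exact (hF.continuous_functionalDeriv (n + 1)).comp
      (continuous_fst.prodMk ((snocCLM h).continuous.comp continuous_snd))
  · change functionalDeriv F 1 φ (snocFun (tensorPow 0 h) h) = _
    rw [snocFun_tensorPow]
    rfl
  · have h1 := hF.hasDerivAt_functionalDeriv φ g (snocFun (tensorPow n g) h) 0
    rw [zero_smul, add_zero, CompDist.apply_snocFun_snocFun (hF.functionalDeriv_permuteVars φ),
      snocFun_tensorPow] at h1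
    exact h1

theorem dirDeriv (hF : IsSmoothFunctional F) (h : Config d) :
    IsSmoothFunctional (dirDeriv h F) := (hF.dirDeriv_aux h).1

theorem functionalDeriv_dirDeriv (hF : IsSmoothFunctional F) (h φ : Config d)
    (u : SmoothFun (Fin n → Euc d)) :
    functionalDeriv (_root_.dirDeriv h F) n φ u = functionalDeriv F (n + 1) φ (snocFun u h) := by
  rw [((hF.dirDeriv_aux h).2 n).eq]
  rfl

theorem hasDerivAt (hF : IsSmoothFunctional F) (φ h : Config d) (t : ℝ) :
    HasDerivAt (fun t : ℝ => F (φ + t • h)) (_root_.dirDeriv h F (φ + t • h)) t := by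
  have h1 := hF.hasDerivAt_functionalDeriv φ h (tensorPow 0 h) t
  rw [snocFun_tensorPow] at h1
  simp only [hF.functionalDeriv_zero] at h1
  exact h1

end IsSmoothFunctional

end FunctionalDeriv

end

/-! ### Linearity and supports of functionals -/

section

open SmoothFun

variable {d n : ℕ} {F G : Config d → ℂ}

section Linear

theorem IsFunctionalDeriv.add {S T : Config d → CompDist (Fin n → Euc d)}
    (hF : IsSmoothFunctional F) (hG : IsSmoothFunctional G) (hS : IsFunctionalDeriv F n S)
    (hT : IsFunctionalDeriv G n T) : IsFunctionalDeriv (F + G) n (S + T) := by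
  refine ⟨fun φ σ u => ?_, hS.continuous.add hT.continuous, fun φ h => ?_⟩
  · change S φ _ + T φ _ = S φ _ + T φ _
    rw [hS.symm, hT.symm]
  · change S φ _ + T φ _ = _
    have hn : ((n : ℕ∞) : WithTop ℕ∞) ≤ ∞ := by exact_mod_cast (le_top : (n : ℕ∞) ≤ ⊤)
    rw [hS.deriv_eq, hT.deriv_eq]
    exact (iteratedDeriv_add ((hF.contDiff_line φ h).contDiffAt.of_le hn)
      ((hG.contDiff_line φ h).contDiffAt.of_le hn)).symm

theorem IsFunctionalDeriv.smul {S : Config d → CompDist (Fin n → Euc d)} (c : ℂ)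
    (hS : IsFunctionalDeriv F n S) : IsFunctionalDeriv (c • F) n (c • S) := by
  refine ⟨fun φ σ u => ?_, hS.continuous.const_smul c, fun φ h => ?_⟩
  · change c • S φ _ = c • S φ _
    rw [hS.symm]
  · change c • S φ _ = _
    rw [hS.deriv_eq]
    simp

theorem functionalDeriv_add (hF : IsSmoothFunctional F) (hG : IsSmoothFunctional G) (φ : Config d) :
    functionalDeriv (F + G) n φ = functionalDeriv F n φ + functionalDeriv G n φ :=
  congrFun ((hF.isFunctionalDeriv n).add hF hG (hG.isFunctionalDeriv n)).eq φ

theorem functionalDeriv_smul (hF : IsSmoothFunctional F) (c : ℂ) (φ : Config d) :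
    functionalDeriv (c • F) n φ = c • functionalDeriv F n φ :=
  congrFun ((hF.isFunctionalDeriv n).smul c).eq φ

end Linear

section Support

theorem fst_mem_functionalSupport {φ : Config d} {x : Fin 1 → Euc d}
    (hx : x ∈ Distribution.dsupport (functionalDeriv F 1 φ)) : x 0 ∈ functionalSupport F := by
  refine subset_closure (mem_iUnion.2 ⟨φ, ?_⟩)
  rw [mem_ofPred_eq]
  convert hx using 2 with i
  rw [Subsingleton.elim i 0]

theorem SmoothFun.tsupport_tensorPow_one_subset (h : Config d) :
    tsupport (tensorPow 1 h) ⊆ {x | x 0 ∈ tsupport h} := by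
  refine closure_minimal (fun x hx => subset_tsupport _ ?_)
    ((isClosed_tsupport h).preimage (continuous_apply (0 : Fin 1)))
  have : tensorPow 1 h x = h (x 0) := Fin.prod_univ_one fun i => h (x i)
  rwa [Function.mem_support, this] at hx

namespace IsSmoothFunctional

theorem dirDeriv_eq_zero {h : Config d} (hd : Disjoint (tsupport h) (functionalSupport F))
    (φ : Config d) : _root_.dirDeriv h F φ = 0 :=
  CompDist.isVanishingOn_compl_dsupport _ _ fun _ hx hx' =>
    disjoint_left.1 hd (tsupport_tensorPow_one_subset h hx) (fst_mem_functionalSupport hx')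

/-- The derivative in direction `h` is zero at every configuration, so the functional is constant on
such lines. -/
theorem apply_add_smul (hF : IsSmoothFunctional F) {h : Config d}
    (hd : Disjoint (tsupport h) (functionalSupport F)) (φ : Config d) (t : ℝ) :
    F (φ + t • h) = F φ := by
  have h1 := fun t => hF.hasDerivAt φ h t
  simp only [dirDeriv_eq_zero hd] at h1
  simpa using is_const_of_deriv_eq_zero (fun t => (h1 t).differentiableAt) (fun t => (h1 t).deriv) t 0

/-- The functional is unchanged by the translation, so its translated derivative is a functional
derivative of the same functional; uniqueness applies. -/
theorem functionalDeriv_add_smul (hF : IsSmoothFunctional F) {h : Config d}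
    (hd : Disjoint (tsupport h) (functionalSupport F)) (n : ℕ) (φ : Config d) (t : ℝ) :
    functionalDeriv F n (φ + t • h) = functionalDeriv F n φ := by
  have hT := hF.isFunctionalDeriv n
  have h1 : IsFunctionalDeriv F n fun φ => functionalDeriv F n (φ + t • h) := by
    refine ⟨fun φ σ u => hT.symm _ σ u, hT.continuous.comp
      ((continuous_fst.add continuous_const).prodMk continuous_snd), fun φ g => ?_⟩
    rw [hT.deriv_eq]
    congr 1
    funext s
    rw [add_right_comm, hF.apply_add_smul hd]
  exact (congrFun h1.eq φ).symm

/-- Moved to the last slot by symmetry, the factor `v i` differentiates a derivative of lower order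
in a direction in which it is constant. -/
theorem functionalDeriv_prodFun_eq_zero (hF : IsSmoothFunctional F) (φ : Config d)
    (v : Fin n → Config d) (i : Fin n) (hi : Disjoint (tsupport (v i)) (functionalSupport F)) :
    functionalDeriv F n φ (prodFun v) = 0 := by
  cases n with
  | zero => exact i.elim0
  | succ n =>
    let σ : Equiv.Perm (Fin (n + 1)) := Equiv.swap i (Fin.last n)
    rw [← CompDist.apply_prodFun_perm (hF.functionalDeriv_permuteVars φ) σ]
    have h1 : (fun j => v (σ j)) = Fin.snoc (α := fun _ => Config d)
        (fun j : Fin n => v (σ j.castSucc)) (v i) := by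
      funext j
      refine Fin.lastCases ?_ (fun j => ?_) j
      · simp [σ]
      · simp
    rw [h1, ← snocFun_prodFun]
    have h2 := hF.hasDerivAt_functionalDeriv φ (v i) (prodFun fun j : Fin n => v (σ j.castSucc)) 0
    simp only [hF.functionalDeriv_add_smul hi] at h2
    exact h2.unique (hasDerivAt_const _ _)

/-- The complement of the power of the support is covered by the sets where one coordinate lies
outside; there the previous vanishing on tensor products extends by density. -/
theorem dsupport_functionalDeriv_subset (hF : IsSmoothFunctional F) (n : ℕ) (φ : Config d) :
    Distribution.dsupport (functionalDeriv F n φ) ⊆ pi univ fun _ => functionalSupport F := by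
  have hcl : IsClosed (functionalSupport F) := isClosed_closure
  rw [CompDist.dsupport_subset_iff _ (isClosed_set_pi fun _ _ => hcl)]
  let U (i : Fin n) : Set (Fin n → Euc d) := {x | x i ∉ functionalSupport F}
  have hU : ∀ i, IsOpen (U i) := fun i =>
    (isOpen_compl_iff.2 hcl).preimage (continuous_apply (A := fun _ : Fin n => Euc d) i)
  refine fun u hu => CompDist.apply_eq_zero_of_cover _ hU (fun i => ?_) (u := u) fun x hx => ?_
  · have hcomp : ∀ u : SmoothFun (Fin n → Euc d), HasCompactSupport u → tsupport u ⊆ U i →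
        functionalDeriv F n φ u = 0 := by
      intro u hu huU
      obtain ⟨χ, -, hχU, hχ1⟩ := exists_cutoff_of_isCompact
        (hu.isCompact.image (continuous_apply i)) hcl.isOpen_compl (image_subset_iff.2 huU)
      -- Multiplying by a cutoff in the `i`-th variable keeps products, now with a factor supported
      -- away from the functional, and fixes `u`.
      let X : SmoothFun (Fin n → Euc d) := pullback (.proj i) χ
      let L : CompDist (Fin n → Euc d) :=
        { toFun := fun g => functionalDeriv F n φ (X * g)
          map_add' := fun g h => by
            rw [← map_add]; exact congrArg _ (SmoothFun.ext fun x => mul_add _ _ _)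
          map_smul' := fun c g => by
            rw [← map_smul]; exact congrArg _ (SmoothFun.ext fun x => mul_left_comm _ _ _)
          cont := (functionalDeriv F n φ).continuous.comp (continuous_const.mul continuous_id) }
      have hL : L = 0 := by
        refine CompDist.ext_prodFun fun v => ?_
        change functionalDeriv F n φ (X * prodFun v) = 0
        have h1 : X * prodFun v = prodFun (Function.update v i (χ * v i)) := by
          ext x
          change χ (x i) * ∏ j, v j (x j) = ∏ j, Function.update v i (χ * v i) j (x j)
          rw [← Finset.mul_prod_erase _ _ (Finset.mem_univ i),
            ← Finset.mul_prod_erase _ _ (Finset.mem_univ i), Function.update_self,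
            SmoothFun.mul_apply, mul_assoc]
          congr 2
          exact Finset.prod_congr rfl fun j hj => by
            rw [Function.update_of_ne (Finset.ne_of_mem_erase hj)]
        rw [h1]
        refine hF.functionalDeriv_prodFun_eq_zero φ _ i ?_
        rw [Function.update_self]
        exact (disjoint_compl_left (a := functionalSupport F)).mono_left
          ((tsupport_mul_subset_left (f := χ) (g := v i)).trans hχU)
      have h2 : X * u = u := by
        ext x
        by_cases hx : u x = 0
        · simp [hx]
        · have : χ (x i) = 1 := hχ1 _ ⟨x, subset_tsupport _ hx, rfl⟩
          simp [X, this]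
      have h3 := congrArg (fun S : CompDist (Fin n → Euc d) => S u) hL
      change functionalDeriv F n φ (X * u) = 0 at h3
      rwa [h2] at h3
    intro u hu
    obtain ⟨χ, hχ, -, ht⟩ := exists_cutoff_seq (X := Fin n → Euc d)
    have h0 : ∀ n', functionalDeriv F n φ (χ n' * u) = 0 := fun n' =>
      hcomp _ (hχ n').mul_right ((SmoothFun.tsupport_mul_subset _ _).trans hu)
    have h1 : Tendsto (fun n' => functionalDeriv F n φ (χ n' * u)) atTop
        (𝓝 (functionalDeriv F n φ u)) := ((functionalDeriv F n φ).continuous.tendsto u).comp (ht u)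
    simp only [h0] at h1
    exact tendsto_nhds_unique h1 tendsto_const_nhds
  · have h1 := hu hx
    simp only [mem_compl_iff, mem_univ_pi, not_forall] at h1
    exact mem_iUnion.2 h1

/-- A functional that does not change along functions supported in an open set is supported in its
complement. -/
theorem functionalSupport_subset (hF : IsSmoothFunctional F) {C : Set (Euc d)} (hC : IsClosed C)
    (h : ∀ (g : Config d), Disjoint (tsupport g) C → ∀ (φ : Config d) (t : ℝ),
      F (φ + t • g) = F φ) : functionalSupport F ⊆ C := by
  refine closure_minimal (iUnion_subset fun φ x hx => ?_) hC
  have h1 : Distribution.dsupport (functionalDeriv F 1 φ) ⊆ {x : Fin 1 → Euc d | x 0 ∈ C} := by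
    rw [CompDist.dsupport_subset_iff _ (hC.preimage (continuous_apply (0 : Fin 1)))]
    intro u hu
    -- In a single variable every smooth function is a tensor power.
    let g : Config d := pullback (ContinuousLinearMap.pi fun _ : Fin 1 => .id ℝ (Euc d)) u
    have hg : tensorPow 1 g = u := by
      ext x
      refine (Fin.prod_univ_one fun i => g (x i)).trans ?_
      change u _ = u _
      congr 1
      funext i
      rw [Subsingleton.elim i 0]
      rfl
    have hgs : Disjoint (tsupport g) C := by
      refine disjoint_left.2 fun x hx hxC => ?_
      have : (fun _ : Fin 1 => x) ∈ tsupport u := by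
        have hc : Continuous fun (x : Euc d) (_ : Fin 1) => x := by fun_prop
        exact closure_minimal (s := Function.support g) (fun y hy => subset_tsupport u hy)
          ((isClosed_tsupport u).preimage hc) hx
      exact hu this hxC
    have h2 := hF.hasDerivAt φ g 0
    simp only [h g hgs] at h2
    have h3 := h2.unique (hasDerivAt_const _ _)
    rw [zero_smul, add_zero, _root_.dirDeriv, hg] at h3
    exact h3
  exact h1 hx

end IsSmoothFunctional

end Support

end

/-! ### Contractions of functionals with a smooth kernel -/

section

open SmoothFun

variable {d n : ℕ} {F G : Config d → ℂ}

namespace SmoothFun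

section CLM

variable {X Y : Type*} [NormedAddCommGroup X] [NormedSpace ℝ X] [NormedAddCommGroup Y]
  [NormedSpace ℝ Y] [FiniteDimensional ℝ X] [FiniteDimensional ℝ Y]

/-- Multiplication with a fixed function, as a continuous linear map. -/
def mulCLM (w : SmoothFun X) : SmoothFun X →L[ℝ] SmoothFun X where
  toFun u := w * u
  map_add' _ _ := SmoothFun.ext fun _ => mul_add _ _ _
  map_smul' _ _ := SmoothFun.ext fun _ => mul_left_comm _ _ _
  cont := continuous_const.mul continuous_id

@[simp] theorem mulCLM_apply (w u : SmoothFun X) : mulCLM w u = w * u := rfl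

/-- Pullback along a linear map, as a continuous linear map. -/
def pullbackCLM (A : X →L[ℝ] Y) : SmoothFun Y →L[ℝ] SmoothFun X where
  toFun u := pullback A u
  map_add' _ _ := rfl
  map_smul' _ _ := rfl
  cont := continuous_id.smoothFun_pullback A

@[simp] theorem pullbackCLM_apply (A : X →L[ℝ] Y) (u : SmoothFun Y) :
    pullbackCLM A u = pullback A u := rfl

/-- Distributions on a product that agree on products of functions are equal. -/
theorem _root_.CompDist.ext_tprod {S T : CompDist (X × Y)}
    (h : ∀ u v, S (tprod u v) = T (tprod u v)) : S = T :=
  ext_expFun fun ℓ => by rw [expFun_prod, h]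

end CLM

/-- Permutation of the variables, as a continuous linear map. -/
def permuteCLM (σ : Equiv.Perm (Fin n)) :
    SmoothFun (Fin n → Euc d) →L[ℝ] SmoothFun (Fin n → Euc d) :=
  pullbackCLM (ContinuousLinearMap.pi fun i => .proj (σ i))

theorem permuteCLM_apply (σ : Equiv.Perm (Fin n)) (u : SmoothFun (Fin n → Euc d)) :
    permuteCLM σ u = permuteVars σ u := rfl

/-- The product of `u` with `b` further factors `h`. -/
def extFun {k : ℕ} (u : SmoothFun (Fin k → Euc d)) (h : Config d) :
    ∀ b : ℕ, SmoothFun (Fin (k + b) → Euc d)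
  | 0 => u
  | b + 1 => snocFun (extFun u h b) h

theorem extFun_apply {k : ℕ} (u : SmoothFun (Fin k → Euc d)) (h : Config d) (b : ℕ)
    (x : Fin (k + b) → Euc d) :
    extFun u h b x = u (fun i => x (Fin.castAdd b i)) * ∏ i : Fin b, h (x (Fin.natAdd k i)) := by
  induction b with
  | zero => simp [extFun]
  | succ b ih =>
    rw [extFun, snocFun_apply, ih, Fin.prod_univ_castSucc, mul_assoc]
    rfl

theorem continuous_kerPow (k : ℕ) : Continuous fun K : SmoothFun (Euc d × Euc d) => kerPow k K := by
  induction k with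
  | zero =>
    have : (fun K : SmoothFun (Euc d × Euc d) => kerPow 0 K) = fun _ => kerPow 0 0 := by
      funext K
      ext p
      simp
    rw [this]
    exact continuous_const
  | succ k ih =>
    let A : ((Fin (k + 1) → Euc d) × (Fin (k + 1) → Euc d)) →L[ℝ]
        ((Fin k → Euc d) × (Fin k → Euc d)) :=
      ((ContinuousLinearMap.pi fun i : Fin k => .proj i.castSucc).comp (.fst ℝ _ _)).prod
        ((ContinuousLinearMap.pi fun i : Fin k => .proj i.castSucc).comp (.snd ℝ _ _))
    let B : ((Fin (k + 1) → Euc d) × (Fin (k + 1) → Euc d)) →L[ℝ] (Euc d × Euc d) :=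
      ((ContinuousLinearMap.proj (Fin.last k)).comp (.fst ℝ _ _)).prod
        ((ContinuousLinearMap.proj (Fin.last k)).comp (.snd ℝ _ _))
    have : (fun K : SmoothFun (Euc d × Euc d) => kerPow (k + 1) K) =
        fun K => pullback A (kerPow k K) * pullback B K := by
      funext K
      ext p
      exact Fin.prod_univ_castSucc _
    rw [this]
    exact (ih.smoothFun_pullback A).mul (continuous_id.smoothFun_pullback B)

end SmoothFun

section Symmetrize

/-- The symmetrisation of a distribution. -/
def CompDist.symmetrize (T : CompDist (Fin n → Euc d)) : CompDist (Fin n → Euc d) :=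
  (n.factorial : ℂ)⁻¹ • ∑ σ : Equiv.Perm (Fin n), T.comp (permuteCLM σ)

theorem CompDist.symmetrize_apply (T : CompDist (Fin n → Euc d)) (u : SmoothFun (Fin n → Euc d)) :
    T.symmetrize u = (n.factorial : ℂ)⁻¹ * ∑ σ : Equiv.Perm (Fin n), T (permuteVars σ u) := by
  simp [CompDist.symmetrize, permuteCLM_apply]

theorem CompDist.symmetrize_permuteVars (T : CompDist (Fin n → Euc d)) (τ : Equiv.Perm (Fin n))
    (u : SmoothFun (Fin n → Euc d)) : T.symmetrize (permuteVars τ u) = T.symmetrize u := by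
  rw [symmetrize_apply, symmetrize_apply]
  congr 1
  refine Fintype.sum_equiv (Equiv.mulRight τ) _ _ fun σ => ?_
  rfl

theorem CompDist.symmetrize_tensorPow (T : CompDist (Fin n → Euc d)) (h : Config d) :
    T.symmetrize (tensorPow n h) = T (tensorPow n h) := by
  rw [symmetrize_apply]
  have : ∀ σ : Equiv.Perm (Fin n), permuteVars σ (tensorPow n h) = tensorPow n h := fun σ =>
    permuteVars_prodFun σ fun _ => h
  simp only [this, Finset.sum_const, Finset.card_univ, Fintype.card_perm, Fintype.card_fin,
    nsmul_eq_mul]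
  rw [inv_mul_cancel_left₀ (Nat.cast_ne_zero.2 n.factorial_ne_zero)]

theorem continuous_symmetrize {Z : Type*} [TopologicalSpace Z] {T : Z → CompDist (Fin n → Euc d)}
    (hT : Continuous fun p : Z × SmoothFun (Fin n → Euc d) => T p.1 p.2) :
    Continuous fun p : Z × SmoothFun (Fin n → Euc d) => (T p.1).symmetrize p.2 := by
  simp only [CompDist.symmetrize_apply]
  refine continuous_const.mul (continuous_finsetSum _ fun σ _ => ?_)
  exact hT.comp (continuous_fst.prodMk ((permuteCLM σ).continuous.comp continuous_snd))

/-- Symmetrisation does not affect values at `h^{⊗n}`, so the candidates need not be symmetric. -/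
theorem isSmoothFunctional_of_hasDerivAt' (A : ∀ n, Config d → CompDist (Fin n → Euc d))
    (hcont : ∀ n, Continuous fun p : Config d × SmoothFun (Fin n → Euc d) => A n p.1 p.2)
    (hzero : ∀ φ h, A 0 φ (tensorPow 0 h) = F φ)
    (hderiv : ∀ n φ h, HasDerivAt (fun t : ℝ => A n (φ + t • h) (tensorPow n h))
      (A (n + 1) φ (tensorPow (n + 1) h)) 0) :
    IsSmoothFunctional F ∧ ∀ n, IsFunctionalDeriv F n fun φ => (A n φ).symmetrize :=
  isSmoothFunctional_of_hasDerivAt (fun n φ => (A n φ).symmetrize)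
    (fun n φ => (A n φ).symmetrize_permuteVars) (fun n => continuous_symmetrize (hcont n))
    (fun φ h => by rw [CompDist.symmetrize_tensorPow, hzero])
    fun n φ h => by simpa only [CompDist.symmetrize_tensorPow] using hderiv n φ h

end Symmetrize

section Contr

/-- The contraction of `F⁽ᵏ⁾` and `G⁽ᵏ⁾` with a smooth kernel. -/
def contr (K : SmoothFun (Euc d × Euc d)) (k : ℕ) (F G : Config d → ℂ) : Config d → ℂ :=
  fun φ => CompDist.tens (functionalDeriv F k φ) (functionalDeriv G k φ) (kerPow k K)

/-- The product rule. -/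
theorem hasDerivAt_tens (hF : IsSmoothFunctional F) (hG : IsSmoothFunctional G) (k l : ℕ)
    (φ h : Config d) (w : SmoothFun ((Fin k → Euc d) × (Fin l → Euc d))) (t : ℝ) :
    HasDerivAt (fun t : ℝ => CompDist.tens (functionalDeriv F k (φ + t • h))
        (functionalDeriv G l (φ + t • h)) w)
      (CompDist.tens (functionalDeriv (dirDeriv h F) k (φ + t • h))
        (functionalDeriv G l (φ + t • h)) w + CompDist.tens (functionalDeriv F k (φ + t • h))
        (functionalDeriv (dirDeriv h G) l (φ + t • h)) w) t := by
  have hc : ∀ {F : Config d → ℂ} (_ : IsSmoothFunctional F) (k : ℕ),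
      Continuous fun p : (ℝ × SmoothFun ((Fin k → Euc d) × (Fin l → Euc d))) ×
        SmoothFun (Fin k → Euc d) => functionalDeriv F k (φ + p.1.1 • h) p.2 := fun hF k =>
    (hF.continuous_functionalDeriv k).comp (Continuous.prodMk (by fun_prop) continuous_snd)
  have hc' : ∀ {F : Config d → ℂ} (_ : IsSmoothFunctional F) (m : ℕ),
      Continuous fun p : (ℝ × SmoothFun ((Fin k → Euc d) × (Fin l → Euc d))) ×
        SmoothFun (Fin m → Euc d) => functionalDeriv F m (φ + p.1.1 • h) p.2 := fun hF m =>
    (hF.continuous_functionalDeriv m).comp (Continuous.prodMk (by fun_prop) continuous_snd)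
  refine hasDerivAt_of_expFun
    (A := fun t => CompDist.tens (functionalDeriv F k (φ + t • h)) (functionalDeriv G l (φ + t • h)))
    (A' := fun t => CompDist.tens (functionalDeriv (dirDeriv h F) k (φ + t • h))
        (functionalDeriv G l (φ + t • h)) + CompDist.tens (functionalDeriv F k (φ + t • h))
        (functionalDeriv (dirDeriv h G) l (φ + t • h))) ?_ (fun ℓ t => ?_) w t
  · exact (CompDist.continuous_tens (hc' (hF.dirDeriv h) k) (hc' hG l) continuous_snd).add
      (CompDist.continuous_tens (hc' hF k) (hc' (hG.dirDeriv h) l) continuous_snd)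
  · rw [expFun_prod]
    change HasDerivAt _ (CompDist.tens _ _ _ + CompDist.tens _ _ _) t
    simp only [CompDist.tens_tprod, hF.functionalDeriv_dirDeriv, hG.functionalDeriv_dirDeriv]
    exact (hF.hasDerivAt_functionalDeriv φ h _ t).mul (hG.hasDerivAt_functionalDeriv φ h _ t)

theorem IsSmoothFunctional.iterate_dirDeriv (hF : IsSmoothFunctional F) (h : Config d) (b : ℕ) :
    IsSmoothFunctional ((_root_.dirDeriv h)^[b] F) := by
  induction b with
  | zero => exact hF
  | succ b ih => rw [Function.iterate_succ_apply']; exact ih.dirDeriv h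

theorem IsSmoothFunctional.functionalDeriv_iterate_dirDeriv (hF : IsSmoothFunctional F)
    (h : Config d) (b : ℕ) {k : ℕ} (φ : Config d) (u : SmoothFun (Fin k → Euc d)) :
    functionalDeriv ((_root_.dirDeriv h)^[b] F) k φ u =
      functionalDeriv F (k + b) φ (extFun u h b) := by
  induction b generalizing F with
  | zero => rfl
  | succ b ih => rw [Function.iterate_succ_apply, ih (hF.dirDeriv h), hF.functionalDeriv_dirDeriv]; rfl

/-- Restriction of both groups of variables to the first ones. -/
def headMap (d k b c : ℕ) :
    ((Fin (k + b) → Euc d) × (Fin (k + c) → Euc d)) →L[ℝ] ((Fin k → Euc d) × (Fin k → Euc d)) :=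
  ((ContinuousLinearMap.pi fun i => .proj (Fin.castAdd b i)).comp (.fst ℝ _ _)).prod
    ((ContinuousLinearMap.pi fun i => .proj (Fin.castAdd c i)).comp (.snd ℝ _ _))

/-- The remaining variables, as a single family. -/
def tailMap (d k n b c : ℕ) :
    ((Fin (k + b) → Euc d) × (Fin (k + c) → Euc d)) →L[ℝ] (Fin n → Euc d) :=
  ContinuousLinearMap.pi fun i => if h : (i : ℕ) < b then
    (ContinuousLinearMap.proj (Fin.natAdd k ⟨i, h⟩)).comp (.fst ℝ _ _) else
    -- The last value `0` is never reached when `b + c = n`.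
    if h' : (i : ℕ) - b < c then
      (ContinuousLinearMap.proj (Fin.natAdd k ⟨i - b, h'⟩)).comp (.snd ℝ _ _) else 0

theorem tensorPow_tailMap {k b c : ℕ} (hn : b + c = n) (h : Config d)
    (p : (Fin (k + b) → Euc d) × (Fin (k + c) → Euc d)) :
    tensorPow n h (tailMap d k n b c p) =
      (∏ i : Fin b, h (p.1 (Fin.natAdd k i))) * ∏ i : Fin c, h (p.2 (Fin.natAdd k i)) := by
  subst hn
  change ∏ i, h (tailMap d k (b + c) b c p i) = _
  rw [Fin.prod_univ_add]
  congr 1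
  · refine Finset.prod_congr rfl fun i _ => ?_
    simp [tailMap]
    rfl
  · refine Finset.prod_congr rfl fun i _ => ?_
    simp [tailMap]
    rfl

/-- Each directional derivative is one further slot filled with `h`. It suffices to compare both
sides on tensor products, where the extra slots separate. -/
theorem tens_iterate_dirDeriv (hF : IsSmoothFunctional F) (hG : IsSmoothFunctional G)
    (h : Config d) {k b c : ℕ} (hn : b + c = n) (φ : Config d)
    (w : SmoothFun ((Fin k → Euc d) × (Fin k → Euc d))) :
    CompDist.tens (functionalDeriv ((dirDeriv h)^[b] F) k φ)
        (functionalDeriv ((dirDeriv h)^[c] G) k φ) w =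
      CompDist.tens (functionalDeriv F (k + b) φ) (functionalDeriv G (k + c) φ)
        (pullback (headMap d k b c) w * pullback (tailMap d k n b c) (tensorPow n h)) := by
  have h1 : CompDist.tens (functionalDeriv ((dirDeriv h)^[b] F) k φ)
        (functionalDeriv ((dirDeriv h)^[c] G) k φ) =
      (CompDist.tens (functionalDeriv F (k + b) φ) (functionalDeriv G (k + c) φ)).comp
        ((mulCLM (pullback (tailMap d k n b c) (tensorPow n h))).comp
          (pullbackCLM (headMap d k b c))) := by
    refine CompDist.ext_tprod fun u v => ?_
    rw [CompDist.tens_tprod, hF.functionalDeriv_iterate_dirDeriv,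
      hG.functionalDeriv_iterate_dirDeriv, ← CompDist.tens_tprod]
    change CompDist.tens _ _ _ = CompDist.tens _ _ _
    congr 1
    ext p
    change extFun u h b p.1 * extFun v h c p.2 = tensorPow n h (tailMap d k n b c p) *
      (u (fun i => p.1 (Fin.castAdd b i)) * v (fun i => p.2 (Fin.castAdd c i)))
    rw [tensorPow_tailMap hn, extFun_apply, extFun_apply]
    ring
  rw [h1]
  change CompDist.tens _ _ _ = CompDist.tens _ _ _
  congr 1
  ext p
  exact mul_comm _ _

/-- The (unsymmetrised) derivatives of a contraction. -/
def contrDeriv (K : SmoothFun (Euc d × Euc d)) (k : ℕ) (F G : Config d → ℂ) (n : ℕ) (φ : Config d) :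
    CompDist (Fin n → Euc d) :=
  ∑ p ∈ Finset.HasAntidiagonal.antidiagonal n, n.choose p.1 •
    (CompDist.tens (functionalDeriv F (k + p.1) φ) (functionalDeriv G (k + p.2) φ)).comp
      ((mulCLM (pullback (headMap d k p.1 p.2) (kerPow k K))).comp
        (pullbackCLM (tailMap d k n p.1 p.2)))

theorem contrDeriv_apply (K : SmoothFun (Euc d × Euc d)) (k : ℕ) (F G : Config d → ℂ) (n : ℕ)
    (φ : Config d) (u : SmoothFun (Fin n → Euc d)) : contrDeriv K k F G n φ u =
      ∑ p ∈ Finset.HasAntidiagonal.antidiagonal n, n.choose p.1 •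
        CompDist.tens (functionalDeriv F (k + p.1) φ) (functionalDeriv G (k + p.2) φ)
          (pullback (headMap d k p.1 p.2) (kerPow k K) * pullback (tailMap d k n p.1 p.2) u) := by
  simp [contrDeriv]

/-- Continuity in the kernel is included, for the later passage from kernels of finite rank to all
smooth kernels. -/
theorem continuous_contrDeriv (hF : IsSmoothFunctional F) (hG : IsSmoothFunctional G) (k n : ℕ) :
    Continuous fun q : (SmoothFun (Euc d × Euc d) × Config d) × SmoothFun (Fin n → Euc d) =>
      contrDeriv q.1.1 k F G n q.1.2 q.2 := by
  simp only [contrDeriv_apply]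
  refine continuous_finsetSum _ fun p _ => Continuous.const_smul ?_ _
  refine CompDist.continuous_tens
    ((hF.continuous_functionalDeriv _).comp (Continuous.prodMk (by fun_prop) continuous_snd))
    ((hG.continuous_functionalDeriv _).comp (Continuous.prodMk (by fun_prop) continuous_snd)) ?_
  exact (((continuous_kerPow k).comp (by fun_prop)).smoothFun_pullback _).mul
    (continuous_snd.smoothFun_pullback _)

theorem contrDeriv_tensorPow (hF : IsSmoothFunctional F) (hG : IsSmoothFunctional G)
    (K : SmoothFun (Euc d × Euc d)) (k n : ℕ) (φ h : Config d) :
    contrDeriv K k F G n φ (tensorPow n h) = ∑ p ∈ Finset.HasAntidiagonal.antidiagonal n,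
      n.choose p.1 • contr K k ((dirDeriv h)^[p.1] F) ((dirDeriv h)^[p.2] G) φ := by
  rw [contrDeriv_apply]
  refine Finset.sum_congr rfl fun p hp => ?_
  rw [contr, tens_iterate_dirDeriv hF hG h (Finset.HasAntidiagonal.mem_antidiagonal.1 hp)]

theorem hasDerivAt_contr (hF : IsSmoothFunctional F) (hG : IsSmoothFunctional G)
    (K : SmoothFun (Euc d × Euc d)) (k : ℕ) (φ h : Config d) :
    HasDerivAt (fun t : ℝ => contr K k F G (φ + t • h))
      (contr K k (dirDeriv h F) G φ + contr K k F (dirDeriv h G) φ) 0 := by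
  have h1 := hasDerivAt_tens hF hG k k φ h (kerPow k K) 0
  simp only [zero_smul, add_zero] at h1
  exact h1

/-- The candidates are given by the Leibniz formula of order `n`, and the product rule leads from
one order to the next. -/
theorem isFunctionalDeriv_contr (hF : IsSmoothFunctional F) (hG : IsSmoothFunctional G)
    (K : SmoothFun (Euc d × Euc d)) (k : ℕ) : IsSmoothFunctional (contr K k F G) ∧
      ∀ n, IsFunctionalDeriv (contr K k F G) n fun φ => (contrDeriv K k F G n φ).symmetrize := by
  refine isSmoothFunctional_of_hasDerivAt' (F := contr K k F G)
    (fun n φ => contrDeriv K k F G n φ) (fun n => ?_) (fun φ h => ?_) fun n φ h => ?_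
  · have hc : Continuous fun p : Config d × SmoothFun (Fin n → Euc d) => ((K, p.1), p.2) :=
      (continuous_const.prodMk continuous_fst).prodMk continuous_snd
    have h2 := (continuous_contrDeriv hF hG k n).comp hc
    exact h2
  · rw [contrDeriv_tensorPow hF hG]
    simp
  · simp only [contrDeriv_tensorPow hF hG]
    -- Pascal's rule splits order `n + 1` into the two terms of the product rule.
    rw [Finset.sum_antidiagonal_choose_succ_nsmul
      (fun b c => contr K k ((dirDeriv h)^[b] F) ((dirDeriv h)^[c] G) φ) n,
      ← Finset.sum_add_distrib]
    refine HasDerivAt.fun_sum fun p hp => ?_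
    rw [Nat.choose_symm_of_eq_add (Finset.HasAntidiagonal.mem_antidiagonal.1 hp).symm, ← smul_add,
      Function.iterate_succ_apply', Function.iterate_succ_apply', add_comm]
    exact (hasDerivAt_contr (hF.iterate_dirDeriv h p.1) (hG.iterate_dirDeriv h p.2) K k φ h).const_smul _

theorem isSmoothFunctional_contr (hF : IsSmoothFunctional F) (hG : IsSmoothFunctional G)
    (K : SmoothFun (Euc d × Euc d)) (k : ℕ) : IsSmoothFunctional (contr K k F G) :=
  (isFunctionalDeriv_contr hF hG K k).1

theorem dirDeriv_contr (hF : IsSmoothFunctional F) (hG : IsSmoothFunctional G)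
    (K : SmoothFun (Euc d × Euc d)) (k : ℕ) (h : Config d) :
    dirDeriv h (contr K k F G) = contr K k (dirDeriv h F) G + contr K k F (dirDeriv h G) := by
  funext φ
  have h1 := (isSmoothFunctional_contr hF hG K k).hasDerivAt φ h 0
  rw [zero_smul, add_zero] at h1
  exact h1.unique (hasDerivAt_contr hF hG K k φ h)

theorem continuous_functionalDeriv_contr (hF : IsSmoothFunctional F) (hG : IsSmoothFunctional G)
    (k n : ℕ) (φ : Config d) :
    Continuous fun q : SmoothFun (Euc d × Euc d) × SmoothFun (Fin n → Euc d) =>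
      functionalDeriv (contr q.1 k F G) n φ q.2 := by
  have h1 : ∀ K, functionalDeriv (contr K k F G) n φ = (contrDeriv K k F G n φ).symmetrize :=
    fun K => congrFun ((isFunctionalDeriv_contr hF hG K k).2 n).eq φ
  simp only [h1]
  have hc : Continuous fun q : SmoothFun (Euc d × Euc d) × SmoothFun (Fin n → Euc d) =>
      ((q.1, φ), q.2) := (continuous_fst.prodMk continuous_const).prodMk continuous_snd
  have h2 := (continuous_contrDeriv hF hG k n).comp hc
  exact continuous_symmetrize (T := fun K => contrDeriv K k F G n φ) h2

end Contr

end

/-! ### Associativity and commutativity for smooth kernels -/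

section

open SmoothFun

open scoped TensorProduct

variable {d n : ℕ} {F G : Config d → ℂ}

/-- An empty kernel is the constant `1`. Closure under pointwise products and the Leibniz rule thus
come from contractions. -/
theorem contr_zero (hF : IsSmoothFunctional F) (hG : IsSmoothFunctional G)
    (K : SmoothFun (Euc d × Euc d)) : contr K 0 F G = F * G := by
  funext φ
  have : kerPow 0 K = SmoothFun.tprod (tensorPow 0 (0 : Config d)) (tensorPow 0 (0 : Config d)) := by
    ext p
    simp [kerPow, tensorPow]
  rw [contr, this, CompDist.tens_tprod, hF.functionalDeriv_zero, hG.functionalDeriv_zero]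
  rfl

theorem IsSmoothFunctional.mul (hF : IsSmoothFunctional F) (hG : IsSmoothFunctional G) :
    IsSmoothFunctional (F * G) := by
  rw [← contr_zero hF hG 0]
  exact isSmoothFunctional_contr hF hG 0 0

/-- Leibniz rule. -/
theorem dirDeriv_mul (hF : IsSmoothFunctional F) (hG : IsSmoothFunctional G) (h : Config d) :
    dirDeriv h (F * G) = dirDeriv h F * G + F * dirDeriv h G := by
  rw [← contr_zero hF hG 0, dirDeriv_contr hF hG, contr_zero (hF.dirDeriv h) hG,
    contr_zero hF (hG.dirDeriv h)]

theorem dirDeriv_comm (hF : IsSmoothFunctional F) (h g : Config d) :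
    dirDeriv h (dirDeriv g F) = dirDeriv g (dirDeriv h F) := by
  funext φ
  change functionalDeriv (dirDeriv g F) 1 φ _ = functionalDeriv (dirDeriv h F) 1 φ _
  have h0 : tensorPow 0 g = tensorPow 0 h := by
    ext p
    simp [tensorPow]
  rw [hF.functionalDeriv_dirDeriv, hF.functionalDeriv_dirDeriv,
    ← snocFun_tensorPow 0 h, ← snocFun_tensorPow 0 g, h0]
  exact CompDist.apply_snocFun_snocFun ((hF.isFunctionalDeriv 2).symm φ) _ h g

namespace Functionals

/-- The directional derivative, as an endomorphism of the space of functionals. -/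
def deriv (h : Config d) : Module.End ℂ (Functionals d) where
  toFun F := ⟨dirDeriv h F.1, F.2.dirDeriv h⟩
  map_add' F G := Subtype.ext (funext fun φ => by
    change functionalDeriv (F.1 + G.1) 1 φ _ = _
    rw [functionalDeriv_add F.2 G.2]
    rfl)
  map_smul' c F := Subtype.ext (funext fun φ => by
    change functionalDeriv (c • F.1) 1 φ _ = _
    rw [functionalDeriv_smul F.2]
    rfl)

theorem deriv_comm (h g : Config d) : Commute (deriv h) (deriv g) :=
  LinearMap.ext fun F => Subtype.ext (dirDeriv_comm F.2 h g)

/-- Multiplication of functionals. -/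
def mul : Functionals d ⊗[ℂ] Functionals d →ₗ[ℂ] Functionals d :=
  TensorProduct.lift (LinearMap.mk₂ ℂ (fun F G => ⟨F.1 * G.1, F.2.mul G.2⟩)
    (fun _ _ _ => Subtype.ext (add_mul _ _ _)) (fun _ _ _ => Subtype.ext (smul_mul_assoc _ _ _))
    (fun _ _ _ => Subtype.ext (mul_add _ _ _)) (fun _ _ _ => Subtype.ext (mul_smul_comm _ _ _)))

theorem deriv_mul (h : Config d) (F G : Functionals d) :
    deriv h (mul (F ⊗ₜ G)) = mul (deriv h F ⊗ₜ G) + mul (F ⊗ₜ deriv h G) :=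
  Subtype.ext (dirDeriv_mul F.2 G.2 h)

variable {ι : Type*} [Fintype ι] (f g : ι → Config d)

/-- The bidifferential operator `∑ₐ ∂_{fₐ} ⊗ ∂_{gₐ}`. -/
def bideriv : Module.End ℂ (Functionals d ⊗[ℂ] Functionals d) :=
  ∑ a, TensorProduct.map (deriv (f a)) (deriv (g a))

theorem bideriv_tmul (F G : Functionals d) :
    bideriv f g (F ⊗ₜ G) = ∑ a, deriv (f a) F ⊗ₜ deriv (g a) G := by
  simp [bideriv]

end Functionals

theorem contr_dirDeriv (hF : IsSmoothFunctional F) (hG : IsSmoothFunctional G) (f g : Config d)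
    (k : ℕ) (φ : Config d) (K : SmoothFun (Euc d × Euc d)) :
    contr K k (dirDeriv f F) (dirDeriv g G) φ =
      CompDist.tens (functionalDeriv F (k + 1) φ) (functionalDeriv G (k + 1) φ)
        (pullback (headMap d k 1 1) (kerPow k K) * SmoothFun.tprod
          (pullback (.proj (Fin.last k)) f) (pullback (.proj (Fin.last k)) g)) := by
  have h1 : CompDist.tens (functionalDeriv (dirDeriv f F) k φ)
        (functionalDeriv (dirDeriv g G) k φ) =
      (CompDist.tens (functionalDeriv F (k + 1) φ) (functionalDeriv G (k + 1) φ)).comp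
        ((mulCLM (SmoothFun.tprod (pullback (.proj (Fin.last k)) f) (pullback (.proj (Fin.last k)) g))).comp
          (pullbackCLM (headMap d k 1 1))) := by
    refine CompDist.ext_tprod fun u v => ?_
    rw [CompDist.tens_tprod, hF.functionalDeriv_dirDeriv,
      hG.functionalDeriv_dirDeriv, ← CompDist.tens_tprod]
    change CompDist.tens _ _ _ = CompDist.tens _ _ _
    congr 1
    ext p
    change u (fun i => p.1 i.castSucc) * f (p.1 (Fin.last k)) *
      (v (fun i => p.2 i.castSucc) * g (p.2 (Fin.last k))) =
      f (p.1 (Fin.last k)) * g (p.2 (Fin.last k)) *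
      (u (fun i => p.1 i.castSucc) * v (fun i => p.2 i.castSucc))
    ring
  rw [contr, h1]
  change CompDist.tens _ _ _ = CompDist.tens _ _ _
  congr 1
  ext p
  exact mul_comm _ _

/-- One of the `k + 1` kernel factors is expanded; each of its terms `fₐ ⊗ gₐ` fills the last slots,
that is, differentiates `F` and `G`. -/
theorem contr_succ (hF : IsSmoothFunctional F) (hG : IsSmoothFunctional G) {ι : Type*} [Fintype ι]
    (f g : ι → Config d) (k : ℕ) : contr (∑ a, SmoothFun.tprod (f a) (g a)) (k + 1) F G =
      ∑ a, contr (∑ a, SmoothFun.tprod (f a) (g a)) k (dirDeriv (f a) F) (dirDeriv (g a) G) := by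
  funext φ
  rw [Finset.sum_apply]
  simp only [contr_dirDeriv hF hG]
  rw [contr, ← map_sum]
  congr 1
  ext p
  rw [SmoothFun.sum_apply]
  change ∏ i, (∑ a, SmoothFun.tprod (f a) (g a)) (p.1 i, p.2 i) = ∑ a, (∏ i : Fin k,
    (∑ a, SmoothFun.tprod (f a) (g a)) (p.1 i.castSucc, p.2 i.castSucc)) *
      (f a (p.1 (Fin.last k)) * g a (p.2 (Fin.last k)))
  rw [Fin.prod_univ_castSucc, ← Finset.mul_sum, SmoothFun.sum_apply _ _ (p.1 (Fin.last k), _)]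
  rfl

namespace Functionals

variable {ι : Type*} [Fintype ι] (f g : ι → Config d)

/-- For kernels of finite rank the contractions are powers of one operator, and associativity
becomes algebra of endomorphisms. -/
theorem contr_sum_tprod (k : ℕ) (F G : Functionals d) :
    contr (∑ a, SmoothFun.tprod (f a) (g a)) k F G = mul ((bideriv f g ^ k) (F ⊗ₜ G)) := by
  induction k generalizing F G with
  | zero => exact contr_zero F.2 G.2 _
  | succ k ih =>
    rw [contr_succ F.2 G.2, pow_succ, Module.End.mul_apply, bideriv_tmul, map_sum, map_sum,
      Submodule.coe_sum]
    exact Finset.sum_congr rfl fun a _ => ih (deriv (f a) F) (deriv (g a) G)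

/-- `∑ₐ ∂_{fₐ} ⊗ 1 ⊗ ∂_{gₐ} + 1 ⊗ ∂_{fₐ} ⊗ ∂_{gₐ}`. -/
def biderivLeft : Module.End ℂ ((Functionals d ⊗[ℂ] Functionals d) ⊗[ℂ] Functionals d) :=
  ∑ a, (TensorProduct.map (TensorProduct.map (deriv (f a)) 1) (deriv (g a)) +
    TensorProduct.map (TensorProduct.map 1 (deriv (f a))) (deriv (g a)))

/-- `∑ₐ ∂_{fₐ} ⊗ ∂_{gₐ} ⊗ 1 + ∂_{fₐ} ⊗ 1 ⊗ ∂_{gₐ}`. -/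
def biderivRight : Module.End ℂ (Functionals d ⊗[ℂ] (Functionals d ⊗[ℂ] Functionals d)) :=
  ∑ a, (TensorProduct.map (deriv (f a)) (TensorProduct.map (deriv (g a)) 1) +
    TensorProduct.map (deriv (f a)) (TensorProduct.map 1 (deriv (g a))))

/-- The Leibniz rule in the first factor: `D` after multiplication is multiplication after `D₁₃ +
D₂₃`. -/
theorem bideriv_comp_rTensor_mul : bideriv f g ∘ₗ mul.rTensor (Functionals d) =
    mul.rTensor (Functionals d) ∘ₗ biderivLeft f g := by
  refine TensorProduct.ext_threefold fun F G H => ?_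
  simp [bideriv, biderivLeft, deriv_mul, TensorProduct.add_tmul]

theorem bideriv_comp_lTensor_mul : bideriv f g ∘ₗ mul.lTensor (Functionals d) =
    mul.lTensor (Functionals d) ∘ₗ biderivRight f g := by
  refine TensorProduct.ext_threefold' fun F G H => ?_
  simp [bideriv, biderivRight, deriv_mul, TensorProduct.tmul_add]

theorem _root_.Commute.tensorProduct_map {R M N : Type*} [CommSemiring R] [AddCommMonoid M]
    [AddCommMonoid N] [Module R M] [Module R N] {f f' : Module.End R M} {g g' : Module.End R N}
    (hf : Commute f f') (hg : Commute g g') :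
    Commute (TensorProduct.map f g) (TensorProduct.map f' g') := by
  rw [commute_iff_eq, ← TensorProduct.map_mul, ← TensorProduct.map_mul, hf.eq, hg.eq]

theorem rTensor_bideriv : (bideriv f g).rTensor (Functionals d) = ∑ a,
    TensorProduct.map (TensorProduct.map (deriv (f a)) (deriv (g a))) (1 : Module.End ℂ _) := by
  refine TensorProduct.ext_threefold fun F G H => ?_
  simp [bideriv, TensorProduct.sum_tmul]

theorem lTensor_bideriv : (bideriv f g).lTensor (Functionals d) = ∑ a,
    TensorProduct.map (1 : Module.End ℂ _) (TensorProduct.map (deriv (f a)) (deriv (g a))) := by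
  refine TensorProduct.ext_threefold' fun F G H => ?_
  simp [bideriv, TensorProduct.tmul_sum]

/-- Directional derivatives commute, so `D₁₃ + D₂₃` commutes with `D₁₂` and the binomial theorem
applies. -/
theorem commute_biderivLeft :
    Commute (biderivLeft f g) ((bideriv f g).rTensor (Functionals d)) := by
  rw [rTensor_bideriv, biderivLeft]
  refine Commute.sum_left _ _ _ fun a _ => Commute.sum_right _ _ _ fun b _ => Commute.add_left ?_ ?_
  · exact ((deriv_comm _ _).tensorProduct_map (Commute.one_left _)).tensorProduct_map
      (Commute.one_right _)
  · exact ((Commute.one_left _).tensorProduct_map (deriv_comm _ _)).tensorProduct_map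
      (Commute.one_right _)

theorem commute_biderivRight :
    Commute (biderivRight f g) ((bideriv f g).lTensor (Functionals d)) := by
  rw [lTensor_bideriv, biderivRight]
  refine Commute.sum_left _ _ _ fun a _ => Commute.sum_right _ _ _ fun b _ => Commute.add_left ?_ ?_
  · exact (Commute.one_right _).tensorProduct_map
      ((deriv_comm _ _).tensorProduct_map (Commute.one_left _))
  · exact (Commute.one_right _).tensorProduct_map
      ((Commute.one_left _).tensorProduct_map (deriv_comm _ _))

/-- Both sums are `D₁₂ + D₁₃ + D₂₃`, up to the bracketing of the tensor product. -/
theorem assoc_comp_biderivLeft : (TensorProduct.assoc ℂ (Functionals d) (Functionals d)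
      (Functionals d)).toLinearMap ∘ₗ (biderivLeft f g + (bideriv f g).rTensor (Functionals d)) =
    (biderivRight f g + (bideriv f g).lTensor (Functionals d)) ∘ₗ
      (TensorProduct.assoc ℂ (Functionals d) (Functionals d) (Functionals d)).toLinearMap := by
  refine TensorProduct.ext_threefold fun F G H => ?_
  simp [bideriv, biderivLeft, biderivRight, Finset.sum_add_distrib, TensorProduct.tmul_sum,
    TensorProduct.sum_tmul]
  abel

theorem mul_assoc : mul ∘ₗ mul.rTensor (Functionals d) = (mul ∘ₗ mul.lTensor (Functionals d)) ∘ₗ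
    (TensorProduct.assoc ℂ (Functionals d) (Functionals d) (Functionals d)).toLinearMap := by
  refine TensorProduct.ext_threefold fun F G H => Subtype.ext ?_
  exact _root_.mul_assoc F.1 G.1 H.1

theorem contr_contr_left (k a : ℕ) (F G H : Functionals d) :
    contr (∑ a, SmoothFun.tprod (f a) (g a)) k (contr (∑ a, SmoothFun.tprod (f a) (g a)) a F G) H =
      mul (mul.rTensor (Functionals d)
        ((biderivLeft f g ^ k * (bideriv f g).rTensor (Functionals d) ^ a) ((F ⊗ₜ G) ⊗ₜ H))) := by
  rw [contr_sum_tprod, contr_sum_tprod, Module.End.mul_apply, LinearMap.rTensor_pow,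
    LinearMap.rTensor_tmul]
  have := LinearMap.congr_fun
    (Module.End.commute_pow_left_of_commute (bideriv_comp_rTensor_mul f g) k)
    (((bideriv f g ^ a) (F ⊗ₜ G)) ⊗ₜ H)
  rw [LinearMap.comp_apply, LinearMap.comp_apply, LinearMap.rTensor_tmul] at this
  rw [this]

theorem contr_contr_right (k a : ℕ) (F G H : Functionals d) :
    contr (∑ a, SmoothFun.tprod (f a) (g a)) k F (contr (∑ a, SmoothFun.tprod (f a) (g a)) a G H) =
      mul (mul.lTensor (Functionals d)
        ((biderivRight f g ^ k * (bideriv f g).lTensor (Functionals d) ^ a) (F ⊗ₜ (G ⊗ₜ H)))) := by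
  rw [contr_sum_tprod, contr_sum_tprod, Module.End.mul_apply, LinearMap.lTensor_pow,
    LinearMap.lTensor_tmul]
  have := LinearMap.congr_fun
    (Module.End.commute_pow_left_of_commute (bideriv_comp_lTensor_mul f g) k)
    (F ⊗ₜ ((bideriv f g ^ a) (G ⊗ₜ H)))
  rw [LinearMap.comp_apply, LinearMap.comp_apply, LinearMap.lTensor_tmul] at this
  rw [this]

/-- The coefficient of order `N` of `exp x · exp y = exp (x + y)`. -/
theorem _root_.Commute.sum_factorial_smul {M : Type*} [AddCommMonoid M] [Module ℂ M]
    {x y : Module.End ℂ M}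
    (h : Commute x y) (N : ℕ) : ∑ p ∈ Finset.HasAntidiagonal.antidiagonal N,
      ((p.1.factorial : ℂ)⁻¹ * (p.2.factorial : ℂ)⁻¹) • (x ^ p.1 * y ^ p.2) =
        (N.factorial : ℂ)⁻¹ • (x + y) ^ N := by
  rw [h.add_pow', Finset.smul_sum]
  refine Finset.sum_congr rfl fun p hp => ?_
  rw [← Nat.cast_smul_eq_nsmul ℂ, smul_smul]
  congr 1
  have hp' := Finset.HasAntidiagonal.mem_antidiagonal.1 hp
  have h1 := Nat.choose_mul_factorial_mul_factorial (Nat.le.intro hp')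
  rw [Nat.sub_eq_of_eq_add' hp'.symm] at h1
  have h2 : ((N.choose p.1 * p.1.factorial * p.2.factorial : ℕ) : ℂ) = N.factorial := by rw [h1]
  push_cast at h2
  have h3 : (N.factorial : ℂ) ≠ 0 := Nat.cast_ne_zero.2 N.factorial_ne_zero
  have h4 : (p.1.factorial : ℂ) ≠ 0 := Nat.cast_ne_zero.2 p.1.factorial_ne_zero
  have h5 : (p.2.factorial : ℂ) ≠ 0 := Nat.cast_ne_zero.2 p.2.factorial_ne_zero
  field_simp
  rw [← h2]
  ring

theorem sum_contr_contr_sum_tprod (N : ℕ) (F G H : Functionals d) :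
    ∑ p ∈ Finset.HasAntidiagonal.antidiagonal N, ((p.1.factorial : ℂ)⁻¹ * (p.2.factorial : ℂ)⁻¹) •
      contr (∑ a, SmoothFun.tprod (f a) (g a)) p.1
        (contr (∑ a, SmoothFun.tprod (f a) (g a)) p.2 F G) H =
    ∑ p ∈ Finset.HasAntidiagonal.antidiagonal N, ((p.1.factorial : ℂ)⁻¹ * (p.2.factorial : ℂ)⁻¹) •
      contr (∑ a, SmoothFun.tprod (f a) (g a)) p.1 F
        (contr (∑ a, SmoothFun.tprod (f a) (g a)) p.2 G H) := by
  simp only [contr_contr_left, contr_contr_right]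
  have hl := LinearMap.congr_fun (Commute.sum_factorial_smul
    (M := (Functionals d ⊗[ℂ] Functionals d) ⊗[ℂ] Functionals d) (commute_biderivLeft f g) N) ((F ⊗ₜ G) ⊗ₜ H)
  have hr := LinearMap.congr_fun (Commute.sum_factorial_smul
    (M := Functionals d ⊗[ℂ] (Functionals d ⊗[ℂ] Functionals d)) (commute_biderivRight f g) N) (F ⊗ₜ (G ⊗ₜ H))
  have ha := LinearMap.congr_fun (Module.End.commute_pow_left_of_commute
    (assoc_comp_biderivLeft f g).symm N) ((F ⊗ₜ G) ⊗ₜ H)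
  rw [LinearMap.sum_apply] at hl hr
  simp only [LinearMap.smul_apply] at hl hr
  have hl' := congrArg (fun x => (mul (mul.rTensor (Functionals d) x) : Config d → ℂ)) hl
  have hr' := congrArg (fun x => (mul (mul.lTensor (Functionals d) x) : Config d → ℂ)) hr
  simp only [map_sum, map_smul, Submodule.coe_sum, Submodule.coe_smul] at hl' hr'
  rw [hl', hr']
  congr 2
  have hm := LinearMap.congr_fun (mul_assoc (d := d))
    (((biderivLeft f g + (bideriv f g).rTensor (Functionals d)) ^ N) ((F ⊗ₜ G) ⊗ₜ H))
  simp only [LinearMap.comp_apply] at hm ha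
  rw [hm, ← ha]
  rfl

end Functionals

/-- Sums of exponentials on the product space are already of this form. -/
theorem SmoothFun.dense_sum_tprod : Dense {K : SmoothFun (Euc d × Euc d) |
    ∃ (n : ℕ) (f g : Fin n → Config d), K = ∑ a, SmoothFun.tprod (f a) (g a)} := by
  refine dense_expSpan.mono fun K hK => ?_
  obtain ⟨n, c, e, rfl⟩ := Submodule.mem_span_set'.1 hK
  have h1 : ∀ a, ∃ ℓ : Euc d × Euc d →L[ℝ] ℝ, expFun ℓ = e a := fun a => (e a).2
  choose ℓ hℓ using h1
  refine ⟨n, fun a => c a • expFun ((ℓ a).comp (.inl ℝ _ _)),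
    fun a => expFun ((ℓ a).comp (.inr ℝ _ _)), Finset.sum_congr rfl fun a _ => ?_⟩
  rw [← hℓ, expFun_prod]
  ext p
  exact (_root_.mul_assoc _ _ _).symm

/-- The kernel enters twice, through the inner functional and the outer contraction; the joint
continuity of `CompDist.tens` covers both. -/
theorem continuous_contr_contr_left {H : Config d → ℂ} (hF : IsSmoothFunctional F)
    (hG : IsSmoothFunctional G) (k a : ℕ) (φ : Config d) :
    Continuous fun K => contr K k (contr K a F G) H φ :=
  CompDist.continuous_tens (continuous_functionalDeriv_contr hF hG a k φ)
    ((functionalDeriv H k φ).continuous.comp continuous_snd) (continuous_kerPow k)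

theorem continuous_contr_contr_right {H : Config d → ℂ} (hG : IsSmoothFunctional G)
    (hH : IsSmoothFunctional H) (k a : ℕ) (φ : Config d) :
    Continuous fun K => contr K k F (contr K a G H) φ :=
  CompDist.continuous_tens ((functionalDeriv F k φ).continuous.comp continuous_snd)
    (continuous_functionalDeriv_contr hG hH a k φ) (continuous_kerPow k)

/-- Associativity of the product defined by a smooth kernel. -/
theorem sum_contr_contr {H : Config d → ℂ} (hF : IsSmoothFunctional F)
    (hG : IsSmoothFunctional G) (hH : IsSmoothFunctional H) (K : SmoothFun (Euc d × Euc d))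
    (N : ℕ) (φ : Config d) :
    ∑ p ∈ Finset.HasAntidiagonal.antidiagonal N, ((p.1.factorial : ℂ)⁻¹ * (p.2.factorial : ℂ)⁻¹) *
      contr K p.1 (contr K p.2 F G) H φ =
    ∑ p ∈ Finset.HasAntidiagonal.antidiagonal N, ((p.1.factorial : ℂ)⁻¹ * (p.2.factorial : ℂ)⁻¹) *
      contr K p.1 F (contr K p.2 G H) φ := by
  refine congrFun (Continuous.ext_on (dense_sum_tprod (d := d))
    (continuous_finsetSum _ fun (p : ℕ × ℕ) _ => continuous_const.mul
      (continuous_contr_contr_left hF hG p.1 p.2 φ))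
    (continuous_finsetSum _ fun (p : ℕ × ℕ) _ => continuous_const.mul
      (continuous_contr_contr_right hG hH p.1 p.2 φ)) ?_) K
  rintro _ ⟨n, f, g, rfl⟩
  have := congrFun (Functionals.sum_contr_contr_sum_tprod f g N ⟨F, hF⟩ ⟨G, hG⟩ ⟨H, hH⟩) φ
  simp only [Finset.sum_apply, Pi.smul_apply, smul_eq_mul] at this
  exact this

/-- Commutativity for symmetric kernels. -/
theorem contr_comm (F G : Config d → ℂ) {K : SmoothFun (Euc d × Euc d)}
    (hK : ∀ x y, K (x, y) = K (y, x)) (k : ℕ) : contr K k F G = contr K k G F := by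
  funext φ
  rw [contr, CompDist.tens_swap]
  change CompDist.tens _ _ _ = CompDist.tens _ _ _
  congr 1
  ext p
  change ∏ i, K (p.2 i, p.1 i) = ∏ i, K (p.1 i, p.2 i)
  exact Finset.prod_congr rfl fun i _ => hK (p.2 i) (p.1 i)

end

/-! ### Localisation: the time-ordered product is locally given by smooth kernels -/

section

open SmoothFun

variable {d n : ℕ} {F G H : Config d → ℂ}

section Gluing

/-- Being a smooth functional is a local property. -/
theorem isSmoothFunctional_of_locally
    (h : ∀ φ, ∃ H, IsSmoothFunctional H ∧ F =ᶠ[𝓝 φ] H) : IsSmoothFunctional F := by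
  choose H hH hFH using h
  -- Near `φ₀` the representatives chosen at `φ` and at `φ₀` have the same germ at `φ`, so the glued
  -- derivative is locally that of one functional.
  have key : ∀ n φ₀, ∀ᶠ φ in 𝓝 φ₀,
      functionalDeriv (H φ) n φ = functionalDeriv (H φ₀) n φ := fun n φ₀ => by
    filter_upwards [(hFH φ₀).eventuallyEq_nhds] with φ hφ
    exact ((hH φ).isFunctionalDeriv n).eq_of_eventuallyEq ((hH φ₀).isFunctionalDeriv n)
      ((hFH φ).symm.trans hφ)
  have hline : ∀ (φ h : Config d) (t : ℝ), (fun s : ℝ => F (φ + s • h)) =ᶠ[𝓝 t]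
      fun s => H (φ + t • h) (φ + s • h) := fun φ h t => by
    have hc : Continuous fun s : ℝ => φ + s • h := by fun_prop
    exact hc.continuousAt.eventually (hFH (φ + t • h))
  refine ⟨fun φ h => ?_, fun n => ⟨fun φ => functionalDeriv (H φ) n φ, ⟨fun φ σ u => ?_, ?_,
    fun φ h => ?_⟩⟩⟩
  · refine contDiff_iff_contDiffAt.2 fun t => ?_
    exact ((hH _).contDiff_line φ h).contDiffAt.congr_of_eventuallyEq (hline φ h t)
  · exact ((hH φ).isFunctionalDeriv n).symm φ σ u
  · refine continuous_iff_continuousAt.2 fun p => ?_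
    refine ((hH p.1).continuous_functionalDeriv n).continuousAt.congr ?_
    have := (continuous_fst (X := Config d) (Y := SmoothFun (Fin n → Euc d))).continuousAt
      (x := p) |>.eventually (key n p.1)
    filter_upwards [this] with q hq
    rw [hq]
  · rw [((hH φ).isFunctionalDeriv n).deriv_eq]
    have := hline φ h 0
    rw [zero_smul, add_zero] at this
    exact this.symm.iteratedDeriv_eq n

theorem IsSmoothFunctional.functionalDeriv_congr (hF : IsSmoothFunctional F)
    (hG : IsSmoothFunctional G) {φ : Config d} (h : F =ᶠ[𝓝 φ] G) (n : ℕ) :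
    functionalDeriv F n φ = functionalDeriv G n φ :=
  (hF.isFunctionalDeriv n).eq_of_eventuallyEq (hG.isFunctionalDeriv n) h

end Gluing

section Kernel

/-- `K` is a smooth symmetric kernel which can replace `P(x - y)` in pairings of distributions whose
supports are at distance at least `3r`. -/
structure IsSmoothReplacement (P : 𝓓'((⊤ : Opens (Euc d)), ℝ)) (r : ℝ)
    (K : SmoothFun (Euc d × Euc d)) : Prop where
  symm : ∀ x y, K (x, y) = K (y, x)
  contraction_eq : ∀ {k : ℕ} {A B : Set (Euc d)}, (∀ a ∈ A, ∀ b ∈ B, 3 * r ≤ ‖a - b‖) →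
    ∀ {T T' : CompDist (Fin k → Euc d)}, Distribution.dsupport T ⊆ pi univ (fun _ => A) →
    Distribution.dsupport T' ⊆ pi univ (fun _ => B) → (∃! c, IsContraction P T T' c) ∧
      contraction P T T' = CompDist.tens T T' (kerPow k K)

/-- The kernel is `p(x - y)`, symmetric because `p` is even. -/
theorem IsInvariantFundamentalSolution.exists_isSmoothReplacement {m : ℝ}
    {P : 𝓓'((⊤ : Opens (Euc d)), ℝ)} (hP : IsInvariantFundamentalSolution m P) {r : ℝ}
    (hr : 0 < r) : ∃ K, IsSmoothReplacement P r K := by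
  obtain ⟨p, hp, hp'⟩ := hP.exists_smooth hr
  refine ⟨diffKernel p, fun x y => ?_, fun hAB _ _ hT hT' => contraction_eq_tens hp' hr hAB hT hT'⟩
  rw [diffKernel_apply, diffKernel_apply, ← hp, neg_sub]

/-- A statement about all replacements with small `r` holds for one of them. -/
theorem IsInvariantFundamentalSolution.exists_of_eventually {m : ℝ}
    {P : 𝓓'((⊤ : Opens (Euc d)), ℝ)} (hP : IsInvariantFundamentalSolution m P)
    {q : SmoothFun (Euc d × Euc d) → Prop}
    (h : ∀ᶠ r in 𝓝[>] (0 : ℝ), ∀ K, IsSmoothReplacement P r K → q K) :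
    ∃ K, (∀ x y, K (x, y) = K (y, x)) ∧ q K := by
  obtain ⟨r, hr, hr0⟩ := (h.and self_mem_nhdsWithin).exists
  obtain ⟨K, hK⟩ := hP.exists_isSmoothReplacement hr0
  exact ⟨K, hK.symm, hr K hK⟩

variable {P : 𝓓'((⊤ : Opens (Euc d)), ℝ)}

/-- Functionals with disjoint supports are locally contracted by a smooth kernel. -/
theorem eventually_contraction_eq (hF : IsSmoothFunctional F) (hG : IsSmoothFunctional G)
    (hd : Disjoint (functionalSupport F) (functionalSupport G)) (k : ℕ) (φ₀ : Config d) :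
    ∀ᶠ r in 𝓝[>] (0 : ℝ), ∀ K, IsSmoothReplacement P r K → ∀ᶠ φ in 𝓝 φ₀,
      (∃! c, IsContraction P (functionalDeriv F k φ) (functionalDeriv G k φ) c) ∧
      contraction P (functionalDeriv F k φ) (functionalDeriv G k φ) = contr K k F G φ := by
  -- The support of `F` need not be compact, so the distance to that of `G` could be zero. Locally
  -- in `φ` only its part in a ball matters.
  obtain ⟨R, hR⟩ := CompDist.exists_dsupport_subset_of_continuous
    (hF.continuous_functionalDeriv k) φ₀
  have hd' : Disjoint (functionalSupport F ∩ Metric.closedBall 0 R) (functionalSupport G) :=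
    hd.mono_left inter_subset_left
  obtain ⟨δ, hδ, hδd⟩ := hd'.exists_thickenings
    ((isCompact_closedBall _ _).inter_left isClosed_closure) isClosed_closure
  -- With `r < δ / 3` the required separation `3r` stays below the thickening radius `δ`.
  filter_upwards [Ioo_mem_nhdsGT (show (0 : ℝ) < δ / 3 by positivity)] with r hr K hK
  filter_upwards [hR] with φ hφ
  refine hK.contraction_eq (A := functionalSupport F ∩ Metric.closedBall 0 R)
    (B := functionalSupport G) (fun a ha b hb => ?_) (fun x hx i _ => ⟨?_, ?_⟩)
    (hG.dsupport_functionalDeriv_subset k φ)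
  · by_contra! hab
    have h1 : b ∈ Metric.thickening δ (functionalSupport F ∩ Metric.closedBall 0 R) := by
      refine Metric.mem_thickening_iff.2 ⟨a, ha, ?_⟩
      rw [dist_comm, dist_eq_norm]
      linarith [hr.2]
    exact disjoint_left.1 hδd h1 (Metric.self_subset_thickening hδ _ hb)
  · exact hF.dsupport_functionalDeriv_subset k φ hx i (mem_univ i)
  · have h1 := hφ hx
    rw [mem_closedBall_zero_iff] at h1 ⊢
    exact (norm_le_pi_norm x i).trans h1

end Kernel

section Star

/-- The index set `k + i + j = n` of the coefficient of `ħⁿ` in a product. -/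
def starIndex (n : ℕ) : Finset ((_ : ℕ × ℕ) × (ℕ × ℕ)) :=
  (Finset.HasAntidiagonal.antidiagonal n).sigma fun p => Finset.HasAntidiagonal.antidiagonal p.2

/-- The product of formal power series defined by a smooth kernel. -/
def starProduct (K : SmoothFun (Euc d × Euc d)) (F G : ℕ → Config d → ℂ) (n : ℕ) : Config d → ℂ :=
  ∑ x ∈ starIndex n, (x.1.1.factorial : ℂ)⁻¹ • contr K x.1.1 (F x.2.1) (G x.2.2)

theorem mem_starIndex {x : (_ : ℕ × ℕ) × (ℕ × ℕ)} :
    x ∈ starIndex n ↔ x.1.1 + x.1.2 = n ∧ x.2.1 + x.2.2 = x.1.2 := by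
  simp [starIndex]

theorem timeOrderedProduct_apply (P : 𝓓'((⊤ : Opens (Euc d)), ℝ)) (F G : ℕ → Config d → ℂ) (n : ℕ)
    (φ : Config d) : timeOrderedProduct P F G n φ = ∑ x ∈ starIndex n, (x.1.1.factorial : ℂ)⁻¹ *
      contraction P (functionalDeriv (F x.2.1) x.1.1 φ) (functionalDeriv (G x.2.2) x.1.1 φ) := by
  rw [starIndex, Finset.sum_sigma, timeOrderedProduct,
    Finset.Nat.sum_antidiagonal_eq_sum_range_succ_mk]

variable {F G H : ℕ → Config d → ℂ} {P : 𝓓'((⊤ : Opens (Euc d)), ℝ)}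

theorem isSmoothFunctional_of_mem (hF : F ∈ FunctionalSeries d) (n : ℕ) :
    IsSmoothFunctional (F n) :=
  hF n (mem_univ n)

theorem isSmoothFunctional_star (hF : F ∈ FunctionalSeries d) (hG : G ∈ FunctionalSeries d)
    (K : SmoothFun (Euc d × Euc d)) (n : ℕ) : IsSmoothFunctional (starProduct K F G n) :=
  (Functionals d).sum_mem fun _ _ => (Functionals d).smul_mem _
    (isSmoothFunctional_contr (isSmoothFunctional_of_mem hF _) (isSmoothFunctional_of_mem hG _) K _)

theorem disjoint_functionalSupport (h : Disjoint (seriesSupport F) (seriesSupport G)) (i j : ℕ) :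
    Disjoint (functionalSupport (F i)) (functionalSupport (G j)) :=
  h.mono (subset_iUnion (fun n => functionalSupport (F n)) i)
    (subset_iUnion (fun n => functionalSupport (G n)) j)

/-- The product is locally given by smooth kernels. -/
theorem eventually_timeOrderedProduct_eq (h : (F, G) ∈ productDomain d) (n : ℕ) (φ₀ : Config d) :
    ∀ᶠ r in 𝓝[>] (0 : ℝ), ∀ K, IsSmoothReplacement P r K →
      timeOrderedProduct P F G n =ᶠ[𝓝 φ₀] starProduct K F G n := by
  -- Only finitely many contractions enter the coefficient of `ħⁿ`, so a common range of `r` exists.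
  have h1 := fun (x : (_ : ℕ × ℕ) × (ℕ × ℕ)) (_ : x ∈ starIndex n) => eventually_contraction_eq (P := P)
    (isSmoothFunctional_of_mem h.1 x.2.1) (isSmoothFunctional_of_mem h.2.1 x.2.2)
    (disjoint_functionalSupport h.2.2 _ _) x.1.1 φ₀
  filter_upwards [(Filter.eventually_all_finset _).2 h1] with r hr K hK
  filter_upwards [(Filter.eventually_all_finset _).2 fun x hx => hr x hx K hK] with φ hφ
  rw [timeOrderedProduct_apply, starProduct, Finset.sum_apply]
  exact Finset.sum_congr rfl fun x hx => congrArg _ (hφ x hx).2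

theorem existsUnique_isContraction {m : ℝ} (hP : IsInvariantFundamentalSolution m P)
    (h : (F, G) ∈ productDomain d) (i j k : ℕ) (φ : Config d) :
    ∃! c, IsContraction P (functionalDeriv (F i) k φ) (functionalDeriv (G j) k φ) c := by
  obtain ⟨K, -, hK⟩ := hP.exists_of_eventually (eventually_contraction_eq (P := P)
    (isSmoothFunctional_of_mem h.1 i) (isSmoothFunctional_of_mem h.2.1 j)
    (disjoint_functionalSupport h.2.2 _ _) k φ)
  exact hK.self_of_nhds.1

theorem timeOrderedProduct_mem {m : ℝ} (hP : IsInvariantFundamentalSolution m P)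
    (h : (F, G) ∈ productDomain d) : timeOrderedProduct P F G ∈ FunctionalSeries d := fun n _ =>
  isSmoothFunctional_of_locally fun φ => by
    obtain ⟨K, -, hK⟩ := hP.exists_of_eventually (eventually_timeOrderedProduct_eq h n φ)
    exact ⟨_, isSmoothFunctional_star h.1 h.2.1 K n, hK⟩

/-- The coefficient depends on `φ` only through derivatives of `Fᵢ` and `Gⱼ` with `i, j ≤ n`, and
these do not change along functions supported away from all the supports involved. -/
theorem functionalSupport_timeOrderedProduct_subset {m : ℝ}
    (hP : IsInvariantFundamentalSolution m P) (h : (F, G) ∈ productDomain d) (n : ℕ) :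
    functionalSupport (timeOrderedProduct P F G n) ⊆
      ⋃ i ∈ Finset.range (n + 1), (functionalSupport (F i) ∪ functionalSupport (G i)) := by
  refine IsSmoothFunctional.functionalSupport_subset (isSmoothFunctional_of_mem (timeOrderedProduct_mem hP h) n)
    (isClosed_biUnion_finset fun i _ => isClosed_closure.union isClosed_closure) fun g hg φ t => ?_
  rw [timeOrderedProduct_apply, timeOrderedProduct_apply]
  refine Finset.sum_congr rfl fun x hx => ?_
  have hx' := mem_starIndex.1 hx
  have h1 : ∀ i ≤ n, Disjoint (tsupport g) (functionalSupport (F i) ∪ functionalSupport (G i)) :=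
    fun i hi => hg.mono_right (subset_biUnion_of_mem
      (u := fun i => functionalSupport (F i) ∪ functionalSupport (G i))
      (Finset.mem_coe.2 (Finset.mem_range.2 (by omega))))
  rw [(isSmoothFunctional_of_mem h.1 _).functionalDeriv_add_smul
      ((h1 x.2.1 (by omega)).mono_right subset_union_left),
    (isSmoothFunctional_of_mem h.2.1 _).functionalDeriv_add_smul
      ((h1 x.2.2 (by omega)).mono_right subset_union_right)]

theorem isCompact_functionalSupport_timeOrderedProduct {m : ℝ}
    (hP : IsInvariantFundamentalSolution m P) (h : (F, G) ∈ productDomain d)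
    (hF : ∀ n, IsCompact (functionalSupport (F n))) (hG : ∀ n, IsCompact (functionalSupport (G n)))
    (n : ℕ) : IsCompact (functionalSupport (timeOrderedProduct P F G n)) :=
  ((Finset.range (n + 1)).isCompact_biUnion fun i _ => (hF i).union (hG i)).of_isClosed_subset
    isClosed_closure (functionalSupport_timeOrderedProduct_subset hP h n)

theorem productDomain_symm (h : (F, G) ∈ productDomain d) : (G, F) ∈ productDomain d :=
  ⟨h.2.1, h.1, h.2.2.symm⟩

theorem timeOrderedProduct_comm {m : ℝ} (hP : IsInvariantFundamentalSolution m P)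
    (h : (F, G) ∈ productDomain d) : timeOrderedProduct P F G = timeOrderedProduct P G F := by
  funext n φ
  -- One symmetric kernel has to serve for both orders of the factors.
  obtain ⟨K, hKs, hK⟩ := hP.exists_of_eventually (q := fun K => _ ∧ _)
    (((eventually_timeOrderedProduct_eq h n φ).and
      (eventually_timeOrderedProduct_eq (productDomain_symm h) n φ)).mono
        fun r hr K hK => ⟨hr.1 K hK, hr.2 K hK⟩)
  rw [hK.1.self_of_nhds, hK.2.self_of_nhds, starProduct, starProduct, Finset.sum_apply, Finset.sum_apply]
  refine Finset.sum_nbij' (fun x => ⟨x.1, x.2.swap⟩) (fun x => ⟨x.1, x.2.swap⟩)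
    (fun x hx => ?_) (fun x hx => ?_) (fun _ _ => rfl) (fun _ _ => rfl) fun x _ => ?_
  · rw [mem_starIndex] at hx ⊢
    exact ⟨hx.1, (add_comm _ _).trans hx.2⟩
  · rw [mem_starIndex] at hx ⊢
    exact ⟨hx.1, (add_comm _ _).trans hx.2⟩
  · rw [contr_comm _ _ hKs]
    rfl

end Star

end

/-! ### Bilinearity and associativity of the product of series -/

section

open SmoothFun

variable {d n : ℕ}

section Linear

/-- A contraction, as a linear functional of the left argument. -/
def contrLeft (K : SmoothFun (Euc d × Euc d)) (k : ℕ) (G : Config d → ℂ) (φ : Config d) :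
    Functionals d →ₗ[ℂ] ℂ where
  toFun F := contr K k F G φ
  map_add' F F' := by
    change CompDist.tens (functionalDeriv (F.1 + F'.1) k φ) _ _ = _
    rw [functionalDeriv_add F.2 F'.2, CompDist.tens_apply]
    simp only [contr, CompDist.tens_apply, _root_.add_apply]
    ring
  map_smul' c F := by
    change CompDist.tens (functionalDeriv (c • F.1) k φ) _ _ = _
    rw [functionalDeriv_smul F.2, CompDist.tens_apply]
    simp only [contr, CompDist.tens_apply, _root_.smul_apply, smul_eq_mul,
      RingHom.id_apply]
    ring

theorem contr_sum_left (K : SmoothFun (Euc d × Euc d)) (k : ℕ) (G : Config d → ℂ) (φ : Config d)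
    {ι : Type*} (s : Finset ι) (c : ι → ℂ) {F : ι → Config d → ℂ}
    (hF : ∀ i, IsSmoothFunctional (F i)) :
    contr K k (∑ i ∈ s, c i • F i) G φ = ∑ i ∈ s, c i * contr K k (F i) G φ := by
  have h := map_sum (contrLeft K k G φ) (fun i => c i • (⟨F i, hF i⟩ : Functionals d)) s
  simp only [map_smul] at h
  rw [show ∑ i ∈ s, c i • F i = ((∑ i ∈ s, c i • (⟨F i, hF i⟩ : Functionals d) :
    Functionals d) : Config d → ℂ) by simp only [Submodule.coe_sum, Submodule.coe_smul]]
  exact h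

theorem contr_add_smul_left (K : SmoothFun (Euc d × Euc d)) (k : ℕ) (G : Config d → ℂ)
    (φ : Config d) (a b : ℂ) {F F' : Config d → ℂ} (hF : IsSmoothFunctional F)
    (hF' : IsSmoothFunctional F') :
    contr K k (a • F + b • F') G φ = a * contr K k F G φ + b * contr K k F' G φ := by
  have h := (contrLeft K k G φ).map_add (a • (⟨F, hF⟩ : Functionals d)) (b • ⟨F', hF'⟩)
  rw [map_smul, map_smul] at h
  exact h

/-- The transposed kernel. -/
theorem contr_swap (K : SmoothFun (Euc d × Euc d)) (k : ℕ) (F G : Config d → ℂ) :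
    contr K k F G = contr (SmoothFun.swap K) k G F := by
  funext φ
  rw [contr, CompDist.tens_swap]
  rfl

theorem contr_sum_right (K : SmoothFun (Euc d × Euc d)) (k : ℕ) (F : Config d → ℂ) (φ : Config d)
    {ι : Type*} (s : Finset ι) (c : ι → ℂ) {G : ι → Config d → ℂ}
    (hG : ∀ i, IsSmoothFunctional (G i)) :
    contr K k F (∑ i ∈ s, c i • G i) φ = ∑ i ∈ s, c i * contr K k F (G i) φ := by
  simp only [contr_swap K k F, contr_sum_left _ _ _ _ _ _ hG]

end Linear

section Series

variable {F F' G H : ℕ → Config d → ℂ} {P : 𝓓'((⊤ : Opens (Euc d)), ℝ)} {m : ℝ}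

theorem productDomain_add_smul (h : (F, G) ∈ productDomain d) (h' : (F', G) ∈ productDomain d)
    (a b : ℂ) : (a • F + b • F', G) ∈ productDomain d := by
  have hm : a • F + b • F' ∈ FunctionalSeries d :=
    (FunctionalSeries d).add_mem ((FunctionalSeries d).smul_mem a h.1)
      ((FunctionalSeries d).smul_mem b h'.1)
  refine ⟨hm, h.2.1, (h.2.2.union_left h'.2.2).mono_left (iUnion_subset fun n => ?_)⟩
  have h1 : functionalSupport ((a • F + b • F') n) ⊆
      functionalSupport (F n) ∪ functionalSupport (F' n) := by
    refine IsSmoothFunctional.functionalSupport_subset (isSmoothFunctional_of_mem hm n)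
      (isClosed_closure.union isClosed_closure) fun g hg φ t => ?_
    change a * F n _ + b * F' n _ = a * F n _ + b * F' n _
    rw [(isSmoothFunctional_of_mem (F := F) h.1 n).apply_add_smul (hg.mono_right subset_union_left),
      (isSmoothFunctional_of_mem (F := F') h'.1 n).apply_add_smul (hg.mono_right subset_union_right)]
  exact h1.trans (union_subset_union (subset_iUnion (fun n => functionalSupport (F n)) n)
    (subset_iUnion (fun n => functionalSupport (F' n)) n))

theorem timeOrderedProduct_add_smul_left (hP : IsInvariantFundamentalSolution m P)
    (h : (F, G) ∈ productDomain d) (h' : (F', G) ∈ productDomain d) (a b : ℂ) :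
    timeOrderedProduct P (a • F + b • F') G =
      a • timeOrderedProduct P F G + b • timeOrderedProduct P F' G := by
  funext n φ
  obtain ⟨K, -, h1, h2, h3⟩ := hP.exists_of_eventually (q := fun K => _ ∧ _ ∧ _)
    (((eventually_timeOrderedProduct_eq (productDomain_add_smul h h' a b) n φ).and
      ((eventually_timeOrderedProduct_eq h n φ).and
        (eventually_timeOrderedProduct_eq h' n φ))).mono
          fun r hr K hK => ⟨hr.1 K hK, hr.2.1 K hK, hr.2.2 K hK⟩)
  change _ = a * timeOrderedProduct P F G n φ + b * timeOrderedProduct P F' G n φ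
  rw [h1.self_of_nhds, h2.self_of_nhds, h3.self_of_nhds]
  simp only [starProduct, Finset.sum_apply, Finset.mul_sum, ← Finset.sum_add_distrib]
  refine Finset.sum_congr rfl fun x _ => ?_
  change _ * contr K x.1.1 (a • F x.2.1 + b • F' x.2.1) (G x.2.2) φ =
    a * (_ * contr K x.1.1 (F x.2.1) (G x.2.2) φ) + b * (_ * contr K x.1.1 (F' x.2.1) (G x.2.2) φ)
  rw [contr_add_smul_left _ _ _ _ _ _ (isSmoothFunctional_of_mem h.1 _)
    (isSmoothFunctional_of_mem h'.1 _)]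
  ring

theorem starProduct_starProduct_left (hF : F ∈ FunctionalSeries d) (hG : G ∈ FunctionalSeries d)
    (K : SmoothFun (Euc d × Euc d)) (H : ℕ → Config d → ℂ) (n : ℕ) (φ : Config d) :
    starProduct K (starProduct K F G) H n φ =
      ∑ x ∈ starIndex n, ∑ y ∈ starIndex x.2.1,
        ((x.1.1.factorial : ℂ)⁻¹ * (y.1.1.factorial : ℂ)⁻¹) *
          contr K x.1.1 (contr K y.1.1 (F y.2.1) (G y.2.2)) (H x.2.2) φ := by
  rw [starProduct, Finset.sum_apply]
  refine Finset.sum_congr rfl fun x _ => ?_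
  rw [Pi.smul_apply, starProduct, contr_sum_left _ _ _ _ _ _ fun y => isSmoothFunctional_contr
    (isSmoothFunctional_of_mem hF _) (isSmoothFunctional_of_mem hG _) _ _, smul_eq_mul,
    Finset.mul_sum]
  exact Finset.sum_congr rfl fun y _ => (mul_assoc _ _ _).symm

theorem starProduct_starProduct_right (hG : G ∈ FunctionalSeries d) (hH : H ∈ FunctionalSeries d)
    (K : SmoothFun (Euc d × Euc d)) (F : ℕ → Config d → ℂ) (n : ℕ) (φ : Config d) :
    starProduct K F (starProduct K G H) n φ =
      ∑ x ∈ starIndex n, ∑ y ∈ starIndex x.2.2,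
        ((x.1.1.factorial : ℂ)⁻¹ * (y.1.1.factorial : ℂ)⁻¹) *
          contr K x.1.1 (F x.2.1) (contr K y.1.1 (G y.2.1) (H y.2.2)) φ := by
  rw [starProduct, Finset.sum_apply]
  refine Finset.sum_congr rfl fun x _ => ?_
  rw [Pi.smul_apply, starProduct, contr_sum_right _ _ _ _ _ _ fun y => isSmoothFunctional_contr
    (isSmoothFunctional_of_mem hG _) (isSmoothFunctional_of_mem hH _) _ _, smul_eq_mul,
    Finset.mul_sum]
  exact Finset.sum_congr rfl fun y _ => (mul_assoc _ _ _).symm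

/-- In the nested product `k` counts outer and `k'` inner contractions. Both bracketings are
regrouped by the total `k + k'` and the orders of the three series; the inner sum is then the one
treated by `sum_contr_contr`. -/
theorem sum_starIndex_left {M : Type*} [AddCommMonoid M] (S : ℕ → ℕ → ℕ → ℕ → ℕ → M) (n : ℕ) :
    ∑ x ∈ starIndex n, ∑ y ∈ starIndex x.2.1, S x.1.1 y.1.1 y.2.1 y.2.2 x.2.2 =
      ∑ x ∈ starIndex n, ∑ q ∈ Finset.HasAntidiagonal.antidiagonal x.2.2,
        ∑ p ∈ Finset.HasAntidiagonal.antidiagonal x.1.1, S p.1 p.2 x.2.1 q.1 q.2 := by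
  simp only [Finset.sum_sigma']
  refine Finset.sum_nbij'
    (fun z => ⟨⟨(z.1.1.1 + z.2.1.1, z.2.1.2 + z.1.2.2), (z.2.2.1, z.2.2.2 + z.1.2.2)⟩,
      (z.2.2.2, z.1.2.2), (z.1.1.1, z.2.1.1)⟩)
    (fun z => ⟨⟨(z.2.2.1, z.2.2.2 + z.1.1.2), (z.2.2.2 + z.1.2.1 + z.2.1.1, z.2.1.2)⟩,
      ⟨(z.2.2.2, z.1.2.1 + z.2.1.1), (z.1.2.1, z.2.1.1)⟩⟩) ?_ ?_ ?_ ?_ fun _ _ => rfl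
  · rintro ⟨⟨⟨k, l⟩, i, j⟩, ⟨k', l'⟩, i', j'⟩ h
    simp only [Finset.mem_sigma, mem_starIndex, Finset.HasAntidiagonal.mem_antidiagonal] at h ⊢
    grind
  · rintro ⟨⟨⟨k, l⟩, i, j⟩, ⟨q, q'⟩, p, p'⟩ h
    simp only [Finset.mem_sigma, mem_starIndex, Finset.HasAntidiagonal.mem_antidiagonal] at h ⊢
    grind
  · rintro ⟨⟨⟨k, l⟩, i, j⟩, ⟨k', l'⟩, i', j'⟩ h
    simp only [Finset.mem_sigma, mem_starIndex] at h
    obtain ⟨⟨rfl, rfl⟩, h3, h4⟩ := h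
    subst h3 h4
    simp [add_assoc]
  · rintro ⟨⟨⟨k, l⟩, i, j⟩, ⟨q, q'⟩, p, p'⟩ h
    simp only [Finset.mem_sigma, mem_starIndex, Finset.HasAntidiagonal.mem_antidiagonal] at h
    obtain ⟨⟨rfl, rfl⟩, rfl, rfl⟩ := h
    simp [add_assoc]

theorem sum_starIndex_right {M : Type*} [AddCommMonoid M] (S : ℕ → ℕ → ℕ → ℕ → ℕ → M) (n : ℕ) :
    ∑ x ∈ starIndex n, ∑ y ∈ starIndex x.2.2, S x.1.1 y.1.1 x.2.1 y.2.1 y.2.2 =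
      ∑ x ∈ starIndex n, ∑ q ∈ Finset.HasAntidiagonal.antidiagonal x.2.2,
        ∑ p ∈ Finset.HasAntidiagonal.antidiagonal x.1.1, S p.1 p.2 x.2.1 q.1 q.2 := by
  simp only [Finset.sum_sigma']
  refine Finset.sum_nbij'
    (fun z => ⟨⟨(z.1.1.1 + z.2.1.1, z.1.2.1 + z.2.1.2), (z.1.2.1, z.2.1.2)⟩,
      (z.2.2.1, z.2.2.2), (z.1.1.1, z.2.1.1)⟩)
    (fun z => ⟨⟨(z.2.2.1, z.2.2.2 + z.1.1.2), (z.1.2.1, z.2.2.2 + z.1.2.2)⟩,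
      ⟨(z.2.2.2, z.1.2.2), (z.2.1.1, z.2.1.2)⟩⟩) ?_ ?_ ?_ ?_ fun _ _ => rfl
  · rintro ⟨⟨⟨k, l⟩, i, j⟩, ⟨k', l'⟩, i', j'⟩ h
    simp only [Finset.mem_sigma, mem_starIndex, Finset.HasAntidiagonal.mem_antidiagonal] at h ⊢
    grind
  · rintro ⟨⟨⟨k, l⟩, i, j⟩, ⟨q, q'⟩, p, p'⟩ h
    simp only [Finset.mem_sigma, mem_starIndex, Finset.HasAntidiagonal.mem_antidiagonal] at h ⊢
    grind
  · rintro ⟨⟨⟨k, l⟩, i, j⟩, ⟨k', l'⟩, i', j'⟩ h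
    simp only [Finset.mem_sigma, mem_starIndex] at h
    obtain ⟨⟨rfl, rfl⟩, h3, h4⟩ := h
    subst h3 h4
    simp [add_left_comm]
  · rintro ⟨⟨⟨k, l⟩, i, j⟩, ⟨q, q'⟩, p, p'⟩ h
    simp only [Finset.mem_sigma, mem_starIndex, Finset.HasAntidiagonal.mem_antidiagonal] at h
    obtain ⟨⟨rfl, rfl⟩, rfl, rfl⟩ := h
    simp

theorem starProduct_assoc (hF : F ∈ FunctionalSeries d) (hG : G ∈ FunctionalSeries d)
    (hH : H ∈ FunctionalSeries d) (K : SmoothFun (Euc d × Euc d)) (n : ℕ) (φ : Config d) :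
    starProduct K (starProduct K F G) H n φ = starProduct K F (starProduct K G H) n φ := by
  rw [starProduct_starProduct_left hF hG, starProduct_starProduct_right hG hH,
    sum_starIndex_left (fun k k' i j l => ((k.factorial : ℂ)⁻¹ * (k'.factorial : ℂ)⁻¹) *
      contr K k (contr K k' (F i) (G j)) (H l) φ),
    sum_starIndex_right (fun k k' i j l => ((k.factorial : ℂ)⁻¹ * (k'.factorial : ℂ)⁻¹) *
      contr K k (F i) (contr K k' (G j) (H l)) φ)]
  exact Finset.sum_congr rfl fun x _ => Finset.sum_congr rfl fun q _ =>
    sum_contr_contr (isSmoothFunctional_of_mem hF _) (isSmoothFunctional_of_mem hG _)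
      (isSmoothFunctional_of_mem hH _) K _ φ

/-- Equality of germs at `φ` is required, as the outer contraction differentiates its factors. -/
theorem starProduct_congr_left (hF : F ∈ FunctionalSeries d) (hF' : F' ∈ FunctionalSeries d)
    (K : SmoothFun (Euc d × Euc d)) (G : ℕ → Config d → ℂ) {n : ℕ} {φ : Config d}
    (h : ∀ i ∈ Finset.range (n + 1), F i =ᶠ[𝓝 φ] F' i) :
    starProduct K F G n φ = starProduct K F' G n φ := by
  rw [starProduct, starProduct, Finset.sum_apply, Finset.sum_apply]
  refine Finset.sum_congr rfl fun x hx => ?_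
  have hx' := mem_starIndex.1 hx
  rw [Pi.smul_apply, Pi.smul_apply, contr, contr,
    (isSmoothFunctional_of_mem hF _).functionalDeriv_congr
    (isSmoothFunctional_of_mem hF' _) (h x.2.1 (Finset.mem_range.2 (by omega)))]

theorem starProduct_congr_right (hG : G ∈ FunctionalSeries d) (hH : H ∈ FunctionalSeries d)
    (K : SmoothFun (Euc d × Euc d)) (F : ℕ → Config d → ℂ) {n : ℕ} {φ : Config d}
    (h : ∀ i ∈ Finset.range (n + 1), G i =ᶠ[𝓝 φ] H i) :
    starProduct K F G n φ = starProduct K F H n φ := by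
  rw [starProduct, starProduct, Finset.sum_apply, Finset.sum_apply]
  refine Finset.sum_congr rfl fun x hx => ?_
  have hx' := mem_starIndex.1 hx
  rw [Pi.smul_apply, Pi.smul_apply, contr, contr,
    (isSmoothFunctional_of_mem hG _).functionalDeriv_congr
    (isSmoothFunctional_of_mem hH _) (h x.2.2 (Finset.mem_range.2 (by omega)))]

theorem timeOrderedProduct_mem_productDomain (hP : IsInvariantFundamentalSolution m P)
    (hFG : (F, G) ∈ productDomain d) (hGH : (G, H) ∈ productDomain d)
    (hFH : (F, H) ∈ productDomain d) : (timeOrderedProduct P F G, H) ∈ productDomain d := by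
  refine ⟨timeOrderedProduct_mem hP hFG, hGH.2.1,
    (hFH.2.2.union_left hGH.2.2).mono_left (iUnion_subset fun n => ?_)⟩
  refine (functionalSupport_timeOrderedProduct_subset hP hFG n).trans
    (iUnion₂_subset fun i _ => ?_)
  exact union_subset_union (subset_iUnion (fun n => functionalSupport (F n)) i)
    (subset_iUnion (fun n => functionalSupport (G n)) i)

/-- At a given `n` and `φ` all products involved are expressed by one smooth kernel, for which
associativity is known. -/
theorem timeOrderedProduct_assoc (hP : IsInvariantFundamentalSolution m P)
    (hFG : (F, G) ∈ productDomain d) (hGH : (G, H) ∈ productDomain d)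
    (hFH : (F, H) ∈ productDomain d) :
    timeOrderedProduct P (timeOrderedProduct P F G) H =
      timeOrderedProduct P F (timeOrderedProduct P G H) := by
  have hl := timeOrderedProduct_mem_productDomain hP hFG hGH hFH
  have hr := productDomain_symm (timeOrderedProduct_mem_productDomain hP hGH
    (productDomain_symm hFH) (productDomain_symm hFG))
  funext n φ
  have hl' := (Filter.eventually_all_finset (Finset.range (n + 1))).2 fun i _ =>
    eventually_timeOrderedProduct_eq (P := P) hFG i φ
  have hr' := (Filter.eventually_all_finset (Finset.range (n + 1))).2 fun i _ =>
    eventually_timeOrderedProduct_eq (P := P) hGH i φ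
  -- The outer products are needed only at `φ`, the inner ones on a neighbourhood and for all orders
  -- up to `n`.
  obtain ⟨K, -, h1, h2, h3, h4⟩ := hP.exists_of_eventually (q := fun K => _ ∧ _ ∧
    (∀ i ∈ Finset.range (n + 1), timeOrderedProduct P F G i =ᶠ[𝓝 φ] starProduct K F G i) ∧
    (∀ i ∈ Finset.range (n + 1), timeOrderedProduct P G H i =ᶠ[𝓝 φ] starProduct K G H i))
    (((eventually_timeOrderedProduct_eq hl n φ).and
      ((eventually_timeOrderedProduct_eq hr n φ).and (hl'.and hr'))).mono
        fun r h K hK => ⟨h.1 K hK, h.2.1 K hK, fun i hi => h.2.2.1 i hi K hK,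
          fun i hi => h.2.2.2 i hi K hK⟩)
  rw [h1.self_of_nhds, h2.self_of_nhds,
    starProduct_congr_left hl.1 (fun i _ => isSmoothFunctional_star hFG.1 hFG.2.1 K i) K H h3,
    starProduct_congr_right hr.2.1 (fun i _ => isSmoothFunctional_star hGH.1 hGH.2.1 K i) K F h4,
    starProduct_assoc hFG.1 hFG.2.1 hFH.2.1]

end Series

end

end

/-! ### The proposition -/

theorem mainTheorem1 (d : ℕ) (m : ℝ) (P : 𝓓'((⊤ : TopologicalSpace.Opens (Euc d)), ℝ))
    (hP : IsInvariantFundamentalSolution m P) :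
    -- the product is well-defined on the domain, and its values are functionals of compact support
    (∀ F G : ℕ → Config d → ℂ, (F, G) ∈ productDomain d →
      (∀ i j k φ, ∃! c : ℂ,
        IsContraction P (functionalDeriv (F i) k φ) (functionalDeriv (G j) k φ) c) ∧
      timeOrderedProduct P F G ∈ FunctionalSeries d ∧
      (∀ n, functionalSupport (timeOrderedProduct P F G n) ⊆
        ⋃ i ∈ Finset.range (n + 1), (functionalSupport (F i) ∪ functionalSupport (G i))) ∧
      ((∀ n, IsCompact (functionalSupport (F n))) → (∀ n, IsCompact (functionalSupport (G n))) →
        ∀ n, IsCompact (functionalSupport (timeOrderedProduct P F G n)))) ∧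
    -- it is bilinear
    (∀ (F F' G : ℕ → Config d → ℂ) (a b : ℂ),
      (F, G) ∈ productDomain d → (F', G) ∈ productDomain d →
      (a • F + b • F', G) ∈ productDomain d ∧ (G, a • F + b • F') ∈ productDomain d ∧
      timeOrderedProduct P (a • F + b • F') G =
        a • timeOrderedProduct P F G + b • timeOrderedProduct P F' G ∧
      timeOrderedProduct P G (a • F + b • F') =
        a • timeOrderedProduct P G F + b • timeOrderedProduct P G F') ∧
    -- it is commutative
    (∀ F G : ℕ → Config d → ℂ, (F, G) ∈ productDomain d →
      (G, F) ∈ productDomain d ∧ timeOrderedProduct P F G = timeOrderedProduct P G F) ∧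
    -- it is associative
    (∀ F G H : ℕ → Config d → ℂ, (F, G) ∈ productDomain d → (G, H) ∈ productDomain d →
      (F, H) ∈ productDomain d →
      (timeOrderedProduct P F G, H) ∈ productDomain d ∧
      (F, timeOrderedProduct P G H) ∈ productDomain d ∧
      timeOrderedProduct P (timeOrderedProduct P F G) H =
        timeOrderedProduct P F (timeOrderedProduct P G H)) := by
  refine ⟨fun F G h => ⟨fun i j k φ => existsUnique_isContraction hP h i j k φ,
      timeOrderedProduct_mem hP h, functionalSupport_timeOrderedProduct_subset hP h,
      isCompact_functionalSupport_timeOrderedProduct hP h⟩,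
    fun F F' G a b h h' => ?_,
    fun F G h => ⟨productDomain_symm h, timeOrderedProduct_comm hP h⟩,
    fun F G H hFG hGH hFH => ⟨timeOrderedProduct_mem_productDomain hP hFG hGH hFH,
      productDomain_symm (timeOrderedProduct_mem_productDomain hP hGH
        (productDomain_symm hFH) (productDomain_symm hFG)),
      timeOrderedProduct_assoc hP hFG hGH hFH⟩⟩
  have hs := productDomain_add_smul h h' a b
  have hl := timeOrderedProduct_add_smul_left hP h h' a b
  refine ⟨hs, productDomain_symm hs, hl, ?_⟩
  -- Linearity in the second argument follows from the first by commutativity.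
  rw [← timeOrderedProduct_comm hP hs, hl, timeOrderedProduct_comm hP h,
    timeOrderedProduct_comm hP h']
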